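/- **Racks and shadows.** A rack is a set $R$ with operations $\rhd,\rhd^{-1}$ such that $(x\rhd y)\rhd^{-1}y=x=(x\rhd^{-1}y)\rhd y$ and $(x\rhd y)\rhd z=(x\rhd z)\rhd(y\rhd z)$. Let $R$ be a finite rack and let $N$ be its rack rank, i.e. the order of the diagonal permutation $x\mapsto x\rhd x$. An $R$-shadow is a set $X$ with a bijection $x\mapsto x\cdot r$ of $X$ for every $r\in R$ such that $(x\cdot r_1)\cdot r_2=(x\cdot r_2)\cdot(r_1\rhd r_2)$. Let $X$ be a finite $R$-shadow, put $r(x)=|\{r\in R: x\cdot r=x\}|$, and for $S\subset X$ put $\mathrm{ssp}_{S\subset X}(t)=\sum_{x\in S}t^{r(x)}\in\mathbb Z[t]$. **Links.** Oriented links with $k$ ordered components are represented by oriented link diagrams in the plane (in general position with respect to the height function, hence built from minima, maxima and crossings). Two diagrams represent ambient isotopic links if they are connected by a finite sequence of planar isotopies and Reidemeister moves I, II, III. The framed Reidemeister moves are II, III and the framed move I, which replaces a curl on one side of a strand by a curl of the same sign on the other side. The writhe vector of a diagram is $(w(L_1),\dots,w(L_k))$, where $w(L_i)$ is the sum of the signs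 of the self-crossings of the $i$-th component. **Shadow colorings.** A shadow coloring $f$ of a diagram assigns an element of $R$ to every arc and an element of $X$ to every region of the plane. At a crossing with over-arc colored $y$, if the under-arc on the right of the over-arc is colored $x$, then the under-arc on its left is colored $x\rhd y$. Along an arc colored $r$, if the region on its right is colored $x$, then the region on its left is colored $x\cdot r$. The image subrack $\mathrm{Im}(f)$ is the subrack generated by the colors of the arcs, and the shadow image $\mathrm{si}(f)\subset X$ is the closure of the set of colors of the regions under the action of $\mathrm{Im}(f)$. **Theorem.** 1. Let the diagram $D'$ arise from $D$ by a planar isotopy move or a framed Reidemeister move. Then for every shadow coloring $f$ of $D$ there is exactly one shadow coloring $f'$ of $D'$ that agrees with $f$ outside of the part of the diagram changed by the move, and $f\mapsto f'$ is a bijection. Moreover $\mathrm{si}(f')=\mathrm{si}(f)$, and hence $\mathrm{ssp}_{\mathrm{si}(f')\subset X}(t)=\mathrm{ssp}_{\mathrm{si}(f)\subset X}(t)$. 2. For every oriented link $L$ with $k$ ordered components and every $\mathbf w\in(\mathbb Z_N)^k$ there is a diagram $(L,\mathbf w)$ of $L$ whose writhe vector is congruent to $\mathbf w$ modulo $N$.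 3. Choose such a diagram $(L,\mathbf w)$ for every $\mathbf w\in(\mathbb Z_N)^k$. Let $\Phi(L)$ be the multiset of all pairs $$\bigl(\mathrm{ssp}_{\mathrm{si}(f)\subset X}(t),\ \mathbf w\bigr),\qquad \mathbf w\in(\mathbb Z_N)^k,\quad f\text{ a shadow coloring of }(L,\mathbf w),$$ and let $$\mathrm{sp}(L)=\sum_{\mathbf w\in(\mathbb Z_N)^k}\ \sum_{f}z^{\mathrm{ssp}_{\mathrm{si}(f)\subset X}(t)}\,q^{\mathbf w},\qquad q^{\mathbf w}=\prod_{i=1}^kq_i^{w_i}\quad(0\le w_i<N),$$ where $f$ runs over the shadow colorings of $(L,\mathbf w)$ and the $z^p$, $p\in\mathbb Z[t]$, are formal symbols. If $L$ and $L'$ are ambient isotopic (respecting the orientations and the order of the components), then $\Phi(L)=\Phi(L')$ and $\mathrm{sp}(L)=\mathrm{sp}(L')$, for all choices of the diagrams $(L,\mathbf w)$ and $(L',\mathbf w)$. In particular $\Phi(L)$ and $\mathrm{sp}(L)$ are well-defined invariants of $L$ up to ambient isotopy. -/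

import Mathlib

open scoped Quandles

namespace ShadowLink

/-! ## Racks and rack shadows

Mathlib's rack operation `y ◃ x` (the element `y` acting on `x`) is `x ▷ y` in the right-handed
notation. -/

/-- A rack action of `R` on `X`: a bijection `x ↦ x · r` of `X` for every `r : R` (here `act r`),
with `(x · r₁) · r₂ = (x · r₂) · (r₁ ▷ r₂)`. -/
class RackShadow (R : Type*) (X : Type*) [Rack R] where
  act : R → Equiv.Perm X
  act_act : ∀ (r₁ r₂ : R) (x : X), act r₂ (act r₁ x) = act (r₂ ◃ r₁) (act r₂ x)

/-- The rack rank: the order of the diagonal permutation `x ↦ x ▷ x`. -/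
noncomputable def rackRank (R : Type*) [Rack R] : ℕ :=
  orderOf (Rack.selfApplyEquiv R : Equiv.Perm R)

instance (R : Type*) [Rack R] [Finite R] : NeZero (rackRank R) :=
  ⟨(orderOf_pos (Rack.selfApplyEquiv R : Equiv.Perm R)).ne'⟩

/-- The number of `r : R` with `x · r = x`. -/
noncomputable def fixCount (R : Type*) {X : Type*} [Rack R] [RackShadow R X] (x : X) : ℕ :=
  Nat.card {r : R // RackShadow.act r x = x}

open Classical in
/-- The subshadow polynomial `∑_{x ∈ S} t ^ r(x)`. -/
noncomputable def subshadowPoly (R : Type*) {X : Type*} [Rack R] [RackShadow R X] [Fintype X]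
    (S : Set X) : Polynomial ℤ :=
  ∑ x : X with x ∈ S, Polynomial.X ^ fixCount R x

/-! ## Oriented link diagrams with `k` ordered components

A diagram in the plane in general position with respect to the height function is recorded by
reading it from bottom to top: between consecutive levels there is exactly one minimum, maximum or
crossing, and all the other strands run vertically. -/

/-- A strand of a diagram meeting a horizontal level: the component it belongs to, and whether it
is oriented upwards. -/
@[ext] structure Strand (k : ℕ) where
  comp : Fin k
  up : Bool

/-- The same strand with the opposite direction. -/
def Strand.rev {k : ℕ} (s : Strand k) : Strand k := ⟨s.comp, !s.up⟩

/-- The elementary pieces: a minimum (`cup`) with left branch `s`, a maximum (`cap`) with left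
branch `s`, and a crossing of the strand `a`, running from bottom left to top right, with the
strand `b`, running from bottom right to top left; `a` is the over-strand if `o = true`, and
`b` is the over-strand if `o = false`. -/
inductive Elem (k : ℕ) where
  | cup (s : Strand k)
  | cap (s : Strand k)
  | cross (a b : Strand k) (o : Bool)

/-- The strands at the bottom of an elementary piece, from left to right. -/
def Elem.bot {k : ℕ} : Elem k → List (Strand k)
  | cup _ => []
  | cap s => [s, s.rev]
  | cross a b _ => [a, b]

/-- The strands at the top of an elementary piece, from left to right. -/
def Elem.top {k : ℕ} : Elem k → List (Strand k)
  | cup s => [s, s.rev]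
  | cap _ => []
  | cross a b _ => [b, a]

/-- The sign of a strand: `1` if it is directed upwards, `-1` if downwards. -/
def Strand.sign {k : ℕ} (s : Strand k) : ℤ := if s.up then 1 else -1

/-- The contribution of an elementary piece to the writhe of component `i`: the sign of the
crossing if it is a crossing of component `i` with itself. -/
def Elem.selfWrithe {k : ℕ} (i : Fin k) : Elem k → ℤ
  | cup _ => 0
  | cap _ => 0
  | cross a b o =>
      if a.comp = i ∧ b.comp = i then (if o then 1 else -1) * a.sign * b.sign else 0

/-- How the end points of an elementary piece are joined inside it. End points are numbered from
left to right, `Sum.inl j` at the bottom and `Sum.inr j` at the top. -/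
inductive Elem.Joins {k : ℕ} : Elem k → ℕ ⊕ ℕ → ℕ ⊕ ℕ → Prop
  | cup (s : Strand k) : Joins (.cup s) (.inr 0) (.inr 1)
  | cap (s : Strand k) : Joins (.cap s) (.inl 0) (.inl 1)
  | cross_left (a b : Strand k) (o : Bool) : Joins (.cross a b o) (.inl 0) (.inr 1)
  | cross_right (a b : Strand k) (o : Bool) : Joins (.cross a b o) (.inl 1) (.inr 0)

/-- A horizontal slice of a diagram: one elementary piece with vertical strands on both sides. -/
structure Slice (k : ℕ) where
  left : List (Strand k)
  elem : Elem k
  right : List (Strand k)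

namespace Slice

variable {k : ℕ}

def bot (σ : Slice k) : List (Strand k) := σ.left ++ σ.elem.bot ++ σ.right

def top (σ : Slice k) : List (Strand k) := σ.left ++ σ.elem.top ++ σ.right

/-- Add further vertical strands `u` on the left and `v` on the right. -/
def whisker (u v : List (Strand k)) (σ : Slice k) : Slice k := ⟨u ++ σ.left, σ.elem, σ.right ++ v⟩

/-- How the end points of a slice are joined inside the slice. -/
inductive Joins (σ : Slice k) : ℕ ⊕ ℕ → ℕ ⊕ ℕ → Prop
  | left (j : ℕ) (h : j < σ.left.length) : Joins σ (.inl j) (.inr j)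
  | elem {p q : ℕ ⊕ ℕ} (h : σ.elem.Joins p q) :
      Joins σ (Sum.map (σ.left.length + ·) (σ.left.length + ·) p)
        (Sum.map (σ.left.length + ·) (σ.left.length + ·) q)
  | right (j : ℕ) (h : j < σ.right.length) :
      Joins σ (.inl (σ.left.length + σ.elem.bot.length + j))
        (.inr (σ.left.length + σ.elem.top.length + j))

end Slice

/-- The slices of `w` fit on top of each other and lead from the strands `S` to the strands `T`. -/
def IsPath {k : ℕ} : List (Strand k) → List (Slice k) → List (Strand k) → Prop
  | S, [], T => S = T
  | S, σ :: w, T => σ.bot = S ∧ IsPath σ.top w T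

/-- The points `(i, j)` of a word of slices (`j`-th strand at level `i`) carrying strand `s`;
level `0`, at the bottom, has no strands, and level `i + 1` is the top of slice `i`. -/
def HasStrand {k : ℕ} (w : List (Slice k)) (P : ℕ × ℕ) (s : Strand k) : Prop :=
  ∃ S : List (Strand k), ([] :: w.map Slice.top)[P.1]? = some S ∧ S[P.2]? = some s

/-- The point of the diagram given by an end point of slice `i`. -/
def slicePoint (i : ℕ) : ℕ ⊕ ℕ → ℕ × ℕ
  | .inl j => (i, j)
  | .inr j => (i + 1, j)

/-- Two points are joined by a piece of the diagram inside one slice. -/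
def Adjacent {k : ℕ} (w : List (Slice k)) (P Q : ℕ × ℕ) : Prop :=
  ∃ (i : ℕ) (σ : Slice k) (p q : ℕ ⊕ ℕ),
    w[i]? = some σ ∧ σ.Joins p q ∧ P = slicePoint i p ∧ Q = slicePoint i q

/-- An oriented link diagram with `k` ordered components: a closed stack of slices in which the
strands labelled `i`, for each `i : Fin k`, form exactly one closed curve. -/
structure LinkDiagram (k : ℕ) where
  word : List (Slice k)
  isPath : IsPath [] word []
  comp_nonempty : ∀ i : Fin k, ∃ P s, HasStrand word P s ∧ s.comp = i
  comp_connected : ∀ P Q s t, HasStrand word P s → HasStrand word Q t → s.comp = t.comp →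
    Relation.EqvGen (Adjacent word) P Q

/-- The writhe of the `i`-th component of a diagram: the sum of the signs of its
self-crossings. -/
def LinkDiagram.writhe {k : ℕ} (D : LinkDiagram k) (i : Fin k) : ℤ :=
  (D.word.map fun σ => σ.elem.selfWrithe i).sum

/-! ## Reidemeister moves -/

section Moves

variable {k : ℕ}

/-- A curl on the right-hand side of the strand `s`. -/
def kinkRight (s : Strand k) (o : Bool) : List (Slice k) :=
  [⟨[s], .cup s, []⟩, ⟨[], .cross s s o, [s.rev]⟩, ⟨[s], .cap s, []⟩]

/-- A curl on the left-hand side of the strand `s`; it has the same sign as `kinkRight s o`. -/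
def kinkLeft (s : Strand k) (o : Bool) : List (Slice k) :=
  [⟨[], .cup s.rev, [s]⟩, ⟨[s.rev], .cross s s o, []⟩, ⟨[], .cap s.rev, [s]⟩]

/-- The local moves generating isotopy of diagrams in the plane (`exchange`, the straightening of a
strand, and the passage of a crossing through a maximum or minimum) together with the framed
Reidemeister moves, for all orientations of the strands. -/
inductive FramedMove : List (Slice k) → List (Slice k) → Prop
  /-- Distant pieces change heights. -/
  | exchange (e f : Elem k) (m : List (Strand k)) :
      FramedMove [⟨[], e, m ++ f.bot⟩, ⟨e.top ++ m, f, []⟩]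
        [⟨e.bot ++ m, f, []⟩, ⟨[], e, m ++ f.top⟩]
  | straighten_left (s : Strand k) :
      FramedMove [⟨[s], .cup s.rev, []⟩, ⟨[], .cap s, [s]⟩] []
  | straighten_right (s : Strand k) :
      FramedMove [⟨[], .cup s, [s]⟩, ⟨[s], .cap s.rev, []⟩] []
  /-- A strand `c` passes over or under a maximum. -/
  | slide_cap (s c : Strand k) (o : Bool) :
      FramedMove [⟨[s], .cross c s.rev o, []⟩, ⟨[], .cap s, [c]⟩]
        [⟨[], .cross s c (!o), [s.rev]⟩, ⟨[c], .cap s, []⟩]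
  /-- A strand `c` passes over or under a minimum. -/
  | slide_cup (s c : Strand k) (o : Bool) :
      FramedMove [⟨[], .cup s, [c]⟩, ⟨[s], .cross s.rev c o, []⟩]
        [⟨[c], .cup s, []⟩, ⟨[], .cross c s (!o), [s.rev]⟩]
  /-- The framed first Reidemeister move. -/
  | framedR1 (s : Strand k) (o : Bool) : FramedMove (kinkRight s o) (kinkLeft s o)
  /-- The second Reidemeister move. -/
  | R2 (a b : Strand k) (o : Bool) :
      FramedMove [⟨[], .cross a b o, []⟩, ⟨[], .cross b a (!o), []⟩] []
  /-- The third Reidemeister move. The bits say which strand of each pair is on top; the hypothesis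
  says that the three strands lie at three different heights. -/
  | R3 (a b c : Strand k) (ab ac bc : Bool) (h : ab = bc → ac = ab) :
      FramedMove
        [⟨[], .cross a b ab, [c]⟩, ⟨[b], .cross a c ac, []⟩, ⟨[], .cross b c bc, [a]⟩]
        [⟨[a], .cross b c bc, []⟩, ⟨[], .cross a c ac, [b]⟩, ⟨[c], .cross a b ab, []⟩]

/-- All Reidemeister moves: the framed ones and the unframed first Reidemeister move, which removes
a curl. -/
inductive Move : List (Slice k) → List (Slice k) → Prop
  | framed {L M : List (Slice k)} (h : FramedMove L M) : Move L M
  | R1_right (s : Strand k) (o : Bool) : Move (kinkRight s o) []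
  | R1_left (s : Strand k) (o : Bool) : Move (kinkLeft s o) []

/-- `D'` arises from `D` by replacing, above the slices `pre` and below the slices `post`, and
between the vertical strands `u` and `v`, the local picture `L` by the local picture `M`. -/
structure IsReplacement (D D' : LinkDiagram k) (pre post : List (Slice k)) (u v : List (Strand k))
    (L M : List (Slice k)) : Prop where
  before : D.word = pre ++ L.map (Slice.whisker u v) ++ post
  after : D'.word = pre ++ M.map (Slice.whisker u v) ++ post

/-- `D'` arises from `D` by one of the Reidemeister moves. -/
def Step (D D' : LinkDiagram k) : Prop :=
  ∃ pre post u v L M, Move L M ∧ IsReplacement D D' pre post u v L M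

/-- The diagrams represent ambient isotopic oriented links, by an isotopy that respects the
orientations and the order of the components: they are connected by a finite sequence of
Reidemeister moves and their inverses. -/
def AmbientIsotopic (D D' : LinkDiagram k) : Prop := Relation.EqvGen Step D D'

end Moves

/-! ## Shadow colorings -/

section Colorings

variable {R X : Type*} {k : ℕ}

/-- The colors seen along a horizontal level, from left to right: the rack colors of the strands,
and the shadow colors of the regions between them. -/
structure Level (R X : Type*) where
  arcs : List R
  regions : List X

variable [Rack R]

/-- The coloring condition along strands. If a strand has color `r`, the region on its right has
color `x` and the region on its left has color `y`, then `y = x · r` (right and left are with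
respect to the orientation of the strand). -/
def EdgeRule [RackShadow R X] : List (Strand k) → List R → List X → Prop
  | [], [], [_] => True
  | s :: S, r :: A, x :: y :: G =>
      (if s.up then x = RackShadow.act r y else y = RackShadow.act r x) ∧ EdgeRule S A (y :: G)
  | _, _, _ => False

/-- The rack coloring condition at a crossing: `x` and `x'` are the colors of the strand `a` below
and above the crossing, and `y` and `y'` those of the strand `b`. The over-strand keeps its color;
if it has color `q` and the under-strand has color `p` on the right of the over-strand, then the
under-strand has color `p ▷ q` on the left of the over-strand. -/
def CrossingRule (a b : Strand k) (o : Bool) (x y x' y' : R) : Prop :=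
  if o then x' = x ∧ (if a.up then y' = x ◃ y else y = x ◃ y')
  else y' = y ∧ (if b.up then x = y ◃ x' else x' = y ◃ x)

/-- The colors below and above a slice match: colors are constant along arcs, except at the
undercrossings, where the crossing rule holds, and colors are constant on regions. -/
inductive SliceRule : Slice k → Level R X → Level R X → Prop
  | cup {u v : List (Strand k)} {A B : List R} {G H : List X} (s : Strand k) (r : R) (x y : X)
      (hA : A.length = u.length) (hB : B.length = v.length)
      (hG : G.length = u.length) (hH : H.length = v.length) :
      SliceRule ⟨u, .cup s, v⟩ ⟨A ++ B, G ++ x :: H⟩ ⟨A ++ r :: r :: B, G ++ x :: y :: x :: H⟩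
  | cap {u v : List (Strand k)} {A B : List R} {G H : List X} (s : Strand k) (r : R) (x y : X)
      (hA : A.length = u.length) (hB : B.length = v.length)
      (hG : G.length = u.length) (hH : H.length = v.length) :
      SliceRule ⟨u, .cap s, v⟩ ⟨A ++ r :: r :: B, G ++ x :: y :: x :: H⟩ ⟨A ++ B, G ++ x :: H⟩
  | cross {u v : List (Strand k)} {A B : List R} {G H : List X} (a b : Strand k) (o : Bool)
      (x y x' y' : R) (g h h' l : X)
      (hA : A.length = u.length) (hB : B.length = v.length)
      (hG : G.length = u.length) (hH : H.length = v.length)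
      (hc : CrossingRule a b o x y x' y') :
      SliceRule ⟨u, .cross a b o, v⟩ ⟨A ++ x :: y :: B, G ++ g :: h :: l :: H⟩
        ⟨A ++ y' :: x' :: B, G ++ g :: h' :: l :: H⟩

variable [RackShadow R X]

/-- The levels in the list, from bottom to top, are a shadow coloring of the word of slices. -/
def IsColoring : List (Strand k) → List (Slice k) → List (Level R X) → Prop
  | S, [], [a] => EdgeRule S a.arcs a.regions
  | S, σ :: w, a :: b :: c =>
      EdgeRule S a.arcs a.regions ∧ SliceRule σ a b ∧ IsColoring σ.top w (b :: c)
  | _, _, _ => False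

/-- A shadow coloring of a diagram: rack colors of the arcs and shadow colors of the regions,
given by the colors at every level. -/
@[ext] structure ShadowColoring (R X : Type*) [Rack R] [RackShadow R X] {k : ℕ}
    (D : LinkDiagram k) where
  levels : List (Level R X)
  isColoring : IsColoring [] D.word levels

theorem EdgeRule.length : ∀ {S : List (Strand k)} {A : List R} {G : List X},
    EdgeRule S A G → A.length = S.length ∧ G.length = S.length + 1
  | [], [], [_], _ => by simp
  | s :: S, r :: A, x :: y :: G, h => by
      have := EdgeRule.length h.2
      simp only [List.length_cons] at this ⊢
      omega
  | [], [], [], h => by simp [EdgeRule] at h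
  | [], [], _ :: _ :: _, h => by simp [EdgeRule] at h
  | [], _ :: _, _, h => by simp [EdgeRule] at h
  | _ :: _, [], _, h => by simp [EdgeRule] at h
  | _ :: _, _ :: _, [], h => by simp [EdgeRule] at h
  | _ :: _, _ :: _, [_], h => by simp [EdgeRule] at h

theorem finite_edgeRule [Finite R] [Finite X] (S : List (Strand k)) :
    {a : Level R X | EdgeRule S a.arcs a.regions}.Finite := by
  refine (Set.Finite.image2 (fun A G => Level.mk A G) (List.finite_length_eq R S.length)
    (List.finite_length_eq X (S.length + 1))).subset ?_
  rintro ⟨A, G⟩ h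
  exact ⟨A, (EdgeRule.length h).1, G, (EdgeRule.length h).2, rfl⟩

theorem finite_isColoring [Finite R] [Finite X] (w : List (Slice k)) :
    ∀ S : List (Strand k), {c : List (Level R X) | IsColoring S w c}.Finite := by
  induction w with
  | nil =>
    intro S
    refine ((finite_edgeRule S).image (fun a => [a])).subset ?_
    rintro c h
    match c, h with
    | [a], h => exact ⟨a, h, rfl⟩
  | cons σ w ih =>
    intro S
    refine (Set.Finite.image2 List.cons (finite_edgeRule S) (ih σ.top)).subset ?_
    rintro c h
    match c, h with
    | a :: b :: c, h => exact ⟨a, h.1, b :: c, h.2.2, rfl⟩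

instance [Finite R] [Finite X] (D : LinkDiagram k) : Finite (ShadowColoring R X D) := by
  have := (finite_isColoring (R := R) (X := X) D.word []).to_subtype
  exact Finite.of_injective
    (fun f : ShadowColoring R X D =>
      (⟨f.levels, f.isColoring⟩ : {c : List (Level R X) | IsColoring [] D.word c}))
    fun f g h => ShadowColoring.ext (congrArg Subtype.val h)

noncomputable instance [Finite R] [Finite X] (D : LinkDiagram k) :
    Fintype (ShadowColoring R X D) := Fintype.ofFinite _

/-- Two colorings have the same colors outside of the region in which a replacement takes place:
at the first `m + 1` levels, and at all levels from the top of the replaced part on. The replaced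
part consists of the `n` slices above level `m` of the first diagram, and of the `n'` slices above
level `m` of the second. -/
def AgreeOutside {D D' : LinkDiagram k} (m n n' : ℕ) (f : ShadowColoring R X D)
    (f' : ShadowColoring R X D') : Prop :=
  f.levels.take (m + 1) = f'.levels.take (m + 1) ∧
    f.levels.drop (m + n) = f'.levels.drop (m + n')

/-- The image subrack of a coloring: the subrack generated by the colors of the arcs. -/
inductive ImageSubrack {D : LinkDiagram k} (f : ShadowColoring R X D) : R → Prop
  | arc {a : Level R X} {r : R} (ha : a ∈ f.levels) (hr : r ∈ a.arcs) : ImageSubrack f r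
  | act {r q : R} (hr : ImageSubrack f r) (hq : ImageSubrack f q) : ImageSubrack f (q ◃ r)
  | invAct {r q : R} (hr : ImageSubrack f r) (hq : ImageSubrack f q) : ImageSubrack f (q ◃⁻¹ r)

/-- Membership in the shadow image: the closure of the set of colors of the regions under the
action of the image subrack. -/
inductive MemShadowImage {D : LinkDiagram k} (f : ShadowColoring R X D) : X → Prop
  | region {a : Level R X} {x : X} (ha : a ∈ f.levels) (hx : x ∈ a.regions) : MemShadowImage f x
  | act {r : R} {x : X} (hr : ImageSubrack f r) (hx : MemShadowImage f x) :
      MemShadowImage f (RackShadow.act r x)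

/-- The shadow image of a shadow coloring. -/
def ShadowColoring.shadowImage {D : LinkDiagram k} (f : ShadowColoring R X D) : Set X :=
  {x | MemShadowImage f x}

end Colorings

/-! ## The invariants -/

section Invariants

variable {k : ℕ}

/-- For each framing vector `w` modulo the rack rank, a diagram `E w` of the oriented link
represented by `D` whose writhe vector is `w`. -/
def IsFramingFamily (R : Type*) [Rack R] (D : LinkDiagram k)
    (E : (Fin k → ZMod (rackRank R)) → LinkDiagram k) : Prop :=
  ∀ w, AmbientIsotopic D (E w) ∧ ∀ i, ((E w).writhe i : ZMod (rackRank R)) = w i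

/-- The multiset shadow polynomial invariant. -/
noncomputable def multisetInvariant (R X : Type*) [Rack R] [RackShadow R X] [Fintype R] [Fintype X]
    (E : (Fin k → ZMod (rackRank R)) → LinkDiagram k) :
    Multiset (Polynomial ℤ × (Fin k → ZMod (rackRank R))) :=
  ∑ w, (Finset.univ : Finset (ShadowColoring R X (E w))).val.map
    fun f => (subshadowPoly R f.shadowImage, w)

/-- The shadow polynomial invariant `∑_w ∑_f z ^ ssp(f) q ^ w`. It is a polynomial in variables
`q_i` over the ring of formal integral combinations of symbols `z ^ p` with `p ∈ ℤ[t]`; the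
exponent of `q_i` is the representative of `w_i` in `{0, …, N - 1}`. -/
noncomputable def shadowPolyInvariant (R X : Type*) [Rack R] [RackShadow R X] [Fintype R]
    [Fintype X] (E : (Fin k → ZMod (rackRank R)) → LinkDiagram k) :
    MvPolynomial (Fin k) (AddMonoidAlgebra ℤ (Polynomial ℤ)) :=
  ∑ w, ∑ f : ShadowColoring R X (E w),
    MvPolynomial.C (AddMonoidAlgebra.single (subshadowPoly R f.shadowImage) 1) *
      ∏ i, MvPolynomial.X i ^ (w i).val

end Invariants

end ShadowLink

open ShadowLink

namespace ShadowLink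

/-! ## The action of a rack, and its diagonal permutation -/

section Within

variable {R : Type*}

/-- All colors in the list `A` belong to `K`. -/
def Within (K : Set R) (A : List R) : Prop := ∀ r ∈ A, r ∈ K

@[simp] theorem within_nil (K : Set R) : Within K [] := by simp [Within]

@[simp] theorem within_cons (K : Set R) (x : R) (A : List R) :
    Within K (x :: A) ↔ x ∈ K ∧ Within K A := by simp [Within]

@[simp] theorem within_append (K : Set R) (A B : List R) :
    Within K (A ++ B) ↔ Within K A ∧ Within K B := by simp [Within, or_imp, forall_and]

end Within

section Diagonal

variable {R : Type*} [Rack R] {k : ℕ}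

/-- The diagonal permutation `x ↦ x ▷ x` of a rack. -/
def diagPerm (R : Type*) [Rack R] : Equiv.Perm R := Rack.selfApplyEquiv R

theorem diagPerm_apply (x : R) : diagPerm R x = x ◃ x := rfl

theorem diagPerm_inv_apply (x : R) : (diagPerm R)⁻¹ x = x ◃⁻¹ x := rfl

/-- The permutation of the rack by which a strand `s` of color `x` acts on the strands that run
under it from left to right. -/
def Strand.act (s : Strand k) (x : R) : Equiv.Perm R := if s.up then Rack.act' x else (Rack.act' x)⁻¹

theorem Strand.rev_act (s : Strand k) (x : R) : s.rev.act x = (s.act x)⁻¹ := by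
  rcases s with ⟨c, _ | _⟩ <;> simp [Strand.act, Strand.rev]

@[simp] theorem Strand.rev_rev (s : Strand k) : s.rev.rev = s := by
  rcases s with ⟨c, _ | _⟩ <;> rfl

theorem Strand.sign_rev (s : Strand k) : s.rev.sign = -s.sign := by
  rcases s with ⟨c, _ | _⟩ <;> rfl

theorem Strand.sign_mul_self (s : Strand k) : s.sign * s.sign = 1 := by
  rcases s with ⟨c, _ | _⟩ <;> rfl

/-- A rack automorphism commutes with the operation by strands. -/
theorem Strand.map_act {g : Equiv.Perm R} (hg : ∀ y z, g (y ◃ z) = g y ◃ g z) (s : Strand k)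
    (y z : R) : g (s.act y z) = s.act (g y) (g z) := by
  rcases s with ⟨c, _ | _⟩
  · simp only [Strand.act, Bool.false_eq_true, if_false, Rack.invAct_apply]
    rw [← Rack.left_cancel (g y), ← hg]
    simp
  · simp [Strand.act, hg]

theorem Strand.act_distrib (s : Strand k) (x y z : R) :
    s.act x (y ◃ z) = s.act x y ◃ s.act x z := by
  rcases s with ⟨c, _ | _⟩
  · simp only [Strand.act, Bool.false_eq_true, if_false, Rack.invAct_apply]
    rw [← Rack.left_cancel x, Rack.act_invAct_eq, Shelf.self_distrib]
    simp
  · simpa [Strand.act] using Shelf.self_distrib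

theorem Strand.act_act (s t : Strand k) (x y z : R) :
    s.act x (t.act y z) = t.act (s.act x y) (s.act x z) :=
  Strand.map_act (s.act_distrib x) t y z

/-- Properties of integral powers of the diagonal permutation reduce in this way to one step with
`g` and one with `g⁻¹`. -/
theorem zpow_induction_perm {α : Type*} (g : Equiv.Perm α) (C : Equiv.Perm α → Prop) (h1 : C 1)
    (hg : ∀ h, C h → C (g * h)) (hg' : ∀ h, C h → C (g⁻¹ * h)) (n : ℤ) : C (g ^ n) := by
  induction n using Int.induction_on with
  | zero => simpa using h1
  | succ n ih => rw [add_comm, zpow_add, zpow_one]; exact hg _ ih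
  | pred n ih => rw [sub_eq_add_neg, add_comm, zpow_add, zpow_neg_one]; exact hg' _ ih

/-- By self-distributivity an element and its diagonal image act alike. Together with
`Strand.act_apply_diagPerm_zpow` this is what lets a power of the diagonal permutation pass through
a crossing on either strand. -/
theorem diagPerm_zpow_act (n : ℤ) (x y : R) : ((diagPerm R) ^ n) x ◃ y = x ◃ y := by
  refine zpow_induction_perm (diagPerm R) (fun g => ∀ x : R, g x ◃ y = x ◃ y) (fun _ => rfl)
    (fun h ih x => ?_) (fun h ih x => ?_) n x
  · rw [Equiv.Perm.mul_apply, diagPerm_apply, Rack.self_act_act_eq, ih]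
  · rw [Equiv.Perm.mul_apply, diagPerm_inv_apply, Rack.self_invAct_act_eq, ih]

theorem Strand.act_diagPerm_zpow (s : Strand k) (n : ℤ) (x : R) :
    s.act (((diagPerm R) ^ n) x) = s.act x := by
  have : Rack.act' (((diagPerm R) ^ n) x) = Rack.act' x :=
    Equiv.ext fun y => diagPerm_zpow_act n x y
  simp [Strand.act, this]

/-- The diagonal permutation is defined by the rack operation alone, so it commutes with every rack
automorphism, in particular with the action of a strand. -/
theorem Strand.act_apply_diagPerm_zpow (s : Strand k) (n : ℤ) (x y : R) :
    s.act x (((diagPerm R) ^ n) y) = ((diagPerm R) ^ n) (s.act x y) := by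
  have h : Commute (s.act x) (diagPerm R) := Equiv.ext fun z => by
    simp [diagPerm_apply, Strand.act_distrib]
  have := h.zpow_right n
  exact congrArg (fun g : Equiv.Perm R => g y) this.eq

/-- The diagonal permutation or its inverse, according to the direction of the strand. -/
def Strand.diag (R : Type*) [Rack R] (s : Strand k) : Equiv.Perm R := (diagPerm R) ^ s.sign

theorem Strand.act_self (s : Strand k) (x : R) : s.act x x = s.diag R x := by
  rcases s with ⟨c, _ | _⟩ <;> simp [Strand.act, Strand.diag, Strand.sign] <;> rfl

theorem Strand.diag_rev (s : Strand k) : s.rev.diag R = (s.diag R)⁻¹ := by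
  rw [Strand.diag, Strand.sign_rev, zpow_neg]; rfl

/-- The subset `K` is closed under both rack operations. -/
structure IsSubrack (K : Set R) : Prop where
  act : ∀ {x y}, x ∈ K → y ∈ K → x ◃ y ∈ K
  invAct : ∀ {x y}, x ∈ K → y ∈ K → x ◃⁻¹ y ∈ K

theorem IsSubrack.strand_act {K : Set R} (hK : IsSubrack K) (s : Strand k) {x y : R} (hx : x ∈ K)
    (hy : y ∈ K) : s.act x y ∈ K := by
  rcases s with ⟨c, _ | _⟩
  · simpa [Strand.act] using hK.invAct hx hy
  · simpa [Strand.act] using hK.act hx hy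

theorem IsSubrack.diagPerm_zpow_mem {K : Set R} (hK : IsSubrack K) (n : ℤ) {x : R} (hx : x ∈ K) :
    ((diagPerm R) ^ n) x ∈ K := by
  refine zpow_induction_perm (diagPerm R) (fun g => ∀ x ∈ K, g x ∈ K) (fun _ h => h)
    (fun h ih x hx => ?_) (fun h ih x hx => ?_) n x hx
  · exact hK.act (ih x hx) (ih x hx)
  · exact hK.invAct (ih x hx) (ih x hx)

end Diagonal

/-! ## Chains of relations -/

section Chains

variable {T : Type*}

/-- `c` lists the successive members, after the first member `a`, of a chain along the given
relations, ending in `b`. -/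
def IsChain : List (T → T → Prop) → T → List T → T → Prop
  | [], a, [], b => a = b
  | r :: rs, a, x :: c, b => r a x ∧ IsChain rs x c b
  | _, _, _, _ => False

theorem isChain_nil_iff {a b : T} {c : List T} : IsChain [] a c b ↔ c = [] ∧ a = b := by
  cases c <;> simp [IsChain]

theorem isChain_cons_iff {r : T → T → Prop} {rs : List (T → T → Prop)} {a b : T} {c : List T} :
    IsChain (r :: rs) a c b ↔ ∃ x c', c = x :: c' ∧ r a x ∧ IsChain rs x c' b := by
  cases c <;> simp [IsChain]

theorem IsChain.length_eq {rs : List (T → T → Prop)} : ∀ {a b : T} {c : List T},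
    IsChain rs a c b → c.length = rs.length := by
  induction rs with
  | nil => intro a b c h; simp [(isChain_nil_iff.1 h).1]
  | cons r rs ih =>
    intro a b c h
    obtain ⟨x, c', rfl, -, h⟩ := isChain_cons_iff.1 h
    simp [ih h]

theorem isChain_append_iff {rs ss : List (T → T → Prop)} : ∀ {a b : T} {c : List T},
    IsChain (rs ++ ss) a c b ↔
      ∃ c₁ x c₂, c = c₁ ++ c₂ ∧ IsChain rs a c₁ x ∧ IsChain ss x c₂ b := by
  induction rs with
  | nil =>
    intro a b c
    constructor
    · exact fun h => ⟨[], a, c, rfl, by simp [IsChain], h⟩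
    · rintro ⟨c₁, x, c₂, rfl, h, h'⟩
      obtain ⟨rfl, rfl⟩ := isChain_nil_iff.1 h
      exact h'
  | cons r rs ih =>
    intro a b c
    simp only [List.cons_append, isChain_cons_iff, ih]
    constructor
    · rintro ⟨x, c', rfl, h, c₁, y, c₂, rfl, h₁, h₂⟩
      exact ⟨x :: c₁, y, c₂, rfl, ⟨x, c₁, rfl, h, h₁⟩, h₂⟩
    · rintro ⟨c₁, y, c₂, rfl, ⟨x, c', rfl, h, h₁⟩, h₂⟩
      exact ⟨x, c' ++ c₂, rfl, h, c', y, c₂, rfl, h₁, h₂⟩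

/-- The list `c` omits the first member of the chain and `d` omits the last; the lemma passes
between these two conventions. -/
theorem IsChain.exists_eq_append {rs : List (T → T → Prop)} : ∀ {a b : T} {c : List T},
    IsChain rs a c b → ∃ d : List T, a :: c = d ++ [b] ∧ d.length = rs.length := by
  induction rs with
  | nil =>
    intro a b c h
    obtain ⟨rfl, rfl⟩ := isChain_nil_iff.1 h
    exact ⟨[], rfl, rfl⟩
  | cons r rs ih =>
    intro a b c h
    obtain ⟨x, c', rfl, -, h⟩ := isChain_cons_iff.1 h
    obtain ⟨d, hd, hl⟩ := ih h
    exact ⟨a :: d, by rw [hd]; rfl, by simp [hl]⟩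

/-- The levels `c` and `c'` agree at the first `m + 1` places, and from the place `m + n` of the
first and the place `m + n'` of the second list on. -/
def AgreeLists {α : Type*} (m n n' : ℕ) (c c' : List α) : Prop :=
  c.take (m + 1) = c'.take (m + 1) ∧ c.drop (m + n) = c'.drop (m + n')

/-- The member `y`, where the replaced part ends, sits at place `pre.length + L.length` of the full
list, so agreement from there on fixes both `y` and the rest. -/
theorem agreeLists_of_isChain {pre L M : List (T → T → Prop)} {a x y x' y' : T}
    {c₁ c₂ c₃ c₁' c₂' c₃' : List T} (h₁ : IsChain pre a c₁ x) (h₂ : IsChain L x c₂ y)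
    (h₁' : IsChain pre a c₁' x') (h₂' : IsChain M x' c₂' y') :
    AgreeLists pre.length L.length M.length (a :: (c₁ ++ (c₂ ++ c₃))) (a :: (c₁' ++ (c₂' ++ c₃')))
      ↔ c₁ = c₁' ∧ y = y' ∧ c₃ = c₃' := by
  have key : ∀ {L : List (T → T → Prop)} {x y : T} {c₁ c₂ c₃ : List T}, IsChain pre a c₁ x →
      IsChain L x c₂ y → (a :: (c₁ ++ (c₂ ++ c₃))).take (pre.length + 1) = a :: c₁ ∧
        (a :: (c₁ ++ (c₂ ++ c₃))).drop (pre.length + L.length) = y :: c₃ := by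
    intro L x y c₁ c₂ c₃ h₁ h₂
    constructor
    · simp [← h₁.length_eq]
    · obtain ⟨d₁, e₁, l₁⟩ := h₁.exists_eq_append
      obtain ⟨d₂, e₂, l₂⟩ := h₂.exists_eq_append
      -- Here `d₁` consists of the members strictly before `x`, and `d₂` of those from `x` up to
      -- just before `y`.
      have : a :: (c₁ ++ (c₂ ++ c₃)) = (d₁ ++ d₂) ++ y :: c₃ := by
        rw [← List.cons_append, e₁, List.append_assoc, List.singleton_append, ← List.cons_append,
          e₂]
        simp
      rw [this, ← l₁, ← l₂, ← List.length_append, List.drop_left]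
  rw [AgreeLists, (key h₁ h₂).1, (key h₁ h₂).2, (key h₁' h₂').1, (key h₁' h₂').2]
  simp

/-! ### Local replacement in chains of color lists -/

variable {R : Type*} [Rack R]

/-- Chains along `L` are determined by their ends, and lie in every subrack that contains the
ends. -/
structure Rigid (n : ℕ) (L : List (List R → List R → Prop)) : Prop where
  unique : ∀ {a b c c'}, a.length = n → IsChain L a c b → IsChain L a c' b → c = c'
  within : ∀ {K : Set R}, IsSubrack K → ∀ {a b c}, a.length = n → Within K a → Within K b →
    IsChain L a c b → ∀ A ∈ c, Within K A

/-- Chains along `L` and along `M` correspond to each other, relative to their ends. -/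
structure Swap (n : ℕ) (L M : List (List R → List R → Prop)) : Prop where
  left : Rigid n L
  right : Rigid n M
  iff : ∀ {a b}, a.length = n → ((∃ c, IsChain L a c b) ↔ ∃ c, IsChain M a c b)

theorem Swap.symm {n : ℕ} {L M : List (List R → List R → Prop)} (h : Swap n L M) : Swap n M L :=
  ⟨h.right, h.left, fun ha => (h.iff ha).symm⟩

/-- All concrete moves go through this criterion: `θ` collects the free colors of the local picture.
That the ends determine `θ` gives uniqueness, and that both sides have the same end maps `p` and `q`
gives the correspondence. -/
theorem Swap.of_param {n : ℕ} {L M : List (List R → List R → Prop)} {Θ : Type*} (p q : Θ → List R)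
    (cL cM : Θ → List (List R))
    (hL : ∀ a c b, a.length = n → (IsChain L a c b ↔ ∃ θ, a = p θ ∧ b = q θ ∧ c = cL θ))
    (hM : ∀ a c b, a.length = n → (IsChain M a c b ↔ ∃ θ, a = p θ ∧ b = q θ ∧ c = cM θ))
    (inj : ∀ θ θ', p θ = p θ' → q θ = q θ' → θ = θ')
    (within : ∀ {K : Set R}, IsSubrack K → ∀ θ, Within K (p θ) → Within K (q θ) →
      (∀ A ∈ cL θ, Within K A) ∧ ∀ A ∈ cM θ, Within K A) : Swap n L M where
  left :=
    { unique := by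
        intro a b c c' ha h h'
        rw [hL _ _ _ ha] at h h'
        obtain ⟨θ, rfl, rfl, rfl⟩ := h
        obtain ⟨θ', h₁, h₂, rfl⟩ := h'
        rw [inj _ _ h₁ h₂]
      within := by
        intro K hK a b c ha h₁ h₂ h
        obtain ⟨θ, rfl, rfl, rfl⟩ := (hL _ _ _ ha).1 h
        exact (within hK θ h₁ h₂).1 }
  right :=
    { unique := by
        intro a b c c' ha h h'
        rw [hM _ _ _ ha] at h h'
        obtain ⟨θ, rfl, rfl, rfl⟩ := h
        obtain ⟨θ', h₁, h₂, rfl⟩ := h'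
        rw [inj _ _ h₁ h₂]
      within := by
        intro K hK a b c ha h₁ h₂ h
        obtain ⟨θ, rfl, rfl, rfl⟩ := (hM _ _ _ ha).1 h
        exact (within hK θ h₁ h₂).2 }
  iff := by
    intro a b ha
    simp only [hL _ _ _ ha, hM _ _ _ ha]
    constructor
    · rintro ⟨_, θ, h₁, h₂, -⟩
      exact ⟨_, θ, h₁, h₂, rfl⟩
    · rintro ⟨_, θ, h₁, h₂, -⟩
      exact ⟨_, θ, h₁, h₂, rfl⟩

/-- Replacing a part of a chain. -/
theorem Swap.existsUnique {n : ℕ} {pre L M post : List (List R → List R → Prop)} (h : Swap n L M)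
    {a b : List R} (hn : ∀ c x, IsChain pre a c x → x.length = n) {c : List (List R)}
    (hc : IsChain (pre ++ (L ++ post)) a c b) :
    ∃! c', IsChain (pre ++ (M ++ post)) a c' b ∧
      AgreeLists pre.length L.length M.length (a :: c) (a :: c') := by
  obtain ⟨c₁, x, c₂₃, rfl, h₁, hc⟩ := isChain_append_iff.1 hc
  obtain ⟨c₂, y, c₃, rfl, h₂, h₃⟩ := isChain_append_iff.1 hc
  obtain ⟨c₂', h₂'⟩ := (h.iff (hn _ _ h₁)).1 ⟨c₂, h₂⟩
  refine ⟨c₁ ++ (c₂' ++ c₃), ⟨isChain_append_iff.2 ⟨c₁, x, _, rfl, h₁, isChain_append_iff.2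
    ⟨c₂', y, c₃, rfl, h₂', h₃⟩⟩, (agreeLists_of_isChain h₁ h₂ h₁ h₂').2
      ⟨rfl, rfl, rfl⟩⟩, ?_⟩
  rintro d ⟨hd, hag⟩
  obtain ⟨d₁, x', d₂₃, rfl, k₁, hd⟩ := isChain_append_iff.1 hd
  obtain ⟨d₂, y', d₃, rfl, k₂, k₃⟩ := isChain_append_iff.1 hd
  obtain ⟨rfl, rfl, rfl⟩ := (agreeLists_of_isChain h₁ h₂ k₁ k₂).1 hag
  -- The last member of a chain can be read off from the first member and the list.
  have hx : x = x' := by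
    obtain ⟨d, e, -⟩ := h₁.exists_eq_append
    obtain ⟨d', e', -⟩ := k₁.exists_eq_append
    rw [e] at e'
    exact (List.append_inj' e' rfl).2 |> List.singleton_inj.1
  subst hx
  rw [h.right.unique (hn _ _ h₁) k₂ h₂']

/-- The ends `x` and `y` of the replaced part are members of the old chain, so their colors lie in
`K`; rigidity then puts the new interior into `K` as well. -/
theorem Swap.within_of_agree {n : ℕ} {pre L M post : List (List R → List R → Prop)}
    (h : Swap n L M) {a b : List R} (hn : ∀ c x, IsChain pre a c x → x.length = n)
    {c c' : List (List R)} (hc : IsChain (pre ++ (L ++ post)) a c b)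
    (hc' : IsChain (pre ++ (M ++ post)) a c' b)
    (hag : AgreeLists pre.length L.length M.length (a :: c) (a :: c')) {K : Set R}
    (hK : IsSubrack K) (ha : Within K a) (hw : ∀ A ∈ c, Within K A) : ∀ A ∈ c', Within K A := by
  obtain ⟨c₁, x, c₂₃, rfl, h₁, hc⟩ := isChain_append_iff.1 hc
  obtain ⟨c₂, y, c₃, rfl, h₂, h₃⟩ := isChain_append_iff.1 hc
  obtain ⟨d₁, x', d₂₃, rfl, k₁, hd⟩ := isChain_append_iff.1 hc'
  obtain ⟨d₂, y', d₃, rfl, k₂, k₃⟩ := isChain_append_iff.1 hd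
  obtain ⟨rfl, rfl, rfl⟩ := (agreeLists_of_isChain h₁ h₂ k₁ k₂).1 hag
  have hx' : Within K x' := by
    obtain ⟨d, e, -⟩ := k₁.exists_eq_append
    have : x' ∈ a :: c₁ := by simp [e]
    rcases List.mem_cons.1 this with rfl | h
    · exact ha
    · exact hw _ (by simp [h])
  have hx : Within K x := by
    obtain ⟨d, e, -⟩ := h₁.exists_eq_append
    have : x ∈ a :: c₁ := by simp [e]
    rcases List.mem_cons.1 this with rfl | h
    · exact ha
    · exact hw _ (by simp [h])
  have hy : Within K y := by
    obtain ⟨d, e, -⟩ := h₂.exists_eq_append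
    have : y ∈ x :: c₂ := by simp [e]
    rcases List.mem_cons.1 this with rfl | h
    · exact hx
    · exact hw _ (by simp [h])
  have := h.right.within hK (hn _ _ k₁) hx' hy k₂
  intro A hA
  simp only [List.mem_append] at hA hw
  rcases hA with hA | hA | hA
  · exact hw A (Or.inl hA)
  · exact this A hA
  · exact hw A (Or.inr (Or.inr hA))

/-- Equivalence of closed chains: a bijection that respects containment in subracks. -/
def ChainEquiv (L M : List (List R → List R → Prop)) : Prop :=
  ∃ e : {c // IsChain L [] c []} ≃ {c // IsChain M [] c []},
    ∀ K : Set R, IsSubrack K → ∀ c, (∀ A ∈ c.1, Within K A) ↔ ∀ A ∈ (e c).1, Within K A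

theorem ChainEquiv.refl (L : List (List R → List R → Prop)) : ChainEquiv L L :=
  ⟨Equiv.refl _, fun _ _ _ => Iff.rfl⟩

theorem ChainEquiv.symm {L M : List (List R → List R → Prop)} (h : ChainEquiv L M) :
    ChainEquiv M L := by
  obtain ⟨e, he⟩ := h
  exact ⟨e.symm, fun K hK c => by simpa using (he K hK (e.symm c)).symm⟩

theorem ChainEquiv.trans {L M N : List (List R → List R → Prop)} (h : ChainEquiv L M)
    (h' : ChainEquiv M N) : ChainEquiv L N := by
  obtain ⟨e, he⟩ := h
  obtain ⟨e', he'⟩ := h'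
  exact ⟨e.trans e', fun K hK c => (he K hK c).trans (he' K hK (e c))⟩

theorem AgreeLists.symm {α : Type*} {m n n' : ℕ} {c c' : List α} (h : AgreeLists m n n' c c') :
    AgreeLists m n' n c' c := ⟨h.1.symm, h.2.symm⟩

/-- The bijection of closed chains that replaces one part of the chain. -/
theorem Swap.exists_equiv {n : ℕ} {pre L M post N N' : List (List R → List R → Prop)}
    (h : Swap n L M) (hn : ∀ c x, IsChain pre [] c x → x.length = n)
    (hN : N = pre ++ (L ++ post)) (hN' : N' = pre ++ (M ++ post)) :
    ∃ e : {c // IsChain N [] c []} ≃ {c // IsChain N' [] c []},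
      (∀ c c', e c = c' ↔
        AgreeLists pre.length L.length M.length ([] :: c.1) ([] :: c'.1)) ∧
      ∀ K : Set R, IsSubrack K → ∀ c, (∀ A ∈ c.1, Within K A) ↔ ∀ A ∈ (e c).1, Within K A := by
  subst hN hN'
  -- Agreement outside the replaced part is a symmetric relation, so the replacements in the two
  -- directions are mutually inverse by uniqueness.
  choose F hF hF' using fun c : {c // IsChain (pre ++ (L ++ post)) [] c []} =>
    h.existsUnique hn c.2
  choose G hG hG' using fun c : {c // IsChain (pre ++ (M ++ post)) [] c []} =>
    h.symm.existsUnique hn c.2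
  let e : {c // IsChain (pre ++ (L ++ post)) [] c []} ≃
      {c // IsChain (pre ++ (M ++ post)) [] c []} :=
    { toFun := fun c => ⟨F c, (hF c).1⟩
      invFun := fun c => ⟨G c, (hG c).1⟩
      left_inv := fun c => Subtype.ext (hG' ⟨F c, (hF c).1⟩ c.1 ⟨c.2, (hF c).2.symm⟩).symm
      right_inv := fun c => Subtype.ext (hF' ⟨G c, (hG c).1⟩ c.1 ⟨c.2, (hG c).2.symm⟩).symm }
  refine ⟨e, fun c c' => ⟨?_, ?_⟩, fun K hK c => ⟨?_, ?_⟩⟩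
  · rintro rfl
    exact (hF c).2
  · exact fun hag => Subtype.ext (hF' c c'.1 ⟨c'.2, hag⟩).symm
  · exact h.within_of_agree hn c.2 (hF c).1 (hF c).2 hK (within_nil K)
  · exact h.symm.within_of_agree hn (hF c).1 c.2 (hF c).2.symm hK (within_nil K)

theorem Swap.chainEquiv {n : ℕ} {pre L M post N N' : List (List R → List R → Prop)}
    (h : Swap n L M) (hn : ∀ c x, IsChain pre [] c x → x.length = n)
    (hN : N = pre ++ (L ++ post)) (hN' : N' = pre ++ (M ++ post)) : ChainEquiv N N' :=
  let ⟨e, _, he⟩ := h.exists_equiv hn hN hN'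
  ⟨e, he⟩

end Chains

/-! ## Colorings of the arcs -/

section ArcColorings

variable {R : Type*} [Rack R] {k : ℕ}

/-- The crossing rule refers to the right and left of the over-strand. Solved for the colors above
the crossing, it becomes uniform in all directions; `b.rev` occurs because `b`, read upwards, runs
from right to left. -/
theorem crossingRule_iff (a b : Strand k) (o : Bool) (x y x' y' : R) :
    CrossingRule a b o x y x' y' ↔
      if o then y' = a.act x y ∧ x' = x else y' = y ∧ x' = b.rev.act y x := by
  have h : ∀ x y z : R, x = y ◃ z ↔ z = y ◃⁻¹ x := fun x y z => by
    constructor <;> rintro rfl <;> simp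
  have h' : ∀ x y z : R, x = y ◃⁻¹ z ↔ z = y ◃ x := fun x y z => (h z y x).symm
  rcases a with ⟨ca, _ | _⟩ <;> rcases b with ⟨cb, _ | _⟩ <;> cases o <;>
    simp [CrossingRule, Strand.act, Strand.rev, and_comm, h'] 

/-- The colors of the arcs below and above an elementary piece match. -/
def Elem.ArcRule : Elem k → List R → List R → Prop
  | cup _, p, q => ∃ r, p = [] ∧ q = [r, r]
  | cap _, p, q => ∃ r, p = [r, r] ∧ q = []
  | cross a b o, p, q =>
      ∃ x y, p = [x, y] ∧ q = if o then [a.act x y, x] else [y, b.rev.act y x]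

theorem Elem.ArcRule.length_eq {e : Elem k} {p q : List R} (h : e.ArcRule p q) :
    p.length = e.bot.length ∧ q.length = e.top.length := by
  cases e with
  | cup s => obtain ⟨r, rfl, rfl⟩ := h; simp [Elem.bot, Elem.top]
  | cap s => obtain ⟨r, rfl, rfl⟩ := h; simp [Elem.bot, Elem.top]
  | cross a b o =>
    obtain ⟨x, y, rfl, rfl⟩ := h
    cases o <;> simp [Elem.bot, Elem.top]

/-- The colors of the arcs below and above a slice match. -/
def Slice.ArcRule (σ : Slice k) (P Q : List R) : Prop :=
  ∃ A B p q, A.length = σ.left.length ∧ B.length = σ.right.length ∧ P = A ++ (p ++ B) ∧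
    Q = A ++ (q ++ B) ∧ σ.elem.ArcRule p q

theorem Slice.ArcRule.length_eq {σ : Slice k} {P Q : List R} (h : σ.ArcRule P Q) :
    P.length = σ.bot.length ∧ Q.length = σ.top.length := by
  obtain ⟨A, B, p, q, hA, hB, rfl, rfl, h⟩ := h
  simp [Slice.bot, Slice.top, hA, hB, h.length_eq]

theorem Slice.arcRule_nil_nil {e : Elem k} {P Q : List R} :
    Slice.ArcRule ⟨[], e, []⟩ P Q ↔ e.ArcRule P Q := by
  simp [Slice.ArcRule]

theorem Slice.arcRule_nil_right {e : Elem k} {v : List (Strand k)} {P Q : List R} :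
    Slice.ArcRule ⟨[], e, v⟩ P Q ↔
      ∃ B p q, B.length = v.length ∧ P = p ++ B ∧ Q = q ++ B ∧ e.ArcRule p q := by
  simp [Slice.ArcRule]

theorem Slice.arcRule_left_nil {e : Elem k} {u : List (Strand k)} {P Q : List R} :
    Slice.ArcRule ⟨u, e, []⟩ P Q ↔
      ∃ A p q, A.length = u.length ∧ P = A ++ p ∧ Q = A ++ q ∧ e.ArcRule p q := by
  simp [Slice.ArcRule]

theorem Slice.arcRule_nil_single {e : Elem k} {s : Strand k} {P Q : List R} :
    Slice.ArcRule ⟨[], e, [s]⟩ P Q ↔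
      ∃ r p q, P = p ++ [r] ∧ Q = q ++ [r] ∧ e.ArcRule p q := by
  simp only [Slice.arcRule_nil_right, List.length_singleton]
  constructor
  · rintro ⟨B, p, q, hB, h⟩
    obtain ⟨r, rfl⟩ := List.length_eq_one_iff.1 hB
    exact ⟨r, p, q, h⟩
  · rintro ⟨r, p, q, h⟩
    exact ⟨[r], p, q, rfl, h⟩

theorem Slice.arcRule_single_nil {e : Elem k} {s : Strand k} {P Q : List R} :
    Slice.ArcRule ⟨[s], e, []⟩ P Q ↔ ∃ r p q, P = r :: p ∧ Q = r :: q ∧ e.ArcRule p q := by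
  simp only [Slice.arcRule_left_nil, List.length_singleton]
  constructor
  · rintro ⟨B, p, q, hB, h⟩
    obtain ⟨r, rfl⟩ := List.length_eq_one_iff.1 hB
    exact ⟨r, p, q, h⟩
  · rintro ⟨r, p, q, h⟩
    exact ⟨[r], p, q, rfl, h⟩

/-! ### Adding vertical strands on both sides -/

theorem Slice.arcRule_whisker {u v : List (Strand k)} {σ : Slice k} {A B p Q : List R}
    (hA : A.length = u.length) (hB : B.length = v.length) :
    (σ.whisker u v).ArcRule (A ++ (p ++ B)) Q ↔ ∃ q, Q = A ++ (q ++ B) ∧ σ.ArcRule p q := by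
  constructor
  · rintro ⟨A', B', p', q', hA', hB', h, rfl, hpq⟩
    simp only [Slice.whisker, List.length_append] at hA' hB'
    obtain ⟨A₁, A₂, rfl, hA₁⟩ : ∃ A₁ A₂, A' = A₁ ++ A₂ ∧ A₁.length = u.length :=
      ⟨A'.take u.length, A'.drop u.length, (List.take_append_drop _ _).symm, by simp; omega⟩
    obtain ⟨B₁, B₂, rfl, hB₁⟩ : ∃ B₁ B₂, B' = B₁ ++ B₂ ∧ B₁.length = σ.right.length :=
      ⟨B'.take σ.right.length, B'.drop σ.right.length, (List.take_append_drop _ _).symm,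
        by simp; omega⟩
    rw [List.append_assoc] at h
    obtain ⟨rfl, h⟩ := List.append_inj h (hA.trans hA₁.symm)
    have h' : p ++ B = (A₂ ++ (p' ++ B₁)) ++ B₂ := by simpa using h
    simp only [List.length_append] at hB' hA'
    obtain ⟨rfl, rfl⟩ := List.append_inj' h' (by omega)
    exact ⟨A₂ ++ (q' ++ B₁), by simp, A₂, B₁, p', q', by omega, hB₁, rfl, rfl, hpq⟩
  · rintro ⟨q, rfl, A', B', p', q', hA', hB', rfl, rfl, hpq⟩
    exact ⟨A ++ A', B' ++ B, p', q', by simp [Slice.whisker, hA, hA'],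
      by simp [Slice.whisker, hB, hB'], by simp, by simp, hpq⟩

/-- The conditions on the colors of the arcs at the successive slices of a word. -/
def arcRules (R : Type*) [Rack R] (w : List (Slice k)) : List (List R → List R → Prop) :=
  w.map Slice.ArcRule

theorem isChain_whisker {u v : List (Strand k)} {A B : List R} (hA : A.length = u.length)
    (hB : B.length = v.length) {L : List (Slice k)} : ∀ {p Q : List R} {c : List (List R)},
    IsChain (arcRules R (L.map (Slice.whisker u v))) (A ++ (p ++ B)) c Q ↔
      ∃ c₀ q, c = c₀.map (fun x => A ++ (x ++ B)) ∧ Q = A ++ (q ++ B) ∧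
        IsChain (arcRules R L) p c₀ q := by
  induction L with
  | nil =>
    intro p Q c
    simp only [arcRules, List.map_nil, isChain_nil_iff]
    constructor
    · rintro ⟨rfl, rfl⟩
      exact ⟨[], p, rfl, rfl, rfl, rfl⟩
    · rintro ⟨c₀, q, rfl, rfl, rfl, rfl⟩
      exact ⟨rfl, rfl⟩
  | cons σ L ih =>
    intro p Q c
    simp only [arcRules, List.map_cons, isChain_cons_iff] at ih ⊢
    constructor
    · rintro ⟨x, c', rfl, h, h'⟩
      obtain ⟨q, rfl, hq⟩ := (Slice.arcRule_whisker hA hB).1 h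
      obtain ⟨c₀, q', rfl, rfl, hc⟩ := ih.1 h'
      exact ⟨q :: c₀, q', rfl, rfl, q, c₀, rfl, hq, hc⟩
    · rintro ⟨_, q', rfl, rfl, q, c₀, rfl, hq, hc⟩
      exact ⟨_, _, rfl, (Slice.arcRule_whisker hA hB).2 ⟨q, rfl, hq⟩,
        ih.2 ⟨c₀, q', rfl, rfl, hc⟩⟩

theorem exists_eq_append_of_length {α : Type*} {P : List α} {l n m : ℕ}
    (h : P.length = l + (n + m)) :
    ∃ A p B, P = A ++ (p ++ B) ∧ A.length = l ∧ p.length = n ∧ B.length = m :=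
  ⟨P.take l, (P.drop l).take n, (P.drop l).drop n, by simp, by simp; omega, by simp; omega,
    by simp; omega⟩

theorem Rigid.whisker {n : ℕ} {L : List (Slice k)} (h : Rigid n (arcRules R L))
    (u v : List (Strand k)) :
    Rigid (u.length + (n + v.length)) (arcRules R (L.map (Slice.whisker u v))) where
  unique := by
    intro a b c c' ha h₁ h₂
    obtain ⟨A, p, B, rfl, hA, hp, hB⟩ := exists_eq_append_of_length ha
    obtain ⟨c₀, q, rfl, rfl, k₁⟩ := (isChain_whisker hA hB).1 h₁
    obtain ⟨c₁, q', rfl, hq, k₂⟩ := (isChain_whisker hA hB).1 h₂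
    obtain rfl : q = q' := by simpa using hq
    rw [h.unique hp k₁ k₂]
  within := by
    intro K hK a b c ha h₁ h₂ hc
    obtain ⟨A, p, B, rfl, hA, hp, hB⟩ := exists_eq_append_of_length ha
    obtain ⟨c₀, q, rfl, rfl, hc'⟩ := (isChain_whisker hA hB).1 hc
    simp only [within_append] at h₁ h₂
    intro x hx
    obtain ⟨y, hy, rfl⟩ := List.mem_map.1 hx
    simp only [within_append]
    exact ⟨h₁.1, h.within hK hp h₁.2.1 h₂.2.1 hc' y hy, h₁.2.2⟩

theorem Swap.whisker {n : ℕ} {L M : List (Slice k)} (h : Swap n (arcRules R L) (arcRules R M))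
    (u v : List (Strand k)) :
    Swap (u.length + (n + v.length)) (arcRules R (L.map (Slice.whisker u v)))
      (arcRules R (M.map (Slice.whisker u v))) where
  left := h.left.whisker u v
  right := h.right.whisker u v
  iff := by
    intro a b ha
    obtain ⟨A, p, B, rfl, hA, hp, hB⟩ := exists_eq_append_of_length ha
    simp only [isChain_whisker hA hB]
    constructor
    · rintro ⟨_, c₀, q, rfl, rfl, hc⟩
      obtain ⟨c, hc⟩ := (h.iff hp).1 ⟨c₀, hc⟩
      exact ⟨_, c, q, rfl, rfl, hc⟩
    · rintro ⟨_, c₀, q, rfl, rfl, hc⟩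
      obtain ⟨c, hc⟩ := (h.iff hp).2 ⟨c₀, hc⟩
      exact ⟨_, c, q, rfl, rfl, hc⟩

/-! ### The moves -/

/-- The permutation of colors caused by a curl. -/
def kinkPerm (R : Type*) [Rack R] (s : Strand k) (o : Bool) : Equiv.Perm R :=
  if o then s.diag R else (s.diag R)⁻¹

theorem kinkPerm_rev (s : Strand k) (o : Bool) : kinkPerm R s.rev o = kinkPerm R s (!o) := by
  cases o <;> simp [kinkPerm, Strand.diag_rev]

theorem act_kinkPerm (t s : Strand k) (o : Bool) (x : R) : t.act (kinkPerm R s o x) = t.act x := by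
  cases o
  · have := t.act_diagPerm_zpow (-s.sign) x
    rwa [zpow_neg] at this
  · exact t.act_diagPerm_zpow s.sign x

theorem act_self_eq_kinkPerm (s : Strand k) (x : R) : s.act x x = kinkPerm R s true x :=
  s.act_self x

theorem rev_act_self_eq_kinkPerm (s : Strand k) (x : R) : s.rev.act x x = kinkPerm R s false x := by
  rw [act_self_eq_kinkPerm, kinkPerm_rev]; rfl

/-- This is the equation that the closing cap of a curl imposes on the color `q` of the loop.
Undoing the action of `q` turns it into `r = δ^{∓1} q`, because `q` acts on itself diagonally. -/
theorem act_eq_self_iff (s : Strand k) (q r : R) : s.act q r = q ↔ kinkPerm R s true r = q := by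
  constructor
  · intro h
    have h' : r = (s.diag R)⁻¹ q := by
      rw [← Strand.diag_rev, ← Strand.act_self, Strand.rev_act, Equiv.Perm.eq_inv_iff_eq, h]
    rw [h', kinkPerm, if_pos rfl]; exact Equiv.apply_symm_apply _ _
  · rintro rfl
    rw [act_kinkPerm, act_self_eq_kinkPerm]

theorem rev_act_eq_self_iff (s : Strand k) (q r : R) :
    s.rev.act q r = q ↔ kinkPerm R s false r = q := by
  rw [act_eq_self_iff, kinkPerm_rev]; rfl

/-- The cup creates a loop of free color `q`, and the cap fixes it: to `r` if `o = true`, and to the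
outgoing color if `o = false`. In `isChain_kinkLeft` the two cases change roles, but the outgoing
color is the same. -/
theorem isChain_kinkRight {s : Strand k} {o : Bool} {a b : List R} {c : List (List R)} :
    IsChain (arcRules R (kinkRight s o)) a c b ↔
      ∃ r, a = [r] ∧ b = [kinkPerm R s o r] ∧
        c = if o then [[r, r, r], [kinkPerm R s o r, r, r], [kinkPerm R s o r]]
          else [[r, kinkPerm R s o r, kinkPerm R s o r],
            [kinkPerm R s o r, kinkPerm R s o r, kinkPerm R s o r], [kinkPerm R s o r]] := by
  simp only [arcRules, kinkRight, List.map_cons, List.map_nil, isChain_cons_iff, isChain_nil_iff,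
    Slice.arcRule_nil_single, Slice.arcRule_single_nil, Elem.ArcRule]
  constructor
  · rintro ⟨_, _, rfl, ⟨r, _, _, rfl, rfl, q, rfl, rfl⟩, _, _, rfl,
      ⟨t, _, _, h₁, rfl, x, y, rfl, rfl⟩, _, _, rfl, ⟨z, _, _, h₂, rfl, t', rfl, rfl⟩, rfl, rfl⟩
    refine ⟨r, rfl, ?_⟩
    simp only [List.cons_append, List.nil_append, List.cons.injEq, and_true] at h₁
    obtain ⟨rfl, rfl, rfl⟩ := h₁
    cases o <;> simp only [Bool.false_eq_true, if_false, if_true, List.cons_append,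
      List.nil_append, List.cons.injEq, and_true] at h₂ <;> obtain ⟨rfl, h₂, rfl⟩ := h₂
    · have h₃ := (rev_act_eq_self_iff _ _ _).1 h₂
      simp [h₂, h₃]
    · subst h₂
      simp [act_self_eq_kinkPerm]
  · rintro ⟨r, rfl, rfl, rfl⟩
    cases o
    · exact ⟨_, _, rfl, ⟨r, [], _, rfl, rfl, kinkPerm R s false r, rfl, rfl⟩, _, _, rfl,
        ⟨kinkPerm R s false r, [r, kinkPerm R s false r], _, rfl,
          by simp [act_kinkPerm, rev_act_self_eq_kinkPerm], _, _, rfl, rfl⟩, _, _, rfl,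
        ⟨_, [_, _], [], rfl, rfl, _, rfl, rfl⟩, rfl, rfl⟩
    · exact ⟨_, _, rfl, ⟨r, [], _, rfl, rfl, r, rfl, rfl⟩, _, _, rfl,
        ⟨r, [r, r], _, rfl, by simp [act_self_eq_kinkPerm], _, _, rfl, rfl⟩, _, _, rfl,
        ⟨_, [_, _], [], rfl, rfl, _, rfl, rfl⟩, rfl, rfl⟩

theorem isChain_kinkLeft {s : Strand k} {o : Bool} {a b : List R} {c : List (List R)} :
    IsChain (arcRules R (kinkLeft s o)) a c b ↔
      ∃ r, a = [r] ∧ b = [kinkPerm R s o r] ∧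
        c = if o then [[kinkPerm R s o r, kinkPerm R s o r, r],
              [kinkPerm R s o r, kinkPerm R s o r, kinkPerm R s o r], [kinkPerm R s o r]]
          else [[r, r, r], [r, r, kinkPerm R s o r], [kinkPerm R s o r]] := by
  simp only [arcRules, kinkLeft, List.map_cons, List.map_nil, isChain_cons_iff, isChain_nil_iff,
    Slice.arcRule_nil_single, Slice.arcRule_single_nil, Elem.ArcRule]
  constructor
  · rintro ⟨_, _, rfl, ⟨r, _, _, rfl, rfl, q, rfl, rfl⟩, _, _, rfl,
      ⟨t, _, _, h₁, rfl, x, y, rfl, rfl⟩, _, _, rfl, ⟨z, _, _, h₂, rfl, t', rfl, rfl⟩, rfl, rfl⟩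
    refine ⟨r, rfl, ?_⟩
    simp only [List.cons_append, List.nil_append, List.cons.injEq, and_true] at h₁
    obtain ⟨rfl, rfl, rfl⟩ := h₁
    cases o <;> simp only [Bool.false_eq_true, if_false, if_true, List.cons_append,
      List.nil_append, List.cons.injEq, and_true] at h₂ <;> obtain ⟨rfl, h₂, rfl⟩ := h₂
    · subst h₂
      simp [rev_act_self_eq_kinkPerm]
    · have h₃ := (act_eq_self_iff _ _ _).1 h₂
      simp [h₂, h₃]
  · rintro ⟨r, rfl, rfl, rfl⟩
    cases o
    · exact ⟨_, _, rfl, ⟨r, [], _, rfl, rfl, r, rfl, rfl⟩, _, _, rfl,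
        ⟨r, [r, r], _, rfl, by simp [rev_act_self_eq_kinkPerm], _, _, rfl, rfl⟩, _, _, rfl,
        ⟨_, [_, _], [], rfl, rfl, _, rfl, rfl⟩, rfl, rfl⟩
    · exact ⟨_, _, rfl, ⟨r, [], _, rfl, rfl, kinkPerm R s true r, rfl, rfl⟩, _, _, rfl,
        ⟨kinkPerm R s true r, [kinkPerm R s true r, r], _, rfl,
          by simp [act_kinkPerm, act_self_eq_kinkPerm], _, _, rfl, rfl⟩, _, _, rfl,
        ⟨_, [_, _], [], rfl, rfl, _, rfl, rfl⟩, rfl, rfl⟩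

theorem IsSubrack.kinkPerm_mem {K : Set R} (hK : IsSubrack K) (s : Strand k) (o : Bool) {x : R}
    (hx : x ∈ K) : kinkPerm R s o x ∈ K := by
  cases o
  · have := hK.diagPerm_zpow_mem (-s.sign) hx
    rwa [zpow_neg] at this
  · exact hK.diagPerm_zpow_mem s.sign hx

/-- Curls of equal sign on the two sides of a strand change its color by the same permutation
`kinkPerm R s o`. -/
theorem swap_framedR1 (s : Strand k) (o : Bool) :
    Swap 1 (arcRules R (kinkRight s o)) (arcRules R (kinkLeft s o)) := by
  refine Swap.of_param (fun r => [r]) (fun r => [kinkPerm R s o r]) _ _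
    (fun a c b _ => isChain_kinkRight) (fun a c b _ => isChain_kinkLeft) (by simp) ?_
  intro K hK r hr _
  simp only [within_cons, within_nil, and_true] at hr
  have := hK.kinkPerm_mem s o hr
  cases o <;> simp [hr, this]

/-- The parameter records the colors below and above `e`, on the strands `m` in between, and below
and above `f`. Both orders of the two pieces impose the same conditions on these; only the
intermediate level differs. -/
theorem swap_exchange (e f : Elem k) (m : List (Strand k)) :
    Swap (e.bot.length + (m.length + f.bot.length))
      (arcRules R [⟨[], e, m ++ f.bot⟩, ⟨e.top ++ m, f, []⟩])
      (arcRules R [⟨e.bot ++ m, f, []⟩, ⟨[], e, m ++ f.top⟩]) := by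
  have hlen : ∀ {A m' : List R} {l : ℕ}, A.length = l + m.length →
      ∃ A₁ A₂, A = A₁ ++ A₂ ∧ A₁.length = l ∧ A₂.length = m.length :=
    fun {A m' l} h => ⟨A.take l, A.drop l, by simp, by simp; omega, by simp; omega⟩
  refine Swap.of_param
    (Θ := {θ : (List R × List R) × List R × List R × List R //
      θ.2.1.length = m.length ∧ e.ArcRule θ.1.1 θ.1.2 ∧ f.ArcRule θ.2.2.1 θ.2.2.2})
    (fun θ => θ.1.1.1 ++ (θ.1.2.1 ++ θ.1.2.2.1)) (fun θ => θ.1.1.2 ++ (θ.1.2.1 ++ θ.1.2.2.2))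
    (fun θ => [θ.1.1.2 ++ (θ.1.2.1 ++ θ.1.2.2.1), θ.1.1.2 ++ (θ.1.2.1 ++ θ.1.2.2.2)])
    (fun θ => [θ.1.1.1 ++ (θ.1.2.1 ++ θ.1.2.2.2), θ.1.1.2 ++ (θ.1.2.1 ++ θ.1.2.2.2)]) ?_ ?_ ?_ ?_
  · intro a c b _
    simp only [arcRules, List.map_cons, List.map_nil, isChain_cons_iff, isChain_nil_iff,
      Slice.arcRule_nil_right, Slice.arcRule_left_nil, List.length_append]
    constructor
    · rintro ⟨_, _, rfl, ⟨B, p, q, hB, rfl, rfl, hpq⟩, _, _, rfl, ⟨A, p', q', hA, h, rfl, hpq'⟩,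
        rfl, rfl⟩
      obtain ⟨A₁, A₂, rfl, hA₁, hA₂⟩ := hlen (m' := []) hA
      rw [List.append_assoc] at h
      obtain ⟨rfl, rfl⟩ := List.append_inj h (hpq.length_eq.2.trans hA₁.symm)
      exact ⟨⟨⟨⟨p, q⟩, A₂, p', q'⟩, hA₂, hpq, hpq'⟩, by simp, by simp, by simp⟩
    · rintro ⟨⟨⟨⟨p, q⟩, A₂, p', q'⟩, hA₂, hpq, hpq'⟩, rfl, rfl, rfl⟩
      simp only at hA₂ hpq hpq'
      exact ⟨_, _, rfl, ⟨A₂ ++ p', p, q, by simp [hA₂, hpq'.length_eq], rfl, rfl, hpq⟩, _, _, rfl,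
        ⟨q ++ A₂, p', q', by simp [hA₂, hpq.length_eq], by simp, by simp, hpq'⟩, rfl, rfl⟩
  · intro a c b _
    simp only [arcRules, List.map_cons, List.map_nil, isChain_cons_iff, isChain_nil_iff,
      Slice.arcRule_nil_right, Slice.arcRule_left_nil, List.length_append]
    constructor
    · rintro ⟨_, _, rfl, ⟨A, p', q', hA, rfl, rfl, hpq'⟩, _, _, rfl, ⟨B, p, q, hB, h, rfl, hpq⟩,
        rfl, rfl⟩
      obtain ⟨A₁, A₂, rfl, hA₁, hA₂⟩ := hlen (m' := []) hA
      rw [List.append_assoc] at h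
      obtain ⟨rfl, rfl⟩ := List.append_inj h (hA₁.trans hpq.length_eq.1.symm)
      exact ⟨⟨⟨⟨A₁, q⟩, A₂, p', q'⟩, hA₂, hpq, hpq'⟩, by simp, by simp, by simp⟩
    · rintro ⟨⟨⟨⟨p, q⟩, A₂, p', q'⟩, hA₂, hpq, hpq'⟩, rfl, rfl, rfl⟩
      simp only at hA₂ hpq hpq'
      exact ⟨_, _, rfl, ⟨p ++ A₂, p', q', by simp [hA₂, hpq.length_eq], by simp, by simp, hpq'⟩,
        _, _, rfl, ⟨A₂ ++ q', p, q, by simp [hA₂, hpq'.length_eq], rfl, rfl, hpq⟩, rfl, rfl⟩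
  -- The blocks have lengths prescribed by `e`, `m` and `f`, so the concatenated lists can be cut in
  -- only one way.
  · rintro ⟨⟨⟨p, q⟩, A, p', q'⟩, hA, h, h'⟩ ⟨⟨⟨p₁, q₁⟩, A₁, p₁', q₁'⟩, hA₁, h₁, h₁'⟩ k₁ k₂
    simp only at hA h h' hA₁ h₁ h₁' k₁ k₂
    obtain ⟨e₄, k₁⟩ := List.append_inj k₁ (h.length_eq.1.trans h₁.length_eq.1.symm)
    obtain ⟨e₅, k₂⟩ := List.append_inj k₂ (h.length_eq.2.trans h₁.length_eq.2.symm)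
    obtain ⟨e₁, e₂⟩ := List.append_inj k₁ (hA.trans hA₁.symm)
    obtain ⟨-, e₃⟩ := List.append_inj k₂ (hA.trans hA₁.symm)
    subst e₁ e₂ e₃ e₄ e₅
    rfl
  · rintro K hK ⟨⟨⟨p, q⟩, A, p', q'⟩, hA, h, h'⟩ k₁ k₂
    simp only [within_append] at k₁ k₂
    simp [k₁, k₂]

theorem swap_straighten_left (s : Strand k) :
    Swap 1 (arcRules R [⟨[s], .cup s.rev, []⟩, ⟨[], .cap s, [s]⟩]) (arcRules R ([] : List (Slice k))) := by
  refine Swap.of_param (fun r : R => [r]) (fun r => [r]) (fun r => [[r, r, r], [r]]) (fun r => [])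
    ?_ ?_ (by simp) (by simp +contextual)
  · intro a c b _
    simp only [arcRules, List.map_cons, List.map_nil, isChain_cons_iff, isChain_nil_iff,
      Slice.arcRule_nil_single, Slice.arcRule_single_nil, Elem.ArcRule]
    constructor
    · rintro ⟨_, _, rfl, ⟨r, _, _, rfl, rfl, q, rfl, rfl⟩, _, _, rfl,
        ⟨t, _, _, h₁, rfl, x, rfl, rfl⟩, rfl, rfl⟩
      simp only [List.cons_append, List.nil_append, List.cons.injEq, and_true] at h₁
      obtain ⟨rfl, rfl, rfl⟩ := h₁
      exact ⟨_, rfl, by simp, by simp⟩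
    · rintro ⟨r, rfl, rfl, rfl⟩
      exact ⟨_, _, rfl, ⟨r, [], _, rfl, rfl, _, rfl, rfl⟩, _, _, rfl,
        ⟨r, [_, _], [], rfl, rfl, _, rfl, rfl⟩, rfl, rfl⟩
  · intro a c b ha
    obtain ⟨r, rfl⟩ := List.length_eq_one_iff.1 ha
    simp [arcRules, isChain_nil_iff, and_comm, eq_comm]

theorem swap_straighten_right (s : Strand k) :
    Swap 1 (arcRules R [⟨[], .cup s, [s]⟩, ⟨[s], .cap s.rev, []⟩]) (arcRules R ([] : List (Slice k))) := by
  refine Swap.of_param (fun r : R => [r]) (fun r => [r]) (fun r => [[r, r, r], [r]]) (fun r => [])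
    ?_ ?_ (by simp) (by simp +contextual)
  · intro a c b _
    simp only [arcRules, List.map_cons, List.map_nil, isChain_cons_iff, isChain_nil_iff,
      Slice.arcRule_nil_single, Slice.arcRule_single_nil, Elem.ArcRule]
    constructor
    · rintro ⟨_, _, rfl, ⟨r, _, _, rfl, rfl, q, rfl, rfl⟩, _, _, rfl,
        ⟨t, _, _, h₁, rfl, x, rfl, rfl⟩, rfl, rfl⟩
      simp only [List.cons_append, List.nil_append, List.cons.injEq, and_true] at h₁
      obtain ⟨rfl, rfl, rfl⟩ := h₁
      exact ⟨_, rfl, by simp, by simp⟩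
    · rintro ⟨r, rfl, rfl, rfl⟩
      exact ⟨_, _, rfl, ⟨r, [], _, rfl, rfl, _, rfl, rfl⟩, _, _, rfl,
        ⟨r, [_, _], [], rfl, rfl, _, rfl, rfl⟩, rfl, rfl⟩
  · intro a c b ha
    obtain ⟨r, rfl⟩ := List.length_eq_one_iff.1 ha
    simp [arcRules, isChain_nil_iff, and_comm, eq_comm]

theorem Strand.act_rev_act (s : Strand k) (x y : R) : s.act x (s.rev.act x y) = y := by
  rw [Strand.rev_act]; exact Equiv.apply_symm_apply _ _

theorem Strand.rev_act_act (s : Strand k) (x y : R) : s.rev.act x (s.act x y) = y := by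
  rw [Strand.rev_act]; exact Equiv.symm_apply_apply _ _

theorem swap_slide_cap (s c : Strand k) (o : Bool) :
    Swap 3 (arcRules R [⟨[s], .cross c s.rev o, []⟩, ⟨[], .cap s, [c]⟩])
      (arcRules R [⟨[], .cross s c (!o), [s.rev]⟩, ⟨[c], .cap s, []⟩]) := by
  cases o
  -- Here `c` passes under the maximum; the parameters are the color of the maximum and that of `c`
  -- at the bottom.
  · refine Swap.of_param (fun θ : R × R => [θ.1, θ.2, θ.1]) (fun θ => [s.act θ.1 θ.2])
      (fun θ => [[θ.1, θ.1, s.act θ.1 θ.2], [s.act θ.1 θ.2]])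
      (fun θ => [[s.act θ.1 θ.2, θ.1, θ.1], [s.act θ.1 θ.2]]) ?_ ?_
      (by rintro ⟨x, y⟩ ⟨x', y'⟩ h -; simp_all) (by intro K hK ⟨x, y⟩; simp +contextual)
    · intro a d b _
      simp only [arcRules, List.map_cons, List.map_nil, isChain_cons_iff, isChain_nil_iff,
        Slice.arcRule_nil_single, Slice.arcRule_single_nil, Elem.ArcRule, Bool.false_eq_true,
        if_false, Strand.rev_rev]
      constructor
      · rintro ⟨_, _, rfl, ⟨r, _, _, rfl, rfl, x, y, rfl, rfl⟩, _, _, rfl,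
          ⟨t, _, _, h₁, rfl, z, rfl, rfl⟩, rfl, rfl⟩
        simp only [List.cons_append, List.nil_append, List.cons.injEq, and_true] at h₁
        obtain ⟨rfl, rfl, rfl⟩ := h₁
        exact ⟨(_, _), rfl, rfl, rfl⟩
      · rintro ⟨⟨x, y⟩, rfl, rfl, rfl⟩
        exact ⟨_, _, rfl, ⟨_, [_, _], _, rfl, rfl, _, _, rfl, rfl⟩, _, _, rfl,
          ⟨_, [_, _], [], rfl, rfl, _, rfl, rfl⟩, rfl, rfl⟩
    · intro a d b _
      simp only [arcRules, List.map_cons, List.map_nil, isChain_cons_iff, isChain_nil_iff,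
        Slice.arcRule_nil_single, Slice.arcRule_single_nil, Elem.ArcRule, Bool.not_false, if_true]
      constructor
      · rintro ⟨_, _, rfl, ⟨r, _, _, rfl, rfl, x, y, rfl, rfl⟩, _, _, rfl,
          ⟨t, _, _, h₁, rfl, z, rfl, rfl⟩, rfl, rfl⟩
        simp only [List.cons_append, List.nil_append, List.cons.injEq, and_true] at h₁
        obtain ⟨rfl, rfl, rfl⟩ := h₁
        exact ⟨(_, _), rfl, rfl, rfl⟩
      · rintro ⟨⟨x, y⟩, rfl, rfl, rfl⟩
        exact ⟨_, _, rfl, ⟨_, [_, _], _, rfl, rfl, _, _, rfl, rfl⟩, _, _, rfl,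
          ⟨_, [_, _], [], rfl, rfl, _, rfl, rfl⟩, rfl, rfl⟩
  -- Here `c` passes over the maximum; the parameters are the color of `c` and that of the right
  -- branch at the bottom.
  · refine Swap.of_param (fun θ : R × R => [c.act θ.1 θ.2, θ.1, θ.2]) (fun θ => [θ.1])
      (fun θ => [[c.act θ.1 θ.2, c.act θ.1 θ.2, θ.1], [θ.1]])
      (fun θ => [[θ.1, θ.2, θ.2], [θ.1]]) ?_ ?_
      (by rintro ⟨x, y⟩ ⟨x', y'⟩ h -; simp_all) (by intro K hK ⟨x, y⟩; simp +contextual)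
    · intro a d b _
      simp only [arcRules, List.map_cons, List.map_nil, isChain_cons_iff, isChain_nil_iff,
        Slice.arcRule_nil_single, Slice.arcRule_single_nil, Elem.ArcRule, if_true]
      constructor
      · rintro ⟨_, _, rfl, ⟨r, _, _, rfl, rfl, x, y, rfl, rfl⟩, _, _, rfl,
          ⟨t, _, _, h₁, rfl, z, rfl, rfl⟩, rfl, rfl⟩
        simp only [List.cons_append, List.nil_append, List.cons.injEq, and_true] at h₁
        obtain ⟨rfl, rfl, rfl⟩ := h₁
        exact ⟨(_, _), rfl, rfl, rfl⟩
      · rintro ⟨⟨x, y⟩, rfl, rfl, rfl⟩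
        exact ⟨_, _, rfl, ⟨_, [_, _], _, rfl, rfl, _, _, rfl, rfl⟩, _, _, rfl,
          ⟨_, [_, _], [], rfl, rfl, _, rfl, rfl⟩, rfl, rfl⟩
    · intro a d b _
      simp only [arcRules, List.map_cons, List.map_nil, isChain_cons_iff, isChain_nil_iff,
        Slice.arcRule_nil_single, Slice.arcRule_single_nil, Elem.ArcRule, Bool.not_true,
        Bool.false_eq_true, if_false]
      constructor
      · rintro ⟨_, _, rfl, ⟨r, _, _, rfl, rfl, x, y, rfl, rfl⟩, _, _, rfl,
          ⟨t, _, _, h₁, rfl, z, rfl, rfl⟩, rfl, rfl⟩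
        simp only [List.cons_append, List.nil_append, List.cons.injEq, and_true] at h₁
        obtain ⟨rfl, rfl, rfl⟩ := h₁
        exact ⟨(_, _), by simp [Strand.act_rev_act], rfl, rfl⟩
      · rintro ⟨⟨x, y⟩, rfl, rfl, rfl⟩
        exact ⟨_, _, rfl, ⟨y, [c.act x y, x], [x, y], rfl, rfl, _, _, rfl,
          by simp [Strand.rev_act_act]⟩, _, _, rfl, ⟨_, [_, _], [], rfl, rfl, _, rfl, rfl⟩,
          rfl, rfl⟩

theorem swap_slide_cup (s c : Strand k) (o : Bool) :
    Swap 1 (arcRules R [⟨[], .cup s, [c]⟩, ⟨[s], .cross s.rev c o, []⟩])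
      (arcRules R [⟨[c], .cup s, []⟩, ⟨[], .cross c s (!o), [s.rev]⟩]) := by
  cases o
  -- Here `c` passes over the minimum; the parameters are the color of `c` and that of the left
  -- branch at the top. The bottom alone does not determine them.
  · refine Swap.of_param (fun θ : R × R => [θ.1]) (fun θ => [θ.2, θ.1, c.rev.act θ.1 θ.2])
      (fun θ => [[θ.2, θ.2, θ.1], [θ.2, θ.1, c.rev.act θ.1 θ.2]])
      (fun θ => [[θ.1, c.rev.act θ.1 θ.2, c.rev.act θ.1 θ.2],
        [θ.2, θ.1, c.rev.act θ.1 θ.2]]) ?_ ?_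
      (by rintro ⟨x, y⟩ ⟨x', y'⟩ - h; simp_all) (by intro K hK ⟨x, y⟩; simp +contextual)
    · intro a d b _
      simp only [arcRules, List.map_cons, List.map_nil, isChain_cons_iff, isChain_nil_iff,
        Slice.arcRule_nil_single, Slice.arcRule_single_nil, Elem.ArcRule, Bool.false_eq_true,
        if_false]
      constructor
      · rintro ⟨_, _, rfl, ⟨r, _, _, rfl, rfl, z, rfl, rfl⟩, _, _, rfl,
          ⟨t, _, _, h₁, rfl, x, y, rfl, rfl⟩, rfl, rfl⟩
        simp only [List.cons_append, List.nil_append, List.cons.injEq, and_true] at h₁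
        obtain ⟨rfl, rfl, rfl⟩ := h₁
        exact ⟨(_, _), rfl, rfl, rfl⟩
      · rintro ⟨⟨x, y⟩, rfl, rfl, rfl⟩
        exact ⟨_, _, rfl, ⟨_, [], _, rfl, rfl, _, rfl, rfl⟩, _, _, rfl,
          ⟨_, [_, _], _, rfl, rfl, _, _, rfl, rfl⟩, rfl, rfl⟩
    · intro a d b _
      simp only [arcRules, List.map_cons, List.map_nil, isChain_cons_iff, isChain_nil_iff,
        Slice.arcRule_nil_single, Slice.arcRule_single_nil, Elem.ArcRule, Bool.not_false, if_true]
      constructor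
      · rintro ⟨_, _, rfl, ⟨r, _, _, rfl, rfl, z, rfl, rfl⟩, _, _, rfl,
          ⟨t, _, _, h₁, rfl, x, y, rfl, rfl⟩, rfl, rfl⟩
        simp only [List.cons_append, List.nil_append, List.cons.injEq, and_true] at h₁
        obtain ⟨rfl, rfl, rfl⟩ := h₁
        exact ⟨(r, c.act r z), rfl, by simp [Strand.rev_act_act], by simp [Strand.rev_act_act]⟩
      · rintro ⟨⟨x, y⟩, rfl, rfl, rfl⟩
        exact ⟨_, _, rfl, ⟨_, [], _, rfl, rfl, _, rfl, rfl⟩, _, _, rfl,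
          ⟨c.rev.act x y, [x, c.rev.act x y], [y, x], rfl, rfl, _, _, rfl,
            by simp [Strand.act_rev_act]⟩, rfl, rfl⟩
  -- Here `c` passes under the minimum; the parameters are the color of the minimum and that of `c`
  -- at the top.
  · refine Swap.of_param (fun θ : R × R => [s.act θ.1 θ.2]) (fun θ => [θ.1, θ.2, θ.1])
      (fun θ => [[θ.1, θ.1, s.act θ.1 θ.2], [θ.1, θ.2, θ.1]])
      (fun θ => [[s.act θ.1 θ.2, θ.1, θ.1], [θ.1, θ.2, θ.1]]) ?_ ?_
      (by rintro ⟨x, y⟩ ⟨x', y'⟩ - h; simp_all) (by intro K hK ⟨x, y⟩; simp +contextual)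
    · intro a d b _
      simp only [arcRules, List.map_cons, List.map_nil, isChain_cons_iff, isChain_nil_iff,
        Slice.arcRule_nil_single, Slice.arcRule_single_nil, Elem.ArcRule, if_true]
      constructor
      · rintro ⟨_, _, rfl, ⟨r, _, _, rfl, rfl, z, rfl, rfl⟩, _, _, rfl,
          ⟨t, _, _, h₁, rfl, x, y, rfl, rfl⟩, rfl, rfl⟩
        simp only [List.cons_append, List.nil_append, List.cons.injEq, and_true] at h₁
        obtain ⟨rfl, rfl, rfl⟩ := h₁
        exact ⟨(z, s.rev.act z r), by simp [Strand.act_rev_act], rfl, by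
          simp [Strand.act_rev_act]⟩
      · rintro ⟨⟨x, y⟩, rfl, rfl, rfl⟩
        exact ⟨_, _, rfl, ⟨_, [], _, rfl, rfl, _, rfl, rfl⟩, _, _, rfl,
          ⟨x, [x, s.act x y], [y, x], rfl, rfl, _, _, rfl, by simp [Strand.rev_act_act]⟩,
          rfl, rfl⟩
    · intro a d b _
      simp only [arcRules, List.map_cons, List.map_nil, isChain_cons_iff, isChain_nil_iff,
        Slice.arcRule_nil_single, Slice.arcRule_single_nil, Elem.ArcRule, Bool.not_true,
        Bool.false_eq_true, if_false]
      constructor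
      · rintro ⟨_, _, rfl, ⟨r, _, _, rfl, rfl, z, rfl, rfl⟩, _, _, rfl,
          ⟨t, _, _, h₁, rfl, x, y, rfl, rfl⟩, rfl, rfl⟩
        simp only [List.cons_append, List.nil_append, List.cons.injEq, and_true] at h₁
        obtain ⟨rfl, rfl, rfl⟩ := h₁
        exact ⟨(z, s.rev.act z r), by simp [Strand.act_rev_act], rfl, by
          simp [Strand.act_rev_act]⟩
      · rintro ⟨⟨x, y⟩, rfl, rfl, rfl⟩
        exact ⟨_, _, rfl, ⟨_, [], _, rfl, rfl, _, rfl, rfl⟩, _, _, rfl,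
          ⟨x, [s.act x y, x], [x, y], rfl, rfl, _, _, rfl, by simp [Strand.rev_act_act]⟩,
          rfl, rfl⟩

/-- The pair of colors, from left to right, above a crossing. -/
def crossOut (a b : Strand k) (o : Bool) (x y : R) : R × R :=
  if o then (a.act x y, x) else (y, b.rev.act y x)

theorem Elem.arcRule_cross {a b : Strand k} {o : Bool} {p q : List R} :
    (Elem.cross a b o).ArcRule p q ↔
      ∃ x y, p = [x, y] ∧ q = [(crossOut a b o x y).1, (crossOut a b o x y).2] := by
  cases o <;> simp [Elem.ArcRule, crossOut]

theorem IsSubrack.crossOut_mem {K : Set R} (hK : IsSubrack K) (a b : Strand k) (o : Bool) {x y : R}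
    (hx : x ∈ K) (hy : y ∈ K) : (crossOut a b o x y).1 ∈ K ∧ (crossOut a b o x y).2 ∈ K := by
  cases o <;> simp [crossOut, hK.strand_act, hx, hy]

theorem swap_R2 (a b : Strand k) (o : Bool) :
    Swap 2 (arcRules R [⟨[], .cross a b o, []⟩, ⟨[], .cross b a (!o), []⟩])
      (arcRules R ([] : List (Slice k))) := by
  refine Swap.of_param (fun θ : R × R => [θ.1, θ.2]) (fun θ => [θ.1, θ.2])
    (fun θ => [[(crossOut a b o θ.1 θ.2).1, (crossOut a b o θ.1 θ.2).2], [θ.1, θ.2]])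
    (fun θ => []) ?_ ?_ (by rintro ⟨x, y⟩ ⟨x', y'⟩ h -; simp_all) ?_
  · intro l c l' _
    simp only [arcRules, List.map_cons, List.map_nil, isChain_cons_iff, isChain_nil_iff,
      Slice.arcRule_nil_nil, Elem.arcRule_cross]
    constructor
    · rintro ⟨_, _, rfl, ⟨x, y, rfl, rfl⟩, _, _, rfl, ⟨x', y', h, rfl⟩, rfl, rfl⟩
      simp only [List.cons.injEq, and_true] at h
      obtain ⟨rfl, rfl⟩ := h
      refine ⟨(x, y), ?_⟩
      cases o <;> simp [crossOut, Strand.act_rev_act, Strand.rev_act_act]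
    · rintro ⟨⟨x, y⟩, rfl, rfl, rfl⟩
      refine ⟨_, _, rfl, ⟨x, y, rfl, rfl⟩, _, _, rfl, ⟨_, _, rfl, ?_⟩, rfl, rfl⟩
      cases o <;> simp [crossOut, Strand.act_rev_act, Strand.rev_act_act]
  · intro l c l' h
    obtain ⟨x, y, rfl⟩ := List.length_eq_two.1 h
    simp only [arcRules, List.map_nil, isChain_nil_iff]
    constructor
    · rintro ⟨rfl, rfl⟩
      exact ⟨(x, y), rfl, rfl, rfl⟩
    · rintro ⟨⟨x', y'⟩, h, rfl, rfl⟩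
      exact ⟨rfl, h⟩
  · rintro K hK ⟨x, y⟩ h -
    simp only [within_cons, within_nil, and_true] at h
    simp [h, hK.crossOut_mem a b o h.1 h.2]

/-- The colors at the bottom determine everything above them on both sides, so the claim is that the
outgoing colors coincide (`key`). This is self-distributivity in the form `Strand.act_act`. -/
theorem swap_R3 (a b c : Strand k) (ab ac bc : Bool) (h : ab = bc → ac = ab) :
    Swap 3
      (arcRules R
        [⟨[], .cross a b ab, [c]⟩, ⟨[b], .cross a c ac, []⟩, ⟨[], .cross b c bc, [a]⟩])
      (arcRules R
        [⟨[a], .cross b c bc, []⟩, ⟨[], .cross a c ac, [b]⟩, ⟨[c], .cross a b ab, []⟩]) := by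
  have key : ∀ x y z : R,
      (crossOut b c bc (crossOut a b ab x y).1 (crossOut a c ac (crossOut a b ab x y).2 z).1).1 =
        (crossOut a c ac x (crossOut b c bc y z).1).1 ∧
      (crossOut b c bc (crossOut a b ab x y).1 (crossOut a c ac (crossOut a b ab x y).2 z).1).2 =
        (crossOut a b ab (crossOut a c ac x (crossOut b c bc y z).1).2
          (crossOut b c bc y z).2).1 ∧
      (crossOut a c ac (crossOut a b ab x y).2 z).2 =
        (crossOut a b ab (crossOut a c ac x (crossOut b c bc y z).1).2
          (crossOut b c bc y z).2).2 := by
    intro x y z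
    revert h
    have h₁ : ∀ (s t : Strand k) (x y z : R),
        s.act (t.act x y) (t.act x z) = t.act x (s.act y z) :=
      fun s t x y z => (Strand.act_act t s x y z).symm
    -- The hypothesis on the heights rules out the two cyclic cases. The two goals that remain are
    -- those with `b` on top, whose action on the other two strands has to be moved across their
    -- crossing.
    cases ab <;> cases ac <;> cases bc <;> simp [crossOut, h₁]
    · rw [Strand.act_act b.rev, Strand.rev_act_act]
    · rw [Strand.act_act b, Strand.act_rev_act]
  refine Swap.of_param (fun θ : R × R × R => [θ.1, θ.2.1, θ.2.2])
    (fun θ => [(crossOut a c ac θ.1 (crossOut b c bc θ.2.1 θ.2.2).1).1,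
      (crossOut a b ab (crossOut a c ac θ.1 (crossOut b c bc θ.2.1 θ.2.2).1).2
        (crossOut b c bc θ.2.1 θ.2.2).2).1,
      (crossOut a b ab (crossOut a c ac θ.1 (crossOut b c bc θ.2.1 θ.2.2).1).2
        (crossOut b c bc θ.2.1 θ.2.2).2).2])
    (fun θ => [[(crossOut a b ab θ.1 θ.2.1).1, (crossOut a b ab θ.1 θ.2.1).2, θ.2.2],
      [(crossOut a b ab θ.1 θ.2.1).1,
        (crossOut a c ac (crossOut a b ab θ.1 θ.2.1).2 θ.2.2).1,
        (crossOut a c ac (crossOut a b ab θ.1 θ.2.1).2 θ.2.2).2],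
      [(crossOut a c ac θ.1 (crossOut b c bc θ.2.1 θ.2.2).1).1,
      (crossOut a b ab (crossOut a c ac θ.1 (crossOut b c bc θ.2.1 θ.2.2).1).2
        (crossOut b c bc θ.2.1 θ.2.2).2).1,
      (crossOut a b ab (crossOut a c ac θ.1 (crossOut b c bc θ.2.1 θ.2.2).1).2
        (crossOut b c bc θ.2.1 θ.2.2).2).2]])
    (fun θ => [[θ.1, (crossOut b c bc θ.2.1 θ.2.2).1, (crossOut b c bc θ.2.1 θ.2.2).2],
      [(crossOut a c ac θ.1 (crossOut b c bc θ.2.1 θ.2.2).1).1,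
        (crossOut a c ac θ.1 (crossOut b c bc θ.2.1 θ.2.2).1).2,
        (crossOut b c bc θ.2.1 θ.2.2).2],
      [(crossOut a c ac θ.1 (crossOut b c bc θ.2.1 θ.2.2).1).1,
      (crossOut a b ab (crossOut a c ac θ.1 (crossOut b c bc θ.2.1 θ.2.2).1).2
        (crossOut b c bc θ.2.1 θ.2.2).2).1,
      (crossOut a b ab (crossOut a c ac θ.1 (crossOut b c bc θ.2.1 θ.2.2).1).2
        (crossOut b c bc θ.2.1 θ.2.2).2).2]])
    ?_ ?_ (by rintro ⟨x, y⟩ ⟨x', y'⟩ h -; simp_all [Prod.ext_iff]) ?_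
  · intro l d l' _
    simp only [arcRules, List.map_cons, List.map_nil, isChain_cons_iff, isChain_nil_iff,
      Slice.arcRule_nil_single, Slice.arcRule_single_nil, Elem.arcRule_cross]
    constructor
    · rintro ⟨_, _, rfl, ⟨z, _, _, rfl, rfl, x, y, rfl, rfl⟩, _, _, rfl,
        ⟨_, _, _, h₁, rfl, x', y', rfl, rfl⟩, _, _, rfl, ⟨_, _, _, h₂, rfl, x'', y'', rfl, rfl⟩,
        rfl, rfl⟩
      simp only [List.cons_append, List.nil_append, List.cons.injEq, and_true] at h₁ h₂
      obtain ⟨rfl, rfl, rfl⟩ := h₁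
      obtain ⟨rfl, rfl, rfl⟩ := h₂
      refine ⟨(x, y, z), rfl, ?_, ?_⟩ <;> simp [key]
    · rintro ⟨⟨x, y, z⟩, rfl, rfl, rfl⟩
      exact ⟨_, _, rfl, ⟨z, [_, _], _, rfl, rfl, x, y, rfl, rfl⟩, _, _, rfl,
        ⟨_, [_, _], _, rfl, rfl, _, _, rfl, rfl⟩, _, _, rfl,
        ⟨_, [_, _], _, rfl, by simp only [← key]; rfl, _, _, rfl, rfl⟩, rfl, rfl⟩
  · intro l d l' _
    simp only [arcRules, List.map_cons, List.map_nil, isChain_cons_iff, isChain_nil_iff,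
      Slice.arcRule_nil_single, Slice.arcRule_single_nil, Elem.arcRule_cross]
    constructor
    · rintro ⟨_, _, rfl, ⟨x, _, _, rfl, rfl, y, z, rfl, rfl⟩, _, _, rfl,
        ⟨_, _, _, h₁, rfl, x', y', rfl, rfl⟩, _, _, rfl, ⟨_, _, _, h₂, rfl, x'', y'', rfl, rfl⟩,
        rfl, rfl⟩
      simp only [List.cons_append, List.nil_append, List.cons.injEq, and_true] at h₁ h₂
      obtain ⟨rfl, rfl, rfl⟩ := h₁
      obtain ⟨rfl, rfl, rfl⟩ := h₂
      exact ⟨(x, y, z), rfl, rfl, rfl⟩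
    · rintro ⟨⟨x, y, z⟩, rfl, rfl, rfl⟩
      exact ⟨_, _, rfl, ⟨x, [_, _], _, rfl, rfl, _, _, rfl, rfl⟩, _, _, rfl,
        ⟨_, [_, _], _, rfl, rfl, _, _, rfl, rfl⟩, _, _, rfl,
        ⟨_, [_, _], _, rfl, rfl, _, _, rfl, rfl⟩, rfl, rfl⟩
  · rintro K hK ⟨x, y, z⟩ hx hq
    simp only [within_cons, within_nil, and_true] at hx hq
    have h₁ := hK.crossOut_mem a b ab hx.1 hx.2.1
    have h₂ := hK.crossOut_mem a c ac h₁.2 hx.2.2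
    have h₃ := hK.crossOut_mem b c bc hx.2.1 hx.2.2
    have h₄ := hK.crossOut_mem a c ac hx.1 h₃.1
    simp [hx, hq, h₁, h₂, h₃, h₄]

theorem FramedMove.swap {L M : List (Slice k)} (h : FramedMove L M) {S T : List (Strand k)}
    (hL : IsPath S L T) : IsPath S M T ∧ Swap S.length (arcRules R L) (arcRules R M) := by
  cases h with
  | exchange e f m =>
    obtain ⟨rfl, -, rfl⟩ := hL
    refine ⟨by simp [IsPath, Slice.bot, Slice.top], ?_⟩
    simpa [Slice.bot] using swap_exchange e f m
  | straighten_left s =>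
    obtain ⟨rfl, -, rfl⟩ := hL
    exact ⟨by simp [IsPath, Slice.bot, Slice.top, Elem.bot, Elem.top], swap_straighten_left s⟩
  | straighten_right s =>
    obtain ⟨rfl, -, rfl⟩ := hL
    exact ⟨by simp [IsPath, Slice.bot, Slice.top, Elem.bot, Elem.top], swap_straighten_right s⟩
  | slide_cap s c o =>
    obtain ⟨rfl, -, rfl⟩ := hL
    exact ⟨by simp [IsPath, Slice.bot, Slice.top, Elem.bot, Elem.top], swap_slide_cap s c o⟩
  | slide_cup s c o =>
    obtain ⟨rfl, -, rfl⟩ := hL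
    exact ⟨by simp [IsPath, Slice.bot, Slice.top, Elem.bot, Elem.top], swap_slide_cup s c o⟩
  | framedR1 s o =>
    obtain ⟨rfl, -, -, rfl⟩ := hL
    exact ⟨by simp [kinkLeft, IsPath, Slice.bot, Slice.top, Elem.bot, Elem.top],
      swap_framedR1 s o⟩
  | R2 a b o =>
    obtain ⟨rfl, -, rfl⟩ := hL
    exact ⟨by simp [IsPath, Slice.bot, Slice.top, Elem.bot, Elem.top], swap_R2 a b o⟩
  | R3 a b c ab ac bc h =>
    obtain ⟨rfl, -, -, rfl⟩ := hL
    exact ⟨by simp [IsPath, Slice.bot, Slice.top, Elem.bot, Elem.top], swap_R3 a b c ab ac bc h⟩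

end ArcColorings

/-! ## Shadow colorings in terms of the colors of the arcs and of the leftmost region -/

section SliceRules

variable {R X : Type*} [Rack R] {k : ℕ}

theorem SliceRule.arcRule {σ : Slice k} {a b : Level R X} (h : SliceRule σ a b) :
    σ.ArcRule a.arcs b.arcs := by
  cases h with
  | cup s r x y hA hB hG hH => exact ⟨_, _, [], [r, r], hA, hB, rfl, rfl, r, rfl, rfl⟩
  | cap s r x y hA hB hG hH => exact ⟨_, _, [r, r], [], hA, hB, rfl, rfl, r, rfl, rfl⟩
  | cross a b o x y x' y' g h h' l hA hB hG hH hc =>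
    refine ⟨_, _, [x, y], [y', x'], hA, hB, rfl, rfl, x, y, rfl, ?_⟩
    rw [crossingRule_iff] at hc
    cases o <;> simpa using hc

theorem SliceRule.head?_eq {σ : Slice k} {a b : Level R X} (h : SliceRule σ a b) :
    a.regions.head? = b.regions.head? := by
  cases h with
  | @cup u v A B G H s r x y hA hB hG hH => cases G <;> rfl
  | @cap u v A B G H s r x y hA hB hG hH => cases G <;> rfl
  | @cross u v A B G H a b o x y x' y' g h h' l hA hB hG hH hc => cases G <;> rfl

theorem IsChain.length_of_isPath {w : List (Slice k)} : ∀ {S T : List (Strand k)} {A B : List R}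
    {c : List (List R)}, IsChain (arcRules R w) A c B → IsPath S w T → A.length = S.length →
      B.length = T.length := by
  induction w with
  | nil =>
    intro S T A B c hc hp hA
    obtain ⟨-, rfl⟩ := isChain_nil_iff.1 hc
    obtain rfl : S = T := hp
    exact hA
  | cons σ w ih =>
    intro S T A B c hc hp hA
    obtain ⟨A', c, rfl, h₁, hc⟩ := isChain_cons_iff.1 hc
    exact ih hc hp.2 h₁.length_eq.2

end SliceRules

/-! ### Region colors propagated from the leftmost region -/

section Regions

variable {R X : Type*} [Rack R] [RackShadow R X] {k : ℕ}

theorem RackShadow.act_rack_act (q r : R) :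
    (RackShadow.act (q ◃ r) : Equiv.Perm X) =
      RackShadow.act q * RackShadow.act r * (RackShadow.act q)⁻¹ := by
  rw [eq_mul_inv_iff_mul_eq]
  exact Equiv.ext fun x => (RackShadow.act_act r q x).symm

theorem RackShadow.act_rack_invAct (q r : R) :
    (RackShadow.act (q ◃⁻¹ r) : Equiv.Perm X) =
      (RackShadow.act q)⁻¹ * RackShadow.act r * RackShadow.act q := by
  have h := RackShadow.act_rack_act (X := X) q (q ◃⁻¹ r)
  rw [Rack.act_invAct_eq] at h
  rw [h]
  group

/-- The color of the region on the right of a strand of color `r` is obtained by this permutation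
from the color of the region on its left. -/
def Strand.cross (X : Type*) [RackShadow R X] (s : Strand k) (r : R) : Equiv.Perm X :=
  if s.up then (RackShadow.act r)⁻¹ else RackShadow.act r

theorem Strand.cross_rev (s : Strand k) (r : R) : s.rev.cross X r = (s.cross X r)⁻¹ := by
  rcases s with ⟨c, _ | _⟩ <;> simp [Strand.cross, Strand.rev]

/-- A path from left to right may pass below or above the crossing. The two results agree because
the under-strand changes its color by the over-strand, which acts on permutations of `X` by
conjugation. -/
theorem Strand.cross_mul_cross (a b : Strand k) (o : Bool) (x y : R) :
    a.cross X (crossOut a b o x y).2 * b.cross X (crossOut a b o x y).1 =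
      b.cross X y * a.cross X x := by
  rcases a with ⟨ca, _ | _⟩ <;> rcases b with ⟨cb, _ | _⟩ <;> cases o <;>
    simp only [crossOut, Strand.cross, Strand.act, Strand.rev, Bool.not_true, Bool.not_false,
      Bool.false_eq_true, if_false, if_true, Rack.act'_apply, Rack.invAct_apply,
      RackShadow.act_rack_act, RackShadow.act_rack_invAct] <;> group

/-- The colors of all the regions at a level but the rightmost one, when `x` is the color of the
leftmost region. -/
def initRegions : List (Strand k) → List R → X → List X
  | s :: S, r :: A, x => x :: initRegions S A (s.cross X r x)
  | _, _, _ => []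

/-- The color of the rightmost region at a level. -/
def lastRegion : List (Strand k) → List R → X → X
  | s :: S, r :: A, x => lastRegion S A (s.cross X r x)
  | _, _, x => x

/-- The colors of the regions at a level. -/
def regions (S : List (Strand k)) (A : List R) (x : X) : List X :=
  initRegions S A x ++ [lastRegion S A x]

@[simp] theorem regions_nil (A : List R) (x : X) : regions ([] : List (Strand k)) A x = [x] := rfl

@[simp] theorem regions_cons (s : Strand k) (S : List (Strand k)) (r : R) (A : List R) (x : X) :
    regions (s :: S) (r :: A) x = x :: regions S A (s.cross X r x) := rfl

theorem length_initRegions : ∀ {S : List (Strand k)} {A : List R}, A.length = S.length →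
    ∀ x : X, (initRegions S A x).length = S.length
  | [], _, _, _ => rfl
  | s :: S, r :: A, h, x => by simp [initRegions, length_initRegions (S := S) (A := A) (by simpa using h)]
  | _ :: _, [], h, _ => by simp at h

theorem regions_append {S : List (Strand k)} : ∀ {A : List R}, A.length = S.length →
    ∀ (S' : List (Strand k)) (A' : List R) (x : X),
    regions (S ++ S') (A ++ A') x = initRegions S A x ++ regions S' A' (lastRegion S A x) := by
  induction S with
  | nil => intro A h S' A' x; obtain rfl := List.length_eq_zero_iff.1 h; rfl
  | cons s S ih =>
    intro A h S' A' x
    cases A with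
    | nil => simp at h
    | cons r A => simp [ih (by simpa using h), initRegions, lastRegion]

theorem head?_regions (S : List (Strand k)) (A : List R) (x : X) :
    (regions S A x).head? = some x := by
  cases S <;> cases A <;> rfl

/-- Each strand turns the color on its left into the color on its right by a bijection, so the
leftmost color is free and determines the others. -/
theorem edgeRule_iff {S : List (Strand k)} : ∀ {A : List R} {G : List X},
    EdgeRule S A G ↔ A.length = S.length ∧ ∃ x, G = regions S A x := by
  induction S with
  | nil =>
    intro A G
    rcases A with _ | ⟨r, A⟩ <;> rcases G with _ | ⟨x, _ | ⟨y, G⟩⟩ <;> simp [EdgeRule]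
  | cons s S ih =>
    intro A G
    rcases A with _ | ⟨r, A⟩
    · simp [EdgeRule]
    rcases G with _ | ⟨x, _ | ⟨y, G⟩⟩
    · simp [EdgeRule]
    · simp only [EdgeRule, false_iff, regions_cons, List.cons.injEq, not_and, not_exists]
      intro _ y _ h
      have := head?_regions S A (s.cross X r y)
      rw [← h] at this
      simp at this
    · simp only [EdgeRule, ih, List.length_cons, add_left_inj, regions_cons, List.cons.injEq]
      have key : (if s.up = true then x = RackShadow.act r y else y = RackShadow.act r x) ↔
          s.cross X r x = y := by
        rcases s with ⟨c, _ | _⟩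
        · simp [Strand.cross, eq_comm]
        · simp [Strand.cross, Equiv.symm_apply_eq]
      rw [key]
      constructor
      · rintro ⟨rfl, h, z, hz⟩
        have := congrArg List.head? hz
        rw [head?_regions] at this
        simp only [List.head?_cons, Option.some.injEq] at this
        exact ⟨h, x, rfl, by rw [hz, ← this]⟩
      · rintro ⟨h, z, rfl, hz⟩
        have := congrArg List.head? hz
        rw [head?_regions] at this
        simp only [List.head?_cons, Option.some.injEq] at this
        exact ⟨this.symm, h, y, by rw [hz, ← this]⟩

/-- The level with the given colors of the arcs and of the leftmost region. -/
def mkLevel (x : X) (S : List (Strand k)) (A : List R) : Level R X := ⟨A, regions S A x⟩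

/-- Regions impose no condition of their own: at a cup or cap the strand is crossed back and forth,
and at a crossing `Strand.cross_mul_cross` applies, so the colors further to the right are
unaffected. -/
theorem sliceRule_mkLevel {σ : Slice k} {A B : List R} (x : X) (h : σ.ArcRule A B) :
    SliceRule σ (mkLevel x σ.bot A) (mkLevel x σ.top B) := by
  obtain ⟨u, e, v⟩ := σ
  obtain ⟨A, B, p, q, hA, hB, rfl, rfl, h⟩ := h
  simp only at hA hB
  have reg : ∀ (S : List (Strand k)) (p : List R), regions (u ++ S ++ v) (A ++ (p ++ B)) x =
      initRegions u A x ++ regions (S ++ v) (p ++ B) (lastRegion u A x) := by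
    intro S p
    rw [List.append_assoc, regions_append hA]
  have hreg : ∀ y : X, ∃ H, H.length = v.length ∧ regions v B y = y :: H := by
    intro y
    have h₁ := head?_regions v B y
    have h₂ : (regions v B y).length = v.length + 1 := by
      simp [regions, length_initRegions hB]
    cases hr : regions v B y with
    | nil => simp [hr] at h₂
    | cons z H =>
      rw [hr] at h₁ h₂
      simp only [List.head?_cons, Option.some.injEq] at h₁
      exact ⟨H, by simpa using h₂, by rw [h₁]⟩
  simp only [mkLevel, Slice.bot, Slice.top, reg]
  set g := lastRegion u A x
  cases e with
  | cup s =>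
    obtain ⟨r, rfl, rfl⟩ := h
    obtain ⟨H, hH, e⟩ := hreg g
    have e' : s.rev.cross X r (s.cross X r g) = g := by
      rw [Strand.cross_rev]; exact Equiv.symm_apply_apply _ _
    simp only [Elem.bot, Elem.top, List.nil_append, List.cons_append, regions_cons, e', e]
    exact SliceRule.cup s r _ _ hA hB (length_initRegions hA x) hH
  | cap s =>
    obtain ⟨r, rfl, rfl⟩ := h
    obtain ⟨H, hH, e⟩ := hreg g
    have e' : s.rev.cross X r (s.cross X r g) = g := by
      rw [Strand.cross_rev]; exact Equiv.symm_apply_apply _ _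
    simp only [Elem.bot, Elem.top, List.nil_append, List.cons_append, regions_cons, e', e]
    exact SliceRule.cap s r _ _ hA hB (length_initRegions hA x) hH
  | cross a b o =>
    obtain ⟨y, z, rfl, rfl⟩ := Elem.arcRule_cross.1 h
    obtain ⟨H, hH, e⟩ := hreg (b.cross X z (a.cross X y g))
    have e' : a.cross X (crossOut a b o y z).2 (b.cross X (crossOut a b o y z).1 g) =
        b.cross X z (a.cross X y g) :=
      congrArg (fun f : Equiv.Perm X => f g) (Strand.cross_mul_cross a b o y z)
    simp only [Elem.bot, Elem.top, List.nil_append, List.cons_append, regions_cons, e', e]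
    refine SliceRule.cross a b o _ _ _ _ _ _ _ _ hA hB (length_initRegions hA x) hH ?_
    rw [crossingRule_iff]
    cases o <;> simp [crossOut]

/-- The strands at the successive levels of a word. -/
def strandLevels (S : List (Strand k)) (w : List (Slice k)) : List (List (Strand k)) :=
  S :: w.map Slice.top

/-- The leftmost region keeps its color through every slice (`SliceRule.head?_eq`), so a single `x`
serves all levels. -/
theorem isColoring_iff {w : List (Slice k)} : ∀ {S T : List (Strand k)} {ls : List (Level R X)},
    IsPath S w T → (IsColoring S w ls ↔ ∃ (x : X) (A : List R) (c : List (List R)) (B : List R),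
      A.length = S.length ∧ IsChain (arcRules R w) A c B ∧
        ls = List.zipWith (mkLevel x) (strandLevels S w) (A :: c)) := by
  induction w with
  | nil =>
    intro S T ls hp
    rcases ls with _ | ⟨a, _ | ⟨b, ls⟩⟩
    · simp [IsColoring, strandLevels, mkLevel]
    · simp only [IsColoring, edgeRule_iff, strandLevels, arcRules, List.map_nil, isChain_nil_iff]
      constructor
      · rintro ⟨h, x, hx⟩
        exact ⟨x, a.arcs, [], a.arcs, h, ⟨rfl, rfl⟩, by simp [mkLevel, ← hx]⟩
      · rintro ⟨x, A, c, B, h, ⟨rfl, rfl⟩, he⟩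
        obtain rfl : a = mkLevel x S A := by simpa using he
        exact ⟨h, x, rfl⟩
    · simp [IsColoring, strandLevels]
  | cons σ w ih =>
    intro S T ls hp
    obtain ⟨rfl, hp⟩ := hp
    constructor
    · intro h
      rcases ls with _ | ⟨a, _ | ⟨b, ls⟩⟩ <;> simp only [IsColoring] at h
      obtain ⟨h₁, h₂, h₃⟩ := h
      obtain ⟨x, A, c, B, hA, hc, he⟩ := (ih hp).1 h₃
      obtain ⟨hl, y, hy⟩ := edgeRule_iff.1 h₁
      simp only [strandLevels, List.zipWith_cons_cons, List.cons.injEq] at he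
      obtain ⟨rfl, rfl⟩ := he
      obtain rfl : y = x := by
        have := h₂.head?_eq
        rw [hy, head?_regions, mkLevel, head?_regions] at this
        exact Option.some_injective _ this
      exact ⟨y, a.arcs, A :: c, B, hl, ⟨h₂.arcRule, hc⟩, by
        simp [strandLevels, mkLevel, ← hy]⟩
    · rintro ⟨x, A, c, B, hA, hc, rfl⟩
      obtain ⟨A', c, rfl, h₁, hc⟩ := isChain_cons_iff.1 hc
      refine ⟨edgeRule_iff.2 ⟨hA, x, rfl⟩, sliceRule_mkLevel x h₁, ?_⟩
      exact (ih hp).2 ⟨x, A', c, B, h₁.length_eq.2, hc, rfl⟩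

/-- Closed arc colorings of a word. -/
abbrev ArcColoring (R : Type*) [Rack R] (w : List (Slice k)) : Type _ :=
  {c : List (List R) // IsChain (arcRules R w) [] c []}

theorem map_arcs_zipWith_mkLevel {x : X} {S : List (List (Strand k))} : ∀ {c : List (List R)},
    S.length = c.length → (List.zipWith (mkLevel x) S c).map Level.arcs = c := by
  induction S with
  | nil => intro c h; simp [List.length_eq_zero_iff.1 h.symm]
  | cons s S ih =>
    intro c h
    rcases c with _ | ⟨A, c⟩
    · simp at h
    · simpa [mkLevel] using ih (c := c) (by simpa using h)

theorem zipWith_mkLevel_inj {x x' : X} {S : List (List (Strand k))} {c c' : List (List R)}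
    (hS : S ≠ []) (h : S.length = c.length) (h' : S.length = c'.length)
    (e : List.zipWith (mkLevel x) S c = List.zipWith (mkLevel x') S c') : x = x' ∧ c = c' := by
  refine ⟨?_, by rw [← map_arcs_zipWith_mkLevel (x := x) h, e, map_arcs_zipWith_mkLevel h']⟩
  rcases S with _ | ⟨s, S⟩
  · exact absurd rfl hS
  rcases c with _ | ⟨A, c⟩
  · simp at h
  rcases c' with _ | ⟨A', c'⟩
  · simp at h'
  simp only [List.zipWith_cons_cons, List.cons.injEq, mkLevel, Level.mk.injEq] at e
  have := congrArg List.head? e.1.2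
  rw [head?_regions, head?_regions] at this
  exact Option.some_injective _ this

/-- A shadow coloring is the same as the color of the leftmost region and the colors of the
arcs. -/
noncomputable def shadowColoringEquiv (R X : Type*) [Rack R] [RackShadow R X] (D : LinkDiagram k) :
    X × ArcColoring R D.word ≃ ShadowColoring R X D :=
  Equiv.ofBijective
    (fun p => ⟨List.zipWith (mkLevel p.1) (strandLevels [] D.word) ([] :: p.2.1),
      (isColoring_iff D.isPath).2 ⟨p.1, [], p.2.1, [], rfl, p.2.2, rfl⟩⟩) (by
    have hl : ∀ c : ArcColoring R D.word,
        (strandLevels [] D.word).length = (([] : List R) :: c.1).length := fun c => by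
      simp [strandLevels, c.2.length_eq, arcRules]
    constructor
    · rintro ⟨x, c⟩ ⟨x', c'⟩ h
      obtain ⟨rfl, h'⟩ := zipWith_mkLevel_inj (by simp [strandLevels]) (hl c) (hl c')
        (congrArg ShadowColoring.levels h)
      exact Prod.ext rfl (Subtype.ext (by simpa using h'))
    · rintro ⟨ls, h⟩
      obtain ⟨x, A, c, B, hA, hc, rfl⟩ := (isColoring_iff D.isPath).1 h
      obtain rfl := List.length_eq_zero_iff.1 hA
      have hB : B.length = 0 := hc.length_of_isPath D.isPath rfl
      obtain rfl := List.length_eq_zero_iff.1 hB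
      exact ⟨(x, ⟨c, hc⟩), rfl⟩)

theorem shadowColoringEquiv_levels (D : LinkDiagram k) (p : X × ArcColoring R D.word) :
    (shadowColoringEquiv R X D p).levels =
      List.zipWith (mkLevel p.1) (strandLevels [] D.word) ([] :: p.2.1) := rfl

end Regions

/-! ## The shadow image as an orbit -/

section ShadowImage

variable {R : Type*} [Rack R] (X : Type*) [RackShadow R X] {k : ℕ}

/-- The group of permutations of the shadow generated by the colors of the arcs. -/
def actGroup (c : List (List R)) : Subgroup (Equiv.Perm X) :=
  Subgroup.closure {g | ∃ A ∈ c, ∃ r ∈ A, RackShadow.act r = g}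

/-- Rack operations act on `X` by conjugates. This is why the subrack generated by the arc colors
yields no more permutations than the group generated by the arcs themselves. -/
theorem isSubrack_act_mem (H : Subgroup (Equiv.Perm X)) :
    IsSubrack {r : R | RackShadow.act r ∈ H} where
  act := by
    intro x y hx hy
    simp only [Set.mem_ofPred_eq, RackShadow.act_rack_act] at hx hy ⊢
    exact H.mul_mem (H.mul_mem hx hy) (H.inv_mem hx)
  invAct := by
    intro x y hx hy
    simp only [Set.mem_ofPred_eq, RackShadow.act_rack_invAct] at hx hy ⊢
    exact H.mul_mem (H.mul_mem (H.inv_mem hx) hy) hx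

theorem within_actGroup (c : List (List R)) :
    ∀ A ∈ c, Within {r : R | RackShadow.act r ∈ actGroup X c} A :=
  fun A hA r hr => Subgroup.subset_closure ⟨A, hA, r, hr, rfl⟩

/-- The hypothesis is applied to the subrack of those elements whose action lies in the group of the
other coloring. -/
theorem actGroup_eq_of_within {c c' : List (List R)}
    (h : ∀ K : Set R, IsSubrack K → ((∀ A ∈ c, Within K A) ↔ ∀ A ∈ c', Within K A)) :
    actGroup X c = actGroup X c' := by
  apply le_antisymm
  · rw [actGroup, Subgroup.closure_le]
    rintro _ ⟨A, hA, r, hr, rfl⟩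
    exact (h _ (isSubrack_act_mem X _)).2 (within_actGroup X c') A hA r hr
  · rw [actGroup, Subgroup.closure_le]
    rintro _ ⟨A, hA, r, hr, rfl⟩
    exact (h _ (isSubrack_act_mem X _)).1 (within_actGroup X c) A hA r hr

variable {X}

theorem exists_of_mem_regions {H : Subgroup (Equiv.Perm X)} {S : List (Strand k)} :
    ∀ {A : List R} {x y : X}, (∀ r ∈ A, RackShadow.act r ∈ H) → y ∈ regions S A x →
      ∃ g ∈ H, g x = y := by
  induction S with
  | nil =>
    intro A x y _ h
    obtain rfl : y = x := by simpa using h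
    exact ⟨1, H.one_mem, rfl⟩
  | cons s S ih =>
    intro A x y hA h
    rcases A with _ | ⟨r, A⟩
    · obtain rfl : y = x := by simpa [regions, initRegions, lastRegion] using h
      exact ⟨1, H.one_mem, rfl⟩
    · rw [regions_cons, List.mem_cons] at h
      rcases h with rfl | h
      · exact ⟨1, H.one_mem, rfl⟩
      · obtain ⟨g, hg, rfl⟩ := ih (fun r hr => hA r (List.mem_cons_of_mem _ hr)) h
        refine ⟨g * s.cross X r, H.mul_mem hg ?_, rfl⟩
        have := hA r (by simp)
        rcases s with ⟨c, _ | _⟩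
        · simpa [Strand.cross] using this
        · simpa [Strand.cross] using this

theorem exists_mkLevel_of_mem {x : X} {S : List (List (Strand k))} {c : List (List R)}
    {a : Level R X} (ha : a ∈ List.zipWith (mkLevel x) S c) :
    ∃ T : List (Strand k), ∃ A ∈ c, a = mkLevel x T A := by
  induction S generalizing c with
  | nil => simp at ha
  | cons T S ih =>
    rcases c with _ | ⟨A, c⟩
    · simp at ha
    · rw [List.zipWith_cons_cons, List.mem_cons] at ha
      rcases ha with rfl | ha
      · exact ⟨T, A, by simp, rfl⟩
      · obtain ⟨T, A, hA, rfl⟩ := ih ha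
        exact ⟨T, A, List.mem_cons_of_mem _ hA, rfl⟩

theorem exists_mem_zipWith_mkLevel {x : X} {S : List (List (Strand k))} {c : List (List R)}
    (h : S.length = c.length) {A : List R} (hA : A ∈ c) :
    ∃ T : List (Strand k), mkLevel x T A ∈ List.zipWith (mkLevel x) S c := by
  induction S generalizing c with
  | nil => simp [List.length_eq_zero_iff.1 h.symm] at hA
  | cons T S ih =>
    rcases c with _ | ⟨B, c⟩
    · simp at h
    · rcases List.mem_cons.1 hA with rfl | hA
      · exact ⟨T, by simp⟩
      · obtain ⟨T', hT⟩ := ih (by simpa using h) hA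
        exact ⟨T', by simp [hT]⟩

/-- Every region color arises from the leftmost one by actions of arc colors and their inverses, so
the image lies in the orbit. Conversely the shadow image is closed under the generators of the
group. -/
theorem shadowImage_shadowColoringEquiv [Finite X] (D : LinkDiagram k)
    (p : X × ArcColoring R D.word) :
    (shadowColoringEquiv R X D p).shadowImage = {y | ∃ g ∈ actGroup X p.2.1, g p.1 = y} := by
  obtain ⟨x, c⟩ := p
  have hl : (strandLevels [] D.word).length = (([] : List R) :: c.1).length := by
    simp [strandLevels, c.2.length_eq, arcRules]
  have hmem : ∀ {a : Level R X}, a ∈ (shadowColoringEquiv R X D (x, c)).levels →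
      ∃ (T : List (Strand k)) (A : List R), (∀ r ∈ A, RackShadow.act r ∈ actGroup X c.1) ∧ a = mkLevel x T A := by
    intro a ha
    rw [shadowColoringEquiv_levels] at ha
    obtain ⟨T, A, hA, rfl⟩ := exists_mkLevel_of_mem ha
    refine ⟨T, A, ?_, rfl⟩
    rcases List.mem_cons.1 hA with rfl | hA
    · simp
    · exact within_actGroup X c.1 A hA
  have himg : ∀ r, ImageSubrack (shadowColoringEquiv R X D (x, c)) r →
      RackShadow.act r ∈ actGroup X c.1 := by
    intro r hr
    induction hr with
    | arc ha hr =>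
      obtain ⟨T, A, hA, rfl⟩ := hmem ha
      exact hA _ hr
    | act _ _ ih ih' => exact (isSubrack_act_mem X (actGroup X c.1)).act (x := _) (y := _) ih' ih
    | invAct _ _ ih ih' => exact (isSubrack_act_mem X (actGroup X c.1)).invAct (x := _) (y := _) ih' ih
  apply Set.Subset.antisymm
  · intro y hy
    change MemShadowImage _ y at hy
    induction hy with
    | region ha hx =>
      obtain ⟨T, A, hA, rfl⟩ := hmem ha
      exact exists_of_mem_regions hA hx
    | act hr _ ih =>
      obtain ⟨g, hg, rfl⟩ := ih
      exact ⟨_ * g, Subgroup.mul_mem _ (himg _ hr) hg, rfl⟩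
  · rintro _ ⟨g, hg, rfl⟩
    have hx : MemShadowImage (shadowColoringEquiv R X D (x, c)) x := by
      refine MemShadowImage.region (a := mkLevel x ([] : List (Strand k)) []) ?_ (by simp [mkLevel])
      simp [shadowColoringEquiv_levels, strandLevels]
    have key : ∀ y, MemShadowImage (shadowColoringEquiv R X D (x, c)) y →
        MemShadowImage (shadowColoringEquiv R X D (x, c)) (g y) := by
      refine Subgroup.closure_induction (p := fun g _ => ∀ y,
        MemShadowImage (shadowColoringEquiv R X D (x, c)) y →
          MemShadowImage (shadowColoringEquiv R X D (x, c)) (g y)) ?_ ?_ ?_ ?_ hg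
      · rintro _ ⟨A, hA, r, hr, rfl⟩ y hy
        obtain ⟨T, hT⟩ := exists_mem_zipWith_mkLevel (x := x) hl (List.mem_cons_of_mem _ hA)
        exact MemShadowImage.act (ImageSubrack.arc (a := mkLevel x T A) hT hr) hy
      · exact fun y hy => hy
      · exact fun g h _ _ ih ih' y hy => ih _ (ih' y hy)
      · intro g _ ih y hy
        -- The shadow image is closed under actions by definition, but not under their inverses. As
        -- `X` is finite, an inverse is a power with natural exponent.
        obtain ⟨n, hn⟩ : g⁻¹ ∈ Submonoid.powers g :=
          mem_powers_iff_mem_zpowers.2 (Subgroup.inv_mem _ (Subgroup.mem_zpowers g))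
        have hpow : ∀ n : ℕ, MemShadowImage (shadowColoringEquiv R X D (x, c)) ((g ^ n) y) := by
          intro n
          induction n with
          | zero => exact hy
          | succ n ihn => rw [pow_succ']; exact ih _ ihn
        exact (show g ^ n = g⁻¹ from hn) ▸ hpow n
    exact key x hx

/-- Equivalent arc colorings give shadow colorings with the same shadow images. -/
theorem exists_equiv_of_chainEquiv (X : Type*) [RackShadow R X] [Finite X] {D D' : LinkDiagram k}
    (h : ChainEquiv (arcRules R D.word) (arcRules R D'.word)) :
    ∃ φ : ShadowColoring R X D ≃ ShadowColoring R X D',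
      ∀ f, (φ f).shadowImage = f.shadowImage := by
  obtain ⟨e, he⟩ := h
  refine ⟨((shadowColoringEquiv R X D).symm.trans ((Equiv.refl X).prodCongr e)).trans
    (shadowColoringEquiv R X D'), fun f => ?_⟩
  obtain ⟨p, rfl⟩ := (shadowColoringEquiv R X D).surjective f
  simp only [Equiv.trans_apply, Equiv.symm_apply_apply, shadowImage_shadowColoringEquiv,
    Equiv.prodCongr_apply, Prod.map, Equiv.refl_apply,
    actGroup_eq_of_within X fun K hK => he K hK p.2]

end ShadowImage

/-! ## Paths of slices -/

section Paths

variable {k : ℕ}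

theorem isPath_append_iff {w w' : List (Slice k)} : ∀ {S T : List (Strand k)},
    IsPath S (w ++ w') T ↔ ∃ U, IsPath S w U ∧ IsPath U w' T := by
  induction w with
  | nil => simp [IsPath]
  | cons σ w ih => simp [IsPath, ih, and_assoc]

theorem Slice.bot_whisker (u v : List (Strand k)) (σ : Slice k) :
    (σ.whisker u v).bot = u ++ σ.bot ++ v := by simp [Slice.bot, Slice.whisker]

theorem Slice.top_whisker (u v : List (Strand k)) (σ : Slice k) :
    (σ.whisker u v).top = u ++ σ.top ++ v := by simp [Slice.top, Slice.whisker]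

theorem IsPath.whisker {w : List (Slice k)} (u v : List (Strand k)) : ∀ {S T : List (Strand k)},
    IsPath S w T → IsPath (u ++ S ++ v) (w.map (Slice.whisker u v)) (u ++ T ++ v) := by
  induction w with
  | nil => rintro S T rfl; rfl
  | cons σ w ih =>
    rintro S T ⟨rfl, h⟩
    exact ⟨Slice.bot_whisker u v σ, by rw [Slice.top_whisker]; exact ih h⟩

/-- The word must be nonempty: an empty one would not force the levels to contain `u` and `v`. -/
theorem exists_of_isPath_whisker {w : List (Slice k)} {u v : List (Strand k)} (hw : w ≠ []) :
    ∀ {S T : List (Strand k)}, IsPath S (w.map (Slice.whisker u v)) T →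
      ∃ S₀ T₀, S = u ++ S₀ ++ v ∧ T = u ++ T₀ ++ v ∧ IsPath S₀ w T₀ := by
  induction w with
  | nil => exact absurd rfl hw
  | cons σ w ih =>
    rintro S T ⟨rfl, h⟩
    rw [Slice.top_whisker] at h
    rcases eq_or_ne w [] with rfl | hw
    · exact ⟨σ.bot, σ.top, Slice.bot_whisker u v σ, h.symm, rfl, rfl⟩
    · obtain ⟨S₀, T₀, hS, rfl, h₀⟩ := ih hw h
      obtain rfl : σ.top = S₀ := by simpa using hS
      exact ⟨σ.bot, T₀, Slice.bot_whisker u v σ, rfl, rfl, h₀⟩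

/-- In this form, agreement of the lists of strands outside a move also follows from
`agreeLists_of_isChain`. -/
theorem isPath_iff_isChain {w : List (Slice k)} : ∀ {S T : List (Strand k)},
    IsPath S w T ↔ IsChain (w.map fun σ S T => σ.bot = S ∧ σ.top = T) S (w.map Slice.top) T := by
  induction w with
  | nil => simp [IsPath, IsChain]
  | cons σ w ih => simp [IsPath, IsChain, ih]

theorem FramedMove.ne_nil {L M : List (Slice k)} (h : FramedMove L M) : L ≠ [] := by
  cases h <;> simp [kinkRight]

end Paths

/-! ## Framed moves -/

section FramedMoves

theorem AgreeLists.map {α β : Type*} {m n n' : ℕ} {c c' : List α} (h : AgreeLists m n n' c c')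
    (f : α → β) : AgreeLists m n n' (c.map f) (c'.map f) := by
  simp only [AgreeLists, ← List.map_take, ← List.map_drop, h.1, h.2, and_self]

theorem AgreeLists.zipWith {α β γ : Type*} {m n n' : ℕ} {c c' : List α} {d d' : List β}
    (h : AgreeLists m n n' c c') (h' : AgreeLists m n n' d d') (f : α → β → γ) :
    AgreeLists m n n' (List.zipWith f c d) (List.zipWith f c' d') := by
  simp only [AgreeLists, List.take_zipWith, List.drop_zipWith, h.1, h.2, h'.1, h'.2, and_self]

variable {R X : Type*} [Rack R] [RackShadow R X] {k : ℕ}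

theorem agreeOutside_iff {D D' : LinkDiagram k} {m n n' : ℕ}
    (hS : AgreeLists m n n' (strandLevels [] D.word) (strandLevels [] D'.word))
    (p : X × ArcColoring R D.word) (p' : X × ArcColoring R D'.word) :
    AgreeOutside m n n' (shadowColoringEquiv R X D p) (shadowColoringEquiv R X D' p') ↔
      p.1 = p'.1 ∧ AgreeLists m n n' ([] :: p.2.1) ([] :: p'.2.1) := by
  have hl : ∀ (D : LinkDiagram k) (c : ArcColoring R D.word),
      (strandLevels [] D.word).length = (([] : List R) :: c.1).length := fun D c => by
    simp [strandLevels, c.2.length_eq, arcRules]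
  constructor
  · intro h
    have h' : AgreeLists m n n' (shadowColoringEquiv R X D p).levels
      (shadowColoringEquiv R X D' p').levels := h
    constructor
    · have := congrArg List.head? h.1
      simpa [shadowColoringEquiv_levels, strandLevels, mkLevel] using this
    · have := h'.map Level.arcs
      rwa [shadowColoringEquiv_levels, shadowColoringEquiv_levels,
        map_arcs_zipWith_mkLevel (hl D p.2), map_arcs_zipWith_mkLevel (hl D' p'.2)] at this
  · rintro ⟨hx, h⟩
    have := hS.zipWith h (mkLevel p.1)
    rw [AgreeOutside, shadowColoringEquiv_levels, shadowColoringEquiv_levels, ← hx]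
    exact this

/-- The levels of the boundary of the part of a diagram that is replaced by a move. -/
theorem exists_of_isReplacement {D D' : LinkDiagram k} {pre post L M : List (Slice k)}
    {u v : List (Strand k)} (hL : L ≠ []) (h : IsReplacement D D' pre post u v L M) :
    ∃ S T, IsPath [] pre (u ++ S ++ v) ∧ IsPath S L T ∧ IsPath (u ++ T ++ v) post [] := by
  have hp := D.isPath
  rw [h.before] at hp
  obtain ⟨T', hp, hp₃⟩ := isPath_append_iff.1 hp
  obtain ⟨S', hp₁, hp₂⟩ := isPath_append_iff.1 hp
  obtain ⟨S, T, rfl, rfl, hST⟩ := exists_of_isPath_whisker hL hp₂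
  exact ⟨S, T, hp₁, hST, hp₃⟩

theorem arcRules_append (w w' : List (Slice k)) :
    arcRules R (w ++ w') = arcRules R w ++ arcRules R w' := by simp [arcRules]

theorem length_arcRules (w : List (Slice k)) : (arcRules R w).length = w.length := by
  simp [arcRules]

theorem framedMove_bijection [Finite X] {D D' : LinkDiagram k} {pre post L M : List (Slice k)}
    {u v : List (Strand k)} (hm : FramedMove L M) (h : IsReplacement D D' pre post u v L M) :
    ∃ φ : ShadowColoring R X D ≃ ShadowColoring R X D',
      (∀ f f', φ f = f' ↔ AgreeOutside pre.length L.length M.length f f') ∧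
      ∀ f, (φ f).shadowImage = f.shadowImage := by
  obtain ⟨S, T, h₁, h₂, h₃⟩ := exists_of_isReplacement hm.ne_nil h
  obtain ⟨h₂', hs⟩ := hm.swap (R := R) h₂
  have hn : ∀ c x, IsChain (arcRules R pre) [] c x → x.length = u.length + (S.length + v.length) :=
    fun c x hc => by simpa using hc.length_of_isPath h₁ rfl
  have hS : AgreeLists pre.length L.length M.length
      (strandLevels [] D.word) (strandLevels [] D'.word) := by
    have := (agreeLists_of_isChain (c₃ := post.map Slice.top) (c₃' := post.map Slice.top)
      (isPath_iff_isChain.1 h₁) (isPath_iff_isChain.1 (h₂.whisker u v)) (isPath_iff_isChain.1 h₁)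
      (isPath_iff_isChain.1 (h₂'.whisker u v))).2 ⟨rfl, rfl, rfl⟩
    simpa [strandLevels, h.before, h.after] using this
  obtain ⟨e, he, hK⟩ := (hs.whisker u v).exists_equiv (post := arcRules R post)
    (N := arcRules R D.word) (N' := arcRules R D'.word) hn (by simp [h.before, arcRules_append])
    (by simp [h.after, arcRules_append])
  simp only [length_arcRules, List.length_map] at he
  refine ⟨((shadowColoringEquiv R X D).symm.trans ((Equiv.refl X).prodCongr e)).trans
    (shadowColoringEquiv R X D'), fun f f' => ?_, fun f => ?_⟩
  · obtain ⟨p, rfl⟩ := (shadowColoringEquiv R X D).surjective f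
    obtain ⟨p', rfl⟩ := (shadowColoringEquiv R X D').surjective f'
    rw [agreeOutside_iff hS, ← he]
    simp [Prod.ext_iff]
  · obtain ⟨p, rfl⟩ := (shadowColoringEquiv R X D).surjective f
    simp only [Equiv.trans_apply, Equiv.symm_apply_apply, shadowImage_shadowColoringEquiv,
      Equiv.prodCongr_apply, Prod.map, Equiv.refl_apply,
      actGroup_eq_of_within X fun K hK' => hK K hK' p.2]

end FramedMoves

/-! ## Twisted colorings -/

section Twist

variable {R : Type*} [Rack R] {k : ℕ}

/-- Apply the power `f j` of the diagonal permutation to the `j`-th color. -/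
def twist (f : ℕ → ℤ) (A : List R) : List R := A.mapIdx fun j r => ((diagPerm R) ^ f j) r

@[simp] theorem twist_nil (f : ℕ → ℤ) : twist f ([] : List R) = [] := rfl

@[simp] theorem length_twist (f : ℕ → ℤ) (A : List R) : (twist f A).length = A.length := by
  simp [twist]

theorem twist_cons (f : ℕ → ℤ) (r : R) (A : List R) :
    twist f (r :: A) = ((diagPerm R) ^ f 0) r :: twist (fun j => f (j + 1)) A := by
  simp [twist, List.mapIdx_cons]

theorem twist_append (f : ℕ → ℤ) (A B : List R) :
    twist f (A ++ B) = twist f A ++ twist (fun j => f (j + A.length)) B := by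
  simp [twist, List.mapIdx_append]

theorem twist_congr {f g : ℕ → ℤ} {A : List R} (h : ∀ j < A.length, f j = g j) :
    twist f A = twist g A := by
  apply List.ext_getElem (by simp)
  intro j hj _
  simp only [length_twist] at hj
  simp [twist, h j hj]

theorem twist_zero (A : List R) : twist (fun _ => 0) A = A := by
  apply List.ext_getElem (by simp)
  intro j hj _
  simp [twist]

theorem twist_twist (f g : ℕ → ℤ) (A : List R) :
    twist f (twist g A) = twist (fun j => f j + g j) A := by
  apply List.ext_getElem (by simp)
  intro j hj _
  simp [twist, zpow_add]

theorem IsSubrack.within_twist {K : Set R} (hK : IsSubrack K) (f : ℕ → ℤ) {A : List R}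
    (h : Within K A) : Within K (twist f A) := by
  intro r hr
  obtain ⟨j, hj, rfl⟩ := List.mem_iff_getElem.1 hr
  simp only [twist, List.getElem_mapIdx]
  exact hK.diagPerm_zpow_mem _ (h _ (List.getElem_mem _))

/-- Twisting the colors of a crossing along both strands. -/
theorem crossOut_twist (a b : Strand k) (o : Bool) (n m : ℤ) (x y : R) :
    crossOut a b o (((diagPerm R) ^ n) x) (((diagPerm R) ^ m) y) =
      (((diagPerm R) ^ m) (crossOut a b o x y).1, ((diagPerm R) ^ n) (crossOut a b o x y).2) := by
  cases o <;> simp [crossOut, Strand.act_diagPerm_zpow, Strand.act_apply_diagPerm_zpow]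

/-- The twist `γ` is constant along each piece of strand inside the slice. Vertical strands, minima
and maxima respect it trivially, and crossings by `crossOut_twist`. -/
theorem Slice.ArcRule.twist {σ : Slice k} {A B : List R} (h : σ.ArcRule A B) {γ : ℕ ⊕ ℕ → ℤ}
    (hγ : ∀ p q, σ.Joins p q → γ p = γ q) :
    σ.ArcRule (ShadowLink.twist (fun j => γ (.inl j)) A)
      (ShadowLink.twist (fun j => γ (.inr j)) B) := by
  obtain ⟨u, e, v⟩ := σ
  obtain ⟨A, B, p, q, hA, hB, rfl, rfl, h⟩ := h
  simp only at hA hB h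
  have hl := h.length_eq
  refine ⟨_, ShadowLink.twist (fun j => γ (.inl (j + p.length + A.length))) B, _,
    ShadowLink.twist (fun j => γ (.inr (j + A.length))) q, ?_, ?_,
    by rw [twist_append, twist_append], ?_, ?_⟩
  rotate_left 2
  · rw [twist_append, twist_append]
    congr 1
    · exact twist_congr fun j hj => (hγ _ _ (Slice.Joins.left j (hA ▸ hj))).symm
    congr 1
    refine twist_congr fun j hj => ?_
    have := hγ _ _ (Slice.Joins.right j (hB ▸ hj))
    simp only [← hl.1, ← hl.2, ← hA] at this
    rw [show j + p.length + A.length = A.length + p.length + j by omega, this]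
    congr 2
    omega
  · simp only
    have he : ∀ p q, e.Joins p q → γ (Sum.map (A.length + ·) (A.length + ·) p) =
        γ (Sum.map (A.length + ·) (A.length + ·) q) := by
      intro p q hpq
      rw [hA]
      exact hγ _ _ (Slice.Joins.elem hpq)
    cases e with
    | cup s =>
      obtain ⟨r, rfl, rfl⟩ := h
      have := he _ _ (Elem.Joins.cup s)
      simp only [Sum.map_inr, Nat.add_zero] at this
      exact ⟨_, rfl, by simp [twist_cons, this, Nat.add_comm]; rfl⟩
    | cap s =>
      obtain ⟨r, rfl, rfl⟩ := h
      have := he _ _ (Elem.Joins.cap s)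
      simp only [Sum.map_inl, Nat.add_zero] at this
      exact ⟨_, by simp [twist_cons, this, Nat.add_comm]; rfl, rfl⟩
    | cross a b o =>
      obtain ⟨x, y, rfl, rfl⟩ := Elem.arcRule_cross.1 h
      have h₁ := he _ _ (Elem.Joins.cross_left a b o)
      have h₂ := he _ _ (Elem.Joins.cross_right a b o)
      simp only [Sum.map_inl, Sum.map_inr, Nat.add_zero] at h₁ h₂
      refine Elem.arcRule_cross.2 ⟨_, _, by simp only [twist_cons, twist_nil]; rfl, ?_⟩
      simp only [crossOut_twist]
      simp [twist_cons, ← h₁, h₂, Nat.add_comm]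
  · simpa using hA
  · simpa using hB

/-- The conditions on the colors of the arcs below and above a slice, when at each end point `e` of
the slice the color is changed by the power `f e` of the diagonal permutation. -/
def Slice.TwistRule (σ : Slice k) (f : ℕ ⊕ ℕ → ℤ) (A B : List R) : Prop :=
  σ.ArcRule (twist (fun j => f (.inl j)) A) (twist (fun j => f (.inr j)) B)

theorem Slice.TwistRule.length_eq {σ : Slice k} {f : ℕ ⊕ ℕ → ℤ} {A B : List R}
    (h : σ.TwistRule f A B) : A.length = σ.bot.length ∧ B.length = σ.top.length := by
  simpa using Slice.ArcRule.length_eq h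

theorem Slice.twistRule_zero (σ : Slice k) : σ.TwistRule (R := R) (fun _ => 0) = σ.ArcRule := by
  funext A B
  simp [Slice.TwistRule, twist_zero]

theorem Slice.TwistRule.add {σ : Slice k} {f : ℕ ⊕ ℕ → ℤ} {A B : List R} (h : σ.TwistRule f A B)
    {γ : ℕ ⊕ ℕ → ℤ} (hγ : ∀ p q, σ.Joins p q → γ p = γ q) :
    σ.TwistRule (fun e => γ e + f e) A B := by
  have := Slice.ArcRule.twist h hγ
  rwa [twist_twist, twist_twist] at this

theorem Slice.twistRule_add {σ : Slice k} {f γ : ℕ ⊕ ℕ → ℤ}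
    (hγ : ∀ p q, σ.Joins p q → γ p = γ q) :
    σ.TwistRule (R := R) (fun e => f e + γ e) = σ.TwistRule f := by
  funext A B
  refine propext ⟨fun h => ?_, fun h => ?_⟩
  · have := h.add (γ := fun e => - γ e) fun p q hpq => congrArg Neg.neg (hγ p q hpq)
    simpa using this
  · simpa [add_comm] using h.add hγ

theorem Slice.twistRule_congr {σ : Slice k} {f g : ℕ ⊕ ℕ → ℤ}
    (h : ∀ j < σ.bot.length, f (.inl j) = g (.inl j))
    (h' : ∀ j < σ.top.length, f (.inr j) = g (.inr j)) :
    σ.TwistRule (R := R) f = σ.TwistRule g := by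
  have key : ∀ {f g : ℕ ⊕ ℕ → ℤ}, (∀ j < σ.bot.length, f (.inl j) = g (.inl j)) →
      (∀ j < σ.top.length, f (.inr j) = g (.inr j)) → ∀ A B : List R,
      σ.TwistRule f A B → σ.TwistRule g A B := by
    intro f g h h' A B hA
    have hl := hA.length_eq
    rw [Slice.TwistRule, ← twist_congr fun j hj => h j (hl.1 ▸ hj),
      ← twist_congr fun j hj => h' j (hl.2 ▸ hj)]
    exact hA
  funext A B
  exact propext ⟨key h h' A B, key (fun j hj => (h j hj).symm) (fun j hj => (h' j hj).symm) A B⟩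

/-- The conditions on the colors of the arcs of a word, twisted by `t i` at slice `i`. -/
def twistRules (R : Type*) [Rack R] (w : List (Slice k)) (t : ℕ → ℕ ⊕ ℕ → ℤ) :
    List (List R → List R → Prop) :=
  w.mapIdx fun i σ => σ.TwistRule (t i)

theorem twistRules_cons (σ : Slice k) (w : List (Slice k)) (t : ℕ → ℕ ⊕ ℕ → ℤ) :
    twistRules R (σ :: w) t = σ.TwistRule (t 0) :: twistRules R w fun i => t (i + 1) := by
  simp [twistRules, List.mapIdx_cons]

theorem twistRules_append (w w' : List (Slice k)) (t : ℕ → ℕ ⊕ ℕ → ℤ) :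
    twistRules R (w ++ w') t = twistRules R w t ++ twistRules R w' fun i => t (i + w.length) := by
  simp [twistRules, List.mapIdx_append]

theorem twistRules_congr {w : List (Slice k)} {t t' : ℕ → ℕ ⊕ ℕ → ℤ}
    (h : ∀ i (σ : Slice k), w[i]? = some σ → σ.TwistRule (R := R) (t i) = σ.TwistRule (t' i)) :
    twistRules R w t = twistRules R w t' := by
  apply List.ext_getElem (by simp [twistRules])
  intro i hi _
  simp only [twistRules, List.length_mapIdx] at hi
  simp only [twistRules, List.getElem_mapIdx]
  exact h i _ (List.getElem?_eq_getElem hi)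

theorem twistRules_zero (w : List (Slice k)) :
    twistRules R w (fun _ _ => 0) = arcRules R w := by
  apply List.ext_getElem (by simp [twistRules, arcRules])
  intro i hi _
  simp [twistRules, arcRules, Slice.twistRule_zero]

/-- A change of the colors at all levels by powers of the diagonal permutation. -/
theorem IsChain.gauge {w : List (Slice k)} : ∀ {t t' : ℕ → ℕ ⊕ ℕ → ℤ} {g : ℕ → ℕ → ℤ}
    {a b : List R} {c : List (List R)}, IsChain (twistRules R w t) a c b →
    (∀ i j, t' i (.inl j) = t i (.inl j) + g i j) →
    (∀ i j, t' i (.inr j) = t i (.inr j) + g (i + 1) j) →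
    IsChain (twistRules R w t') (twist (fun j => -g 0 j) a)
      (c.mapIdx fun i => twist fun j => -g (i + 1) j) (twist (fun j => -g w.length j) b) := by
  induction w with
  | nil =>
    intro t t' g a b c h _ _
    obtain ⟨rfl, rfl⟩ := isChain_nil_iff.1 h
    exact isChain_nil_iff.2 ⟨rfl, rfl⟩
  | cons σ w ih =>
    intro t t' g a b c h h₁ h₂
    rw [twistRules_cons] at h
    obtain ⟨x, c, rfl, hx, h⟩ := isChain_cons_iff.1 h
    rw [twistRules_cons, List.mapIdx_cons]
    refine ⟨?_, ih (g := fun i j => g (i + 1) j) h (fun i j => h₁ _ _) (fun i j => h₂ _ _)⟩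
    rw [Slice.TwistRule, twist_twist, twist_twist]
    simpa [h₁, h₂, Slice.TwistRule] using hx

/-- Recoloring point `j` of level `i` by the power `-g i j` absorbs the change of the twists on both
sides of that level. Subracks are stable under the diagonal permutation, so containment is
respected. -/
theorem chainEquiv_gauge {w : List (Slice k)} {t t' : ℕ → ℕ ⊕ ℕ → ℤ} {g : ℕ → ℕ → ℤ}
    (h₁ : ∀ i j, t' i (.inl j) = t i (.inl j) + g i j)
    (h₂ : ∀ i j, t' i (.inr j) = t i (.inr j) + g (i + 1) j) :
    ChainEquiv (twistRules R w t) (twistRules R w t') := by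
  have hinv : ∀ (f : ℕ → ℕ → ℤ) (c : List (List R)),
      (c.mapIdx fun i => twist (f i)).mapIdx (fun i => twist fun j => -f i j) = c := by
    intro f c
    apply List.ext_getElem (by simp)
    intro i hi _
    simp [twist_twist, twist_zero]
  have hw : ∀ (f : ℕ → ℕ → ℤ) {K : Set R} {c : List (List R)}, IsSubrack K →
      (∀ A ∈ c, Within K A) → ∀ A ∈ c.mapIdx fun i => twist (f i), Within K A := by
    intro f K c hK h A hA
    obtain ⟨i, hi, rfl⟩ := List.mem_iff_getElem.1 hA
    simp only [List.getElem_mapIdx]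
    exact hK.within_twist _ (h _ (List.getElem_mem _))
  -- The list omits the empty level `0`, so its entry `i` is the level `i + 1`.
  refine ⟨⟨fun c => ⟨c.1.mapIdx fun i => twist fun j => -g (i + 1) j, by
      simpa using c.2.gauge h₁ h₂⟩, fun c => ⟨c.1.mapIdx fun i => twist fun j => g (i + 1) j, by
      simpa using c.2.gauge (t' := t) (g := fun i j => -g i j) (by simp [h₁]) (by simp [h₂])⟩,
      fun c => ?_, fun c => ?_⟩, fun K hK c => ⟨hw _ hK, fun h => ?_⟩⟩
  · refine Subtype.ext ?_
    simpa using hinv (fun i j => -g (i + 1) j) c.1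
  · exact Subtype.ext (hinv (fun i j => g (i + 1) j) c.1)
  · have := hw (fun i j => g (i + 1) j) hK h
    have h' := hinv (fun i j => -g (i + 1) j) c.1
    simp only [neg_neg] at h'
    rwa [Equiv.coe_fn_mk, h'] at this

end Twist

/-! ## Twists that do not change the colorings -/

section TrivialTwists

variable {k : ℕ}

/-- Two pieces of a slice are equal or have no end point in common. -/
theorem Slice.Joins.eq_iff {σ : Slice k} {p q p' q' : ℕ ⊕ ℕ} (h : σ.Joins p q)
    (h' : σ.Joins p' q') : p' = p ∨ p' = q ↔ q' = p ∨ q' = q := by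
  obtain ⟨u, e, v⟩ := σ
  rcases h with ⟨j, hj⟩ | ⟨h⟩ | ⟨j, hj⟩ <;> rcases h' with ⟨j', hj'⟩ | ⟨h'⟩ | ⟨j', hj'⟩ <;>
    (try cases h) <;> (try cases h') <;>
    simp_all only [Sum.map_inl, Sum.map_inr, Sum.inl.injEq, Sum.inr.injEq, reduceCtorEq, false_or,
      or_false, or_self, or_true, true_or, iff_false, false_iff, Elem.bot, Elem.top, List.length_cons, List.length_nil] <;> try omega

/-- The sign of the `j`-th strand of a level; `0` if there is none. -/
def signAt (S : List (Strand k)) (j : ℕ) : ℤ := (S[j]?).elim 0 Strand.sign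

/-- The sign of an end point of a slice: positive if the strand enters the slice. -/
def Slice.endSign (σ : Slice k) : ℕ ⊕ ℕ → ℤ
  | .inl j => signAt σ.bot j
  | .inr j => -signAt σ.top j

theorem signAt_append_left {S T : List (Strand k)} {j : ℕ} (h : j < S.length) :
    signAt (S ++ T) j = signAt S j := by simp [signAt, List.getElem?_append_left h]

theorem signAt_append_right (S T : List (Strand k)) (j : ℕ) :
    signAt (S ++ T) (S.length + j) = signAt T j := by
  simp [signAt, List.getElem?_append_right]

/-- A piece of strand enters the slice at one end and leaves it at the other. -/
theorem Slice.Joins.endSign_eq {σ : Slice k} {p q : ℕ ⊕ ℕ} (h : σ.Joins p q) :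
    σ.endSign q = -σ.endSign p := by
  obtain ⟨u, e, v⟩ := σ
  rcases h with ⟨j, hj⟩ | ⟨h⟩ | ⟨j, hj⟩
  · simp only [Slice.endSign, Slice.bot, Slice.top, List.append_assoc, signAt_append_left hj]
  · cases h <;> simp only [Slice.endSign, Slice.bot, Slice.top, List.append_assoc, Sum.map_inl,
      Sum.map_inr, signAt_append_right] <;>
      simp [signAt, Elem.bot, Elem.top, Strand.sign_rev]
  · simp only [Slice.endSign, Slice.bot, Slice.top, ← List.length_append, signAt_append_right]

variable (R : Type*) [Rack R]

/-- The twists, of finite support, at the end points of the slices of a word. -/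
abbrev Twist : Type := ℕ × (ℕ ⊕ ℕ) →₀ ℤ

/-- The twist at every slice. -/
def Twist.at (t : Twist) (i : ℕ) (e : ℕ ⊕ ℕ) : ℤ := t (i, e)

/-- The twists that can be added without changing the colorings. -/
def trivialTwists (w : List (Slice k)) : AddSubgroup Twist where
  carrier := {g | ∀ t : Twist, ChainEquiv (twistRules R w t.at) (twistRules R w (t + g).at)}
  zero_mem' t := by rw [add_zero]; exact ChainEquiv.refl _
  add_mem' {g h} hg hh t := by rw [← add_assoc]; exact (hg t).trans (hh (t + g))
  neg_mem' {g} hg t := by simpa using (hg (t + -g)).symm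

variable {R}

theorem mem_trivialTwists_of_rule_eq {w : List (Slice k)} {g : Twist}
    (h : ∀ (t : Twist) i (σ : Slice k), w[i]? = some σ →
      σ.TwistRule (R := R) ((t + g).at i) = σ.TwistRule (t.at i)) : g ∈ trivialTwists R w := by
  intro t
  rw [twistRules_congr fun i σ hi => h t i σ hi]
  exact ChainEquiv.refl _

theorem Twist.add_at (t g : Twist) (i : ℕ) : (t + g).at i = fun e => t.at i e + g.at i e := rfl

/-- Equal twists at both ends of a piece of strand cancel, whatever the piece does inside the slice.
-/
theorem single_add_single_mem_of_joins {w : List (Slice k)} {i : ℕ} {σ : Slice k}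
    (hi : w[i]? = some σ) {p q : ℕ ⊕ ℕ} (h : σ.Joins p q) (n : ℤ) :
    Finsupp.single (i, p) n + Finsupp.single (i, q) n ∈ trivialTwists R w := by
  refine mem_trivialTwists_of_rule_eq fun t i' σ' hi' => ?_
  rw [Twist.add_at]
  refine Slice.twistRule_add fun p' q' h' => ?_
  have hpq : p ≠ q := by
    obtain ⟨u, e, v⟩ := σ
    rcases h with ⟨j, hj⟩ | ⟨h⟩ | ⟨j, hj⟩
    · simp
    · cases h <;> simp
    · simp
  by_cases hii : i' = i
  · subst hii
    obtain rfl : σ = σ' := by simpa [hi] using hi'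
    have := h.eq_iff h'
    have key : ∀ r : ℕ ⊕ ℕ, Twist.at (Finsupp.single (i', p) n + Finsupp.single (i', q) n) i' r =
        if r = p ∨ r = q then n else 0 := by
      intro r
      simp only [Twist.at, Finsupp.add_apply, Finsupp.single_apply, Prod.mk.injEq, true_and]
      by_cases h₁ : r = p
      · subst h₁; simp [hpq.symm]
      · by_cases h₂ : r = q
        · subst h₂; simp [hpq]
        · simp [h₁, h₂, Ne.symm h₁, Ne.symm h₂]
    simp only [key, this]
  · simp [Twist.at, Ne.symm hii]

/-- The two end points are the same point of the diagram, seen from the slice below and from the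
slice above; recoloring that point alone absorbs both twists. -/
theorem single_add_single_mem_of_level (w : List (Slice k)) (i j : ℕ) (n : ℤ) :
    Finsupp.single (i, Sum.inr j) n + Finsupp.single (i + 1, Sum.inl j) n ∈ trivialTwists R w := by
  intro t
  refine chainEquiv_gauge (g := fun l m => if l = i + 1 ∧ m = j then n else 0) ?_ ?_
  · intro l m
    simp [Twist.at, Finsupp.single_apply, eq_comm]
  · intro l m
    simp [Twist.at, Finsupp.single_apply, eq_comm]

theorem smul_rackRank_mem (w : List (Slice k)) (t : Twist) (n : ℤ) (hn : (rackRank R : ℤ) ∣ n) :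
    n • t ∈ trivialTwists R w := by
  refine mem_trivialTwists_of_rule_eq fun t' i σ _ => ?_
  have key : ∀ (f g : ℕ → ℤ) (A : List R), twist (fun j => f j + n * g j) A = twist f A := by
    intro f g A
    apply List.ext_getElem (by simp)
    intro j hj _
    have : (diagPerm R) ^ (n * g j) = 1 := by
      obtain ⟨m, rfl⟩ := hn
      rw [mul_assoc, zpow_mul, zpow_natCast]
      have : diagPerm R ^ rackRank R = 1 := pow_orderOf_eq_one _
      rw [this, one_zpow]
    simp [twist, zpow_add, this]
  funext A B
  simp only [Slice.TwistRule, Twist.at, Finsupp.add_apply, Finsupp.smul_apply, smul_eq_mul]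
  rw [key (fun j => t' (i, Sum.inl j)) (fun j => t (i, Sum.inl j)),
    key (fun j => t' (i, Sum.inr j)) (fun j => t (i, Sum.inr j))]

/-- The strands at the bottom of slice `i`; there are none if there is no such slice. -/
def botAt (w : List (Slice k)) (i : ℕ) : List (Strand k) := (w[i]?).elim [] Slice.bot

/-- The sign of an end point of a slice of a word. -/
def endSign (w : List (Slice k)) (p : ℕ × (ℕ ⊕ ℕ)) : ℤ := (w[p.1]?).elim 0 fun σ => σ.endSign p.2

/-- The sign of a strand is `1` or `-1`, so the value `0` occurs only where there is no strand, and
such a twist touches no color. -/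
theorem single_mem_of_endSign_eq_zero {w : List (Slice k)} {p : ℕ × (ℕ ⊕ ℕ)}
    (h : endSign w p = 0) (n : ℤ) : Finsupp.single p n ∈ trivialTwists R w := by
  have hs : ∀ {S : List (Strand k)} {j : ℕ}, signAt S j = 0 → S.length ≤ j := by
    intro S j h
    by_contra! hj
    rw [signAt, List.getElem?_eq_getElem hj] at h
    have := (S[j]).sign_mul_self
    simp only [Option.elim_some] at h
    rw [h] at this
    simp at this
  refine mem_trivialTwists_of_rule_eq fun t i σ hi => ?_
  obtain ⟨i', e⟩ := p
  by_cases hii : i = i'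
  · subst hii
    simp only [endSign, hi, Option.elim_some] at h
    rcases e with j | j
    · have := hs (S := σ.bot) h
      apply Slice.twistRule_congr <;> intro m hm <;>
        simp only [Twist.at, Finsupp.add_apply, Finsupp.single_apply, Prod.mk.injEq, true_and,
          Sum.inl.injEq, reduceCtorEq, if_false, add_zero]
      rw [if_neg (by omega), add_zero]
    · have := hs (S := σ.top) (neg_eq_zero.1 h)
      apply Slice.twistRule_congr <;> intro m hm <;>
        simp only [Twist.at, Finsupp.add_apply, Finsupp.single_apply, Prod.mk.injEq, true_and,
          Sum.inr.injEq, reduceCtorEq, if_false, add_zero]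
      rw [if_neg (by omega), add_zero]
  · congr 1
    funext e'
    simp [Twist.at, Ne.symm hii]

theorem IsPath.botAt_succ {w : List (Slice k)} : ∀ {S : List (Strand k)}, IsPath S w [] →
    ∀ {i : ℕ} {σ : Slice k}, w[i]? = some σ → botAt w (i + 1) = σ.top := by
  induction w with
  | nil => simp
  | cons τ w ih =>
    intro S h i σ hi
    rcases i with _ | i
    · obtain rfl : τ = σ := by simpa using hi
      rcases w with _ | ⟨τ', w⟩
      -- There is no further slice, and the default value `[]` of `botAt` is the actual last level
      -- because the path is closed.
      · have : τ.top = [] := h.2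
        simp [botAt, this]
      · simpa [botAt] using h.2.1
    · simpa [botAt] using ih h.2 (by simpa using hi)

theorem getElem?_strandLevels {w : List (Slice k)} (h : IsPath [] w []) {l : ℕ}
    (hl : l ≤ w.length) : ([] :: w.map Slice.top)[l]? = some (botAt w l) := by
  rcases l with _ | i
  · rcases w with _ | ⟨σ, w⟩
    · simp [botAt]
    · simpa [botAt] using h.1.symm
  · have hi : w[i]? = some w[i] := List.getElem?_eq_getElem (by omega)
    simp [h.botAt_succ hi, hi]

theorem hasStrand_iff {w : List (Slice k)} (h : IsPath [] w []) {P : ℕ × ℕ} {s : Strand k} :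
    HasStrand w P s ↔ (botAt w P.1)[P.2]? = some s := by
  rcases le_or_gt P.1 w.length with hl | hl
  · simp [HasStrand, getElem?_strandLevels h hl]
  · have h₁ : w[P.1]? = none := List.getElem?_eq_none (by omega)
    have h₂ : ([] :: w.map Slice.top)[P.1]? = none := List.getElem?_eq_none (by simp; omega)
    simp [HasStrand, h₂, botAt, h₁]

/-- The twist by a positive unit at a point of a diagram. -/
noncomputable def pointTwist (w : List (Slice k)) (P : ℕ × ℕ) : Twist :=
  Finsupp.single (P.1, Sum.inl P.2) (signAt (botAt w P.1) P.2)

/-- Weighting by the sign makes a twist independent of the slice from which the point is seen: the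
top of one slice is the bottom of the next, with opposite sign. -/
theorem single_endSign_sub_pointTwist_mem {w : List (Slice k)} (h : IsPath [] w []) {i : ℕ}
    {σ : Slice k} (hi : w[i]? = some σ) (e : ℕ ⊕ ℕ) :
    Finsupp.single (i, e) (σ.endSign e) - pointTwist w (slicePoint i e) ∈ trivialTwists R w := by
  rcases e with j | j
  · simp [pointTwist, slicePoint, Slice.endSign, botAt, hi]
  · simp only [pointTwist, slicePoint, Slice.endSign, h.botAt_succ hi]
    have := (trivialTwists R w).neg_mem
      (single_add_single_mem_of_level w i j (signAt σ.top j))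
    rwa [neg_add, ← Finsupp.single_neg, ← sub_eq_add_neg] at this

/-- One step of sliding a unit twist along a strand. The signs of the two ends are opposite, so the
twists at `p` and `q` weighted by their signs differ by equal twists at both ends. -/
theorem pointTwist_sub_mem_of_adjacent {w : List (Slice k)} (h : IsPath [] w []) {P Q : ℕ × ℕ}
    (hPQ : Adjacent w P Q) : pointTwist w P - pointTwist w Q ∈ trivialTwists R w := by
  obtain ⟨i, σ, p, q, hi, hpq, rfl, rfl⟩ := hPQ
  have h₁ := single_endSign_sub_pointTwist_mem (R := R) h hi p
  have h₂ := single_endSign_sub_pointTwist_mem (R := R) h hi q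
  have h₃ := single_add_single_mem_of_joins (R := R) hi hpq (σ.endSign p)
  rw [hpq.endSign_eq, Finsupp.single_neg] at h₂
  have := add_mem (sub_mem h₂ h₁) h₃
  convert this using 1
  abel

theorem pointTwist_sub_mem {w : List (Slice k)} (h : IsPath [] w []) {P Q : ℕ × ℕ}
    (hPQ : Relation.EqvGen (Adjacent w) P Q) :
    pointTwist w P - pointTwist w Q ∈ trivialTwists R w := by
  induction hPQ with
  | rel P Q h' => exact pointTwist_sub_mem_of_adjacent h h'
  | refl P => rw [sub_self]; exact zero_mem _
  | symm P Q _ ih => rw [← neg_sub]; exact neg_mem ih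
  | trans P Q T _ _ ih ih' => rw [← sub_add_sub_cancel]; exact add_mem ih ih'

/-- The strand at an end point of a slice. -/
def Slice.strandAt (σ : Slice k) : ℕ ⊕ ℕ → Option (Strand k)
  | .inl j => σ.bot[j]?
  | .inr j => σ.top[j]?

/-- The sign of an end point of a slice, if it belongs to the component `c`, and `0` otherwise. -/
def compSign (w : List (Slice k)) (c : Fin k) (p : ℕ × (ℕ ⊕ ℕ)) : ℤ :=
  (w[p.1]?).elim 0 fun σ =>
    (σ.strandAt p.2).elim 0 fun s => if s.comp = c then σ.endSign p.2 else 0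

/-- The total twist along the component `c`. -/
noncomputable def totalTwist (w : List (Slice k)) (c : Fin k) : Twist →+ ℤ :=
  Finsupp.liftAddHom fun p => AddMonoidHom.mulLeft (compSign w c p)

@[simp] theorem totalTwist_single (w : List (Slice k)) (c : Fin k) (p : ℕ × (ℕ ⊕ ℕ)) (n : ℤ) :
    totalTwist w c (Finsupp.single p n) = compSign w c p * n := by
  simp [totalTwist]

/-- Choose a base point `P c` on every component. Components are connected, so modulo trivial twists
each twist can be slid to the base point of its component, where the total twist is collected. If
that total is a multiple of the rack rank, it acts trivially. -/
theorem mem_trivialTwists_of_totalTwist (D : LinkDiagram k) {t : Twist}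
    (ht : ∀ c, (rackRank R : ℤ) ∣ totalTwist D.word c t) : t ∈ trivialTwists R D.word := by
  choose P s hP hs using D.comp_nonempty
  have key : ∀ t : Twist, t - ∑ c, totalTwist D.word c t • pointTwist D.word (P c) ∈
      trivialTwists R D.word := by
    intro t
    induction t using Finsupp.induction_linear with
    | zero => simp
    | add t t' h h' =>
      have := add_mem h h'
      convert this using 1
      simp only [map_add, add_smul, Finset.sum_add_distrib]
      abel
    | single p n =>
      obtain ⟨i, e⟩ := p
      rcases hi : D.word[i]? with _ | σ
      · have := single_mem_of_endSign_eq_zero (R := R) (w := D.word) (p := (i, e))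
          (by simp [endSign, hi]) n
        simpa [compSign, hi] using this
      rcases he : σ.strandAt e with _ | s'
      · have := single_mem_of_endSign_eq_zero (R := R) (w := D.word) (p := (i, e))
          (by rcases e with j | j <;> simp only [Slice.strandAt] at he <;>
              simp [endSign, hi, Slice.endSign, signAt, he]) n
        simpa [compSign, hi, he] using this
      have hsum : ∑ c, totalTwist D.word c (Finsupp.single (i, e) n) • pointTwist D.word (P c) =
          (σ.endSign e * n) • pointTwist D.word (P s'.comp) := by
        rw [Finset.sum_eq_single s'.comp]
        · simp [compSign, hi, he]
        · intro c _ hc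
          simp [compSign, hi, he, Ne.symm hc]
        · simp
      have hst : HasStrand D.word (slicePoint i e) s' := by
        rw [hasStrand_iff D.isPath]
        rcases e with j | j
        · simpa [slicePoint, botAt, hi, Slice.strandAt] using he
        · simpa [slicePoint, D.isPath.botAt_succ hi, Slice.strandAt] using he
      have h₁ := single_endSign_sub_pointTwist_mem (R := R) D.isPath hi e
      have h₂ := pointTwist_sub_mem (R := R) D.isPath
        (D.comp_connected _ _ _ _ hst (hP s'.comp) (hs s'.comp).symm)
      have h₃ := add_mem h₁ h₂
      rw [sub_add_sub_cancel] at h₃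
      have h₄ := AddSubgroup.zsmul_mem _ h₃ (σ.endSign e * n)
      -- Converts the plain twist `n` into `endSign * n` copies of the twist weighted by its sign.
      have hsq : σ.endSign e * σ.endSign e = 1 := by
        rcases e with j | j <;> simp only [Slice.strandAt] at he <;>
          simp [Slice.endSign, signAt, he, Strand.sign_mul_self]
      rw [hsum]
      convert h₄ using 1
      rw [smul_sub, Finsupp.smul_single, smul_eq_mul, mul_right_comm, hsq, one_mul]
  have h := add_mem (key t) ((trivialTwists R D.word).sum_mem (t := Finset.univ)
    fun c _ => smul_rackRank_mem D.word (pointTwist D.word (P c)) _ (ht c))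
  rwa [sub_add_cancel] at h

/-- The colorings only depend on the total twists along the components modulo the rack rank. -/
theorem chainEquiv_of_totalTwist (D : LinkDiagram k) {t t' : Twist}
    (h : ∀ c, (totalTwist D.word c t : ZMod (rackRank R)) = totalTwist D.word c t') :
    ChainEquiv (twistRules R D.word t.at) (twistRules R D.word t'.at) := by
  have : t' - t ∈ trivialTwists R D.word := by
    refine mem_trivialTwists_of_totalTwist D fun c => ?_
    rw [map_sub]
    exact (ZMod.intCast_eq_intCast_iff_dvd_sub _ _ _).1 (h c)
  simpa using this t

end TrivialTwists

/-! ## Invariance of twisted colorings under Reidemeister moves -/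

section MoveSwap

variable {R : Type*} [Rack R] {k : ℕ}

/-- The writhe of a word of slices. -/
def wordWrithe (w : List (Slice k)) (c : Fin k) : ℤ := (w.map fun σ => σ.elem.selfWrithe c).sum

theorem wordWrithe_append (w w' : List (Slice k)) (c : Fin k) :
    wordWrithe (w ++ w') c = wordWrithe w c + wordWrithe w' c := by simp [wordWrithe]

theorem wordWrithe_whisker (w : List (Slice k)) (u v : List (Strand k)) (c : Fin k) :
    wordWrithe (w.map (Slice.whisker u v)) c = wordWrithe w c := by
  simp only [wordWrithe, List.map_map]
  rfl

/-- When a strand slides past an extremum, the bit `o` and the direction of one crossing branch are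
both reversed, which leaves the sign alone. The two signs in `R2` cancel, and `R3` merely reorders
its crossings. -/
theorem FramedMove.wordWrithe_eq {L M : List (Slice k)} (h : FramedMove L M) (c : Fin k) :
    wordWrithe L c = wordWrithe M c := by
  cases h with
  | exchange e f m => simp [wordWrithe, add_comm]
  | straighten_left s => simp [wordWrithe, Elem.selfWrithe]
  | straighten_right s => simp [wordWrithe, Elem.selfWrithe]
  | slide_cap s d o =>
    have : s.rev.comp = s.comp := rfl
    cases o <;> simp [wordWrithe, Elem.selfWrithe, this, Strand.sign_rev, and_comm, mul_comm]
  | slide_cup s d o =>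
    have : s.rev.comp = s.comp := rfl
    cases o <;> simp [wordWrithe, Elem.selfWrithe, this, Strand.sign_rev, and_comm, mul_comm]
  | framedR1 s o => simp [wordWrithe, Elem.selfWrithe, kinkLeft, kinkRight]
  | R2 a b o =>
    simp only [wordWrithe, Elem.selfWrithe, List.map_cons, List.map_nil, List.sum_cons,
      List.sum_nil, and_comm (a := b.comp = c)]
    split_ifs <;> cases o <;> simp_all <;> ring
  | R3 a b d ab ac bc h => simp [wordWrithe, Elem.selfWrithe]; ring

theorem wordWrithe_kinkRight (s : Strand k) (o : Bool) (c : Fin k) :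
    wordWrithe (kinkRight s o) c = if s.comp = c then (if o then 1 else -1) else 0 := by
  have := s.sign_mul_self
  simp [wordWrithe, kinkRight, Elem.selfWrithe, this]

theorem wordWrithe_kinkLeft (s : Strand k) (o : Bool) (c : Fin k) :
    wordWrithe (kinkLeft s o) c = if s.comp = c then (if o then 1 else -1) else 0 := by
  have := s.sign_mul_self
  simp [wordWrithe, kinkLeft, Elem.selfWrithe, this]

theorem kinkPerm_eq_zpow (s : Strand k) (o : Bool) :
    kinkPerm R s o = (diagPerm R) ^ ((if o then 1 else -1) * s.sign) := by
  cases o <;> simp [kinkPerm, Strand.diag]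

/-- The twist by `a` at the bottom end point number `l` of the first slice of a word. -/
def bottomTwist (l : ℕ) (a : ℤ) (i : ℕ) (e : ℕ ⊕ ℕ) : ℤ := if i = 0 ∧ e = .inl l then a else 0

theorem bottomTwist_zero (l : ℕ) : bottomTwist l 0 = fun _ _ => 0 := by
  funext i e
  simp [bottomTwist]

theorem isChain_twistRules_bottomTwist {σ : Slice k} {w : List (Slice k)} {l : ℕ} {a : ℤ}
    {A B : List R} {c : List (List R)} :
    IsChain (twistRules R (σ :: w) (bottomTwist l a)) A c B ↔
      IsChain (arcRules R (σ :: w)) (twist (fun j => if j = l then a else 0) A) c B := by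
  have h : (fun i => bottomTwist l a (i + 1)) = fun _ _ => 0 := by
    funext i e
    simp [bottomTwist]
  rw [twistRules_cons, h, twistRules_zero]
  simp only [arcRules, List.map_cons, isChain_cons_iff, Slice.TwistRule, bottomTwist,
    Sum.inl.injEq, true_and, reduceCtorEq, and_false, if_false, twist_zero]

/-- A curl that changes the color by `δ ^ (-a)` is neutralized by a twist `δ ^ a` just below it, and
then it behaves like a vertical strand. -/
theorem swap_of_curl {σ : Slice k} {w : List (Slice k)} (hr : Rigid 1 (arcRules R (σ :: w))) {a : ℤ}
    (hw : ∀ r b, (∃ c, IsChain (arcRules R (σ :: w)) [r] c b) ↔ b = [((diagPerm R) ^ (-a)) r])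
    (u v : List (Strand k)) :
    Swap (u.length + (1 + v.length))
      (twistRules R ((σ :: w).map (Slice.whisker u v)) (bottomTwist u.length a))
      (arcRules R (([] : List (Slice k)).map (Slice.whisker u v))) := by
  have hr' := hr.whisker u v
  rw [List.map_cons] at hr' ⊢
  refine ⟨⟨?_, ?_⟩, ⟨?_, ?_⟩, ?_⟩
  · intro A B c c' hA h h'
    rw [isChain_twistRules_bottomTwist] at h h'
    exact hr'.unique (by simpa using hA) h h'
  · intro K hK A B c hA h₁ h₂ h
    rw [isChain_twistRules_bottomTwist] at h
    exact hr'.within hK (by simpa using hA) (hK.within_twist _ h₁) h₂ h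
  · intro A B c c' _ h h'
    rw [(isChain_nil_iff.1 h).1, (isChain_nil_iff.1 h').1]
  · intro K hK A B c _ _ _ h
    simp [(isChain_nil_iff.1 h).1]
  · intro P Q hP
    obtain ⟨A, p, B, rfl, hA, hp, hB⟩ := exists_eq_append_of_length hP
    obtain ⟨r, rfl⟩ := List.length_eq_one_iff.1 hp
    have ht : twist (fun j => if j = u.length then a else 0) (A ++ ([r] ++ B)) =
        A ++ ([((diagPerm R) ^ a) r] ++ B) := by
      rw [twist_append, twist_append]
      congr 1
      · rw [twist_congr (g := fun _ => 0), twist_zero]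
        intro j hj
        rw [if_neg (by omega)]
      congr 1
      · simp [twist_cons, hA]
      · rw [twist_congr (g := fun _ => 0), twist_zero]
        intro j hj
        rw [if_neg (by simp; omega)]
    have h₁ : ∀ c, IsChain (twistRules R (σ.whisker u v :: w.map (Slice.whisker u v))
        (bottomTwist u.length a)) (A ++ ([r] ++ B)) c Q ↔
        ∃ c₀ q, c = c₀.map (fun x => A ++ (x ++ B)) ∧ Q = A ++ (q ++ B) ∧
          IsChain (arcRules R (σ :: w)) [((diagPerm R) ^ a) r] c₀ q := fun c => by
      rw [isChain_twistRules_bottomTwist, ht, ← List.map_cons (f := Slice.whisker u v)]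
      exact isChain_whisker hA hB
    have h₂ : ∀ c, IsChain (arcRules R (([] : List (Slice k)).map (Slice.whisker u v)))
        (A ++ ([r] ++ B)) c Q ↔ c = [] ∧ A ++ ([r] ++ B) = Q := fun c => isChain_nil_iff
    simp only [h₁, h₂]
    constructor
    · rintro ⟨_, c₀, q, rfl, rfl, h⟩
      have := (hw _ _).1 ⟨_, h⟩
      rw [← Equiv.Perm.mul_apply, ← zpow_add, neg_add_cancel, zpow_zero] at this
      exact ⟨[], rfl, by simp [this]⟩
    · rintro ⟨_, -, rfl⟩
      obtain ⟨c, hc⟩ := (hw (((diagPerm R) ^ a) r) [r]).2 (by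
        rw [← Equiv.Perm.mul_apply, ← zpow_add, neg_add_cancel, zpow_zero]; rfl)
      exact ⟨_, c, [r], rfl, rfl, hc⟩

/-- A Reidemeister move preserves colorings, if the change of the writhe is compensated by a
twist. -/
theorem Move.swap {L M : List (Slice k)} (h : Move L M) {S T : List (Strand k)}
    (hL : IsPath S L T) : IsPath S M T ∧ ∃ a : ℤ, (S = [] → a = 0) ∧
      (∀ u v : List (Strand k), Swap (u.length + (S.length + v.length))
        (twistRules R (L.map (Slice.whisker u v)) (bottomTwist u.length a))
        (arcRules R (M.map (Slice.whisker u v)))) ∧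
      ∀ c, (S[0]?).elim 0 (fun s => if s.comp = c then s.sign else 0) * a + wordWrithe L c =
        wordWrithe M c := by
  cases h with
  | framed h =>
    obtain ⟨hM, hs⟩ := h.swap (R := R) hL
    -- A framed move needs no compensation. This also covers all moves with empty bottom, where no
    -- strand could carry a twist.
    refine ⟨hM, 0, fun _ => rfl, fun u v => ?_, fun c => by simp [h.wordWrithe_eq]⟩
    rw [bottomTwist_zero, twistRules_zero]
    exact hs.whisker u v
  | R1_right s o =>
    obtain ⟨rfl, -, -, rfl⟩ := hL
    -- Minus the exponent of the diagonal permutation caused by the curl; weighted by `s.sign` it is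
    -- minus the sign of the crossing.
    refine ⟨rfl, -((if o then 1 else -1) * s.sign), fun h => by simp [Slice.bot] at h,
      fun u v => ?_, fun c => ?_⟩
    · refine swap_of_curl (swap_framedR1 s o).left (fun r b => ?_) u v
      rw [neg_neg, ← kinkPerm_eq_zpow]
      constructor
      · rintro ⟨c, hc⟩
        obtain ⟨r', hr, rfl, -⟩ := isChain_kinkRight.1 hc
        rw [List.singleton_inj.1 hr]
      · rintro rfl
        exact ⟨_, isChain_kinkRight.2 ⟨r, rfl, rfl, rfl⟩⟩
    · rw [wordWrithe_kinkRight]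
      have := s.sign_mul_self
      cases o <;> by_cases hc : s.comp = c <;>
        simp [Slice.bot, Elem.bot, wordWrithe, hc, this]
  | R1_left s o =>
    obtain ⟨rfl, -, -, rfl⟩ := hL
    refine ⟨rfl, -((if o then 1 else -1) * s.sign), fun h => by simp [Slice.bot] at h,
      fun u v => ?_, fun c => ?_⟩
    · refine swap_of_curl (swap_framedR1 s o).right (fun r b => ?_) u v
      rw [neg_neg, ← kinkPerm_eq_zpow]
      constructor
      · rintro ⟨c, hc⟩
        obtain ⟨r', hr, rfl, -⟩ := isChain_kinkLeft.1 hc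
        rw [List.singleton_inj.1 hr]
      · rintro rfl
        exact ⟨_, isChain_kinkLeft.2 ⟨r, rfl, rfl, rfl⟩⟩
    · rw [wordWrithe_kinkLeft]
      have := s.sign_mul_self
      cases o <;> by_cases hc : s.comp = c <;>
        simp [Slice.bot, Elem.bot, wordWrithe, hc, this]

theorem Move.ne_nil {L M : List (Slice k)} (h : Move L M) : L ≠ [] := by
  cases h with
  | framed h => exact h.ne_nil
  | R1_right => simp [kinkRight]
  | R1_left => simp [kinkLeft]

/-- Each component in the local picture of a move meets its boundary. -/
theorem Move.exists_comp_eq {L M : List (Slice k)} (h : Move L M) {S T : List (Strand k)}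
    (hL : IsPath S L T) : ∀ τ ∈ L, ∀ s ∈ τ.top, ∃ s', (s' ∈ S ∨ s' ∈ T) ∧ s'.comp = s.comp := by
  have hr : ∀ s : Strand k, s.rev.comp = s.comp := fun _ => rfl
  cases h with
  | framed h =>
    cases h with
    | exchange e f m =>
      obtain ⟨rfl, -, rfl⟩ := hL
      intro τ hτ s hs
      refine ⟨s, ?_, rfl⟩
      simp only [List.mem_cons, List.not_mem_nil, or_false] at hτ
      rcases hτ with rfl | rfl <;> simp [Slice.bot, Slice.top] at hs ⊢ <;> tauto
    | straighten_left s =>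
      obtain ⟨rfl, -, rfl⟩ := hL
      simp [Slice.bot, Slice.top, Elem.bot, Elem.top, hr]
    | straighten_right s =>
      obtain ⟨rfl, -, rfl⟩ := hL
      simp [Slice.bot, Slice.top, Elem.bot, Elem.top]
      rintro s₁ ((rfl | rfl) | rfl) <;> simp [hr]
    | slide_cap s c o =>
      obtain ⟨rfl, -, rfl⟩ := hL
      simp [Slice.bot, Slice.top, Elem.bot, Elem.top, hr, or_and_right, exists_or]
    | slide_cup s c o =>
      obtain ⟨rfl, -, rfl⟩ := hL
      simp [Slice.bot, Slice.top, Elem.bot, Elem.top, hr, or_and_right, exists_or]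
      rintro s₁ ((rfl | rfl) | rfl) <;> simp [hr]
    | framedR1 s o =>
      obtain ⟨rfl, -, -, rfl⟩ := hL
      simp [kinkRight, Slice.bot, Slice.top, Elem.bot, Elem.top, hr]
    | R2 a b o =>
      obtain ⟨rfl, -, rfl⟩ := hL
      simp [Slice.bot, Slice.top, Elem.bot, Elem.top, or_and_right, exists_or]
    | R3 a b c ab ac bc h =>
      obtain ⟨rfl, -, -, rfl⟩ := hL
      simp [Slice.bot, Slice.top, Elem.bot, Elem.top, or_and_right, exists_or]
      constructor <;> rintro s ((rfl | rfl) | rfl) <;> simp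
  | R1_right s o =>
    obtain ⟨rfl, -, -, rfl⟩ := hL
    simp [kinkRight, Slice.bot, Slice.top, Elem.bot, Elem.top, hr]
  | R1_left s o =>
    obtain ⟨rfl, -, -, rfl⟩ := hL
    simp [kinkLeft, Slice.bot, Slice.top, Elem.bot, Elem.top, hr]

end MoveSwap

/-! ### Twists placed outside the local picture of a move -/

section Outside

variable {k : ℕ}

theorem exists_mem_top_of_isPath {w : List (Slice k)} : ∀ {S T : List (Strand k)}, IsPath S w T →
    T = S ∨ ∃ σ ∈ w, T = σ.top := by
  induction w with
  | nil => intro S T h; exact Or.inl h.symm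
  | cons σ w ih =>
    intro S T h
    rcases ih h.2 with rfl | ⟨τ, hτ, rfl⟩
    · exact Or.inr ⟨σ, by simp, rfl⟩
    · exact Or.inr ⟨τ, by simp [hτ], rfl⟩

/-- Every component of a diagram meets the complement of the local picture of a move. -/
theorem exists_strandAt_outside {D D' : LinkDiagram k} {pre post L M : List (Slice k)}
    {u v : List (Strand k)} (hm : Move L M) (h : IsReplacement D D' pre post u v L M) (c : Fin k) :
    ∃ (x : ℕ ⊕ ℕ) (e : ℕ ⊕ ℕ) (σ : Slice k) (s : Strand k),
      x.elim (fun i => pre[i]?) (fun i => post[i]?) = some σ ∧ σ.strandAt e = some s ∧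
        s.comp = c := by
  -- The index `x` is `inl i` for slice `i` of `pre` and `inr i` for slice `i` of `post`; unlike a
  -- position in the whole word, it does not depend on the number of replaced slices.
  have hpre : ∀ σ ∈ pre, ∀ e s, σ.strandAt e = some s → s.comp = c →
      ∃ (x : ℕ ⊕ ℕ) (e : ℕ ⊕ ℕ) (σ : Slice k) (s : Strand k),
        x.elim (fun i => pre[i]?) (fun i => post[i]?) = some σ ∧ σ.strandAt e = some s ∧
          s.comp = c := by
    intro σ hσ e s he hs
    obtain ⟨i, hi⟩ := List.mem_iff_getElem?.1 hσ
    exact ⟨.inl i, e, σ, s, hi, he, hs⟩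
  have hpost : ∀ σ ∈ post, ∀ e s, σ.strandAt e = some s → s.comp = c →
      ∃ (x : ℕ ⊕ ℕ) (e : ℕ ⊕ ℕ) (σ : Slice k) (s : Strand k),
        x.elim (fun i => pre[i]?) (fun i => post[i]?) = some σ ∧ σ.strandAt e = some s ∧
          s.comp = c := by
    intro σ hσ e s he hs
    obtain ⟨i, hi⟩ := List.mem_iff_getElem?.1 hσ
    exact ⟨.inr i, e, σ, s, hi, he, hs⟩
  have htop : ∀ {σ : Slice k} {s : Strand k}, s ∈ σ.top → ∃ e, σ.strandAt e = some s := by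
    intro σ s hs
    obtain ⟨j, hj⟩ := List.mem_iff_getElem?.1 hs
    exact ⟨.inr j, hj⟩
  obtain ⟨S, T, h₁, h₂, h₃⟩ := exists_of_isReplacement hm.ne_nil h
  have hS : ∀ s ∈ u ++ S ++ v, s.comp = c → ∃ (x : ℕ ⊕ ℕ) (e : ℕ ⊕ ℕ) (σ : Slice k) (s : Strand k),
      x.elim (fun i => pre[i]?) (fun i => post[i]?) = some σ ∧ σ.strandAt e = some s ∧
        s.comp = c := by
    intro s hs hc
    rcases exists_mem_top_of_isPath h₁ with h' | ⟨σ, hσ, h'⟩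
    · simp [h'] at hs
    · rw [h'] at hs
      obtain ⟨e, he⟩ := htop hs
      exact hpre σ hσ e s he hc
  have hT : ∀ s ∈ u ++ T ++ v, s.comp = c → ∃ (x : ℕ ⊕ ℕ) (e : ℕ ⊕ ℕ) (σ : Slice k) (s : Strand k),
      x.elim (fun i => pre[i]?) (fun i => post[i]?) = some σ ∧ σ.strandAt e = some s ∧
        s.comp = c := by
    intro s hs hc
    rcases hp : post with _ | ⟨σ, w⟩
    · subst hp
      rw [show u ++ T ++ v = [] from h₃] at hs
      simp at hs
    · rw [← hp]
      have hb : σ.bot = u ++ T ++ v := by rw [hp] at h₃; exact h₃.1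
      rw [← hb] at hs
      obtain ⟨j, hj⟩ := List.mem_iff_getElem?.1 hs
      exact hpost σ (by simp [hp]) (.inl j) s hj hc
  -- Some point of the component exists. If it lies in a replaced slice, the component also meets
  -- the level below or above the replaced part, and this level bounds a slice of `pre` or `post`.
  obtain ⟨P, s, ⟨U, hU, hs⟩, rfl⟩ := D.comp_nonempty c
  have hs := List.mem_of_getElem? hs
  rcases List.mem_cons.1 (List.mem_of_getElem? hU) with rfl | hU
  · simp at hs
  obtain ⟨σ, hσ, rfl⟩ := List.mem_map.1 hU
  rw [h.before, List.mem_append, List.mem_append] at hσ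
  rcases hσ with (hσ | hσ) | hσ
  · obtain ⟨e, he⟩ := htop hs
    exact hpre σ hσ e s he rfl
  · obtain ⟨τ, hτ, rfl⟩ := List.mem_map.1 hσ
    rw [Slice.top_whisker, List.mem_append, List.mem_append] at hs
    rcases hs with (hs | hs) | hs
    · exact hS s (by simp [hs]) rfl
    · obtain ⟨s', hs' | hs', hc⟩ := hm.exists_comp_eq h₂ τ hτ s hs
      · exact hS s' (by simp [hs']) hc
      · exact hT s' (by simp [hs']) hc
    · exact hS s (by simp [hs]) rfl
  · obtain ⟨e, he⟩ := htop hs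
    exact hpost σ hσ e s he rfl

/-- The index of a slice before or after a part consisting of the slices `m, …, m + n - 1`. -/
def outsideIndex (m n : ℕ) (x : ℕ ⊕ ℕ) : ℕ := x.elim id (fun i => i + (m + n))

/-- The twist given by integers at end points of slices, one for each component, before or after
the slices `m, …, m + n - 1`. -/
noncomputable def outsideTwist (x e : Fin k → ℕ ⊕ ℕ) (a : Fin k → ℤ) (m n : ℕ) : Twist :=
  ∑ c, Finsupp.single (outsideIndex m n (x c), e c) (a c)

theorem outsideTwist_at (x e : Fin k → ℕ ⊕ ℕ) (a : Fin k → ℤ) (m n i : ℕ) (r : ℕ ⊕ ℕ) :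
    (outsideTwist x e a m n).at i r =
      ∑ c, if outsideIndex m n (x c) = i ∧ e c = r then a c else 0 := by
  simp [Twist.at, outsideTwist, Finsupp.finsetSum_apply, Finsupp.single_apply]

variable {x e : Fin k → ℕ ⊕ ℕ} {a : Fin k → ℤ} {m n n' : ℕ}

theorem outsideTwist_at_before {i : ℕ} (hi : i < m) :
    (outsideTwist x e a m n).at i = (outsideTwist x e a m n').at i := by
  funext r
  simp only [outsideTwist_at]
  refine Finset.sum_congr rfl fun c _ => ?_
  have : outsideIndex m n (x c) = i ↔ outsideIndex m n' (x c) = i := by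
    rcases x c with j | j
    · exact Iff.rfl
    · simp only [outsideIndex, Sum.elim_inr]; omega
  simp only [this]

theorem outsideTwist_at_after (hx : ∀ c i, x c = .inl i → i < m) (i : ℕ) :
    (outsideTwist x e a m n).at (i + (m + n)) = (outsideTwist x e a m n').at (i + (m + n')) := by
  funext r
  simp only [outsideTwist_at]
  refine Finset.sum_congr rfl fun c _ => ?_
  have : outsideIndex m n (x c) = i + (m + n) ↔ outsideIndex m n' (x c) = i + (m + n') := by
    rcases hc : x c with j | j
    · have := hx c j hc
      simp only [outsideIndex, Sum.elim_inl, id]; omega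
    · simp only [outsideIndex, Sum.elim_inr]; omega
  simp only [this]

theorem outsideTwist_at_inside (hx : ∀ c i, x c = .inl i → i < m) {i : ℕ} (hi : i < n) :
    (outsideTwist x e a m n).at (i + m) = fun _ => 0 := by
  funext r
  rw [outsideTwist_at]
  refine Finset.sum_eq_zero fun c _ => if_neg fun h => ?_
  have := h.1
  rcases hc : x c with j | j
  · have := hx c j hc
    simp only [outsideIndex, hc, Sum.elim_inl, id] at h; omega
  · simp only [outsideIndex, hc, Sum.elim_inr] at h; omega

theorem getElem?_outsideIndex {pre L post : List (Slice k)} {y : ℕ ⊕ ℕ} {σ : Slice k}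
    (h : y.elim (fun i => pre[i]?) (fun i => post[i]?) = some σ) :
    (pre ++ L ++ post)[outsideIndex pre.length L.length y]? = some σ := by
  rcases y with i | i
  · simp only [Sum.elim_inl] at h
    have := (List.getElem?_eq_some_iff.1 h).1
    rw [outsideIndex, List.append_assoc, Sum.elim_inl, id, List.getElem?_append_left this, h]
  · simp only [Sum.elim_inr] at h
    rw [outsideIndex, Sum.elim_inr, List.getElem?_append_right (by simp), ← h]
    simp

/-- The summand for `c'` sits on the component `c'`, so only the one for `c` contributes. -/
theorem totalTwist_outsideTwist {pre L post : List (Slice k)} {σ : Fin k → Slice k}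
    {s : Fin k → Strand k}
    (hσ : ∀ c, (x c).elim (fun i => pre[i]?) (fun i => post[i]?) = some (σ c))
    (hs : ∀ c, (σ c).strandAt (e c) = some (s c)) (hc : ∀ c, (s c).comp = c) (c : Fin k) :
    totalTwist (pre ++ L ++ post) c (outsideTwist x e a pre.length L.length) =
      (σ c).endSign (e c) * a c := by
  rw [outsideTwist, map_sum, Finset.sum_eq_single c]
  · rw [totalTwist_single, compSign, getElem?_outsideIndex (hσ c)]
    simp [hs, hc]
  · intro c' _ hne
    rw [totalTwist_single, compSign, getElem?_outsideIndex (hσ c')]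
    simp [hs, hc, hne]
  · simp

theorem Slice.endSign_mul_self {σ : Slice k} {e : ℕ ⊕ ℕ} {s : Strand k}
    (h : σ.strandAt e = some s) : σ.endSign e * σ.endSign e = 1 := by
  rcases e with j | j <;> simp only [Slice.strandAt] at h <;>
    simp [Slice.endSign, signAt, h, Strand.sign_mul_self]

end Outside

/-! ### Twisted colorings along an isotopy -/

section StepInvariance

variable {R : Type*} [Rack R] {k : ℕ}

theorem LinkDiagram.writhe_eq (D : LinkDiagram k) (c : Fin k) :
    D.writhe c = wordWrithe D.word c := rfl

/-- Both diagrams receive the same twists outside the local picture, and the first one in addition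
the twist `b` at the bottom of the picture, which makes up for the change of the writhe. Every
component has a place outside, so any target `y` can be reached. -/
theorem exists_twists_of_step {D D' : LinkDiagram k} (h : Step D D') (y : Fin k → ℤ) :
    ∃ t t' : Twist, (∀ c, totalTwist D.word c t + D.writhe c = y c) ∧
      (∀ c, totalTwist D'.word c t' + D'.writhe c = y c) ∧
      ChainEquiv (twistRules R D.word t.at) (twistRules R D'.word t'.at) := by
  obtain ⟨pre, post, u, v, L, M, hm, h⟩ := h
  choose x e σ s hσ hs hc using exists_strandAt_outside hm h
  obtain ⟨S, T, h₁, h₂, h₃⟩ := exists_of_isReplacement hm.ne_nil h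
  obtain ⟨-, b, hb0, hswap, hw⟩ := hm.swap (R := R) h₂
  -- The twist `b` sits on the first strand of `S`. If `S` is empty, that end point may belong to an
  -- unrelated strand, but then `b = 0`.
  have hcs : ∀ c, compSign D.word c (pre.length, Sum.inl u.length) * b =
      (S[0]?).elim 0 (fun s => if s.comp = c then s.sign else 0) * b := by
    intro c
    rcases S with _ | ⟨s₀, S⟩
    · simp [hb0 rfl]
    · obtain ⟨τ, L₀, rfl⟩ := List.exists_cons_of_ne_nil hm.ne_nil
      have hτ : (τ.whisker u v).bot = u ++ (s₀ :: S) ++ v := by rw [Slice.bot_whisker, h₂.1]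
      congr 1
      simp [compSign, h.before, Slice.strandAt, Slice.endSign, hτ, signAt]
  have hD := h.before
  have hD' := h.after
  have hL0 : 0 < (L.map (Slice.whisker u v)).length :=
    List.length_pos_of_ne_nil (by simp [hm.ne_nil])
  have hwL := wordWrithe_whisker L u v
  have hwM := wordWrithe_whisker M u v
  have hswap := hswap u v
  generalize L.map (Slice.whisker u v) = L' at hD hL0 hwL hswap
  generalize M.map (Slice.whisker u v) = M' at hD' hwM hswap
  -- The factor `endSign` squares to `1` when the total twist is formed.
  set a : Fin k → ℤ := fun c => (σ c).endSign (e c) * (y c - D'.writhe c) with ha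
  have hx : ∀ c i, x c = .inl i → i < pre.length := by
    intro c i hi
    have := hσ c
    rw [hi, Sum.elim_inl] at this
    exact (List.getElem?_eq_some_iff.1 this).1
  have htot : ∀ N : List (Slice k), ∀ c, totalTwist (pre ++ N ++ post) c
      (outsideTwist x e a pre.length N.length) = y c - D'.writhe c := by
    intro N c
    rw [totalTwist_outsideTwist hσ hs hc, ha, ← mul_assoc, Slice.endSign_mul_self (hs c), one_mul]
  set p : ℕ × (ℕ ⊕ ℕ) := (pre.length, Sum.inl u.length) with hp
  refine ⟨outsideTwist x e a pre.length L'.length + Finsupp.single p b,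
    outsideTwist x e a pre.length M'.length, fun c => ?_, fun c => ?_, ?_⟩
  · rw [map_add, totalTwist_single, hcs, D.writhe_eq, hD, htot, D'.writhe_eq, hD']
    simp only [wordWrithe_append, hwL, hwM, ← hw c]
    ring
  · rw [hD', htot]
    ring
  · have hpt : ∀ i, i ≠ pre.length → (outsideTwist x e a pre.length L'.length +
        Finsupp.single p b).at i = (outsideTwist x e a pre.length L'.length).at i := by
      intro i hi
      funext r
      simp [Twist.at, p, Ne.symm hi]
    refine hswap.chainEquiv
      (pre := twistRules R pre (outsideTwist x e a pre.length L'.length).at)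
      (post := twistRules R post fun i =>
        (outsideTwist x e a pre.length L'.length).at (i + (pre.length + L'.length))) ?_ ?_ ?_
    · intro c z hz
      have key : ∀ (w : List (Slice k)) (t : ℕ → ℕ ⊕ ℕ → ℤ) (S T : List (Strand k)) (A B : List R)
          (c : List (List R)), IsChain (twistRules R w t) A c B → IsPath S w T →
          A.length = S.length → B.length = T.length := by
        intro w
        induction w with
        | nil =>
          intro t S T A B c hc hp hA
          obtain ⟨-, rfl⟩ := isChain_nil_iff.1 hc
          obtain rfl : S = T := hp
          exact hA
        | cons σ w ih =>
          intro t S T A B c hc hp hA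
          rw [twistRules_cons] at hc
          obtain ⟨A', c, rfl, h₁, hc⟩ := isChain_cons_iff.1 hc
          exact ih _ _ _ _ _ _ hc hp.2 h₁.length_eq.2
      simpa using key _ _ _ _ _ _ _ hz h₁ rfl
    · rw [hD, List.append_assoc, twistRules_append, twistRules_append]
      congr 1
      · refine twistRules_congr fun i τ hi => ?_
        rw [hpt i (List.getElem?_eq_some_iff.1 hi).1.ne]
      congr 1
      · refine twistRules_congr fun i τ hi => ?_
        congr 1
        have hi' := (List.getElem?_eq_some_iff.1 hi).1
        rw [Twist.add_at, outsideTwist_at_inside hx hi']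
        funext r
        simp only [Twist.at, p, bottomTwist, Finsupp.single_apply, Prod.mk.injEq, zero_add,
          right_eq_add]
        congr 1
        simp [eq_comm]
      · congr 1
        funext i
        rw [hpt _ (by omega)]
        congr 1
        omega
    · rw [hD', List.append_assoc, twistRules_append, twistRules_append]
      congr 1
      · refine twistRules_congr fun i τ hi => ?_
        rw [outsideTwist_at_before (List.getElem?_eq_some_iff.1 hi).1]
      congr 1
      · rw [← twistRules_zero]
        refine twistRules_congr fun i τ hi => ?_
        rw [outsideTwist_at_inside hx (List.getElem?_eq_some_iff.1 hi).1]
      · congr 1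
        funext i
        rw [add_assoc, add_comm M'.length, ← outsideTwist_at_after hx (n := L'.length)]

/-- Colorings, with total twists and writhes adding up to the same modulo the rack rank, are
equivalent for the two diagrams. -/
def TwistEquivalent (R : Type*) [Rack R] (D D' : LinkDiagram k) : Prop :=
  ∀ t t' : Twist, (∀ c, ((totalTwist D.word c t + D.writhe c : ℤ) : ZMod (rackRank R)) =
      ((totalTwist D'.word c t' + D'.writhe c : ℤ) : ZMod (rackRank R))) →
    ChainEquiv (twistRules R D.word t.at) (twistRules R D'.word t'.at)

theorem exists_totalTwist_eq (D : LinkDiagram k) (y : Fin k → ℤ) :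
    ∃ t : Twist, ∀ c, totalTwist D.word c t = y c := by
  have hex : ∀ c, ∃ (x : ℕ ⊕ ℕ) (e : ℕ ⊕ ℕ) (σ : Slice k) (s : Strand k),
      x.elim (fun i => D.word[i]?) (fun i => ([] : List (Slice k))[i]?) = some σ ∧
        σ.strandAt e = some s ∧ s.comp = c := by
    intro c
    obtain ⟨P, s, ⟨U, hU, hs⟩, rfl⟩ := D.comp_nonempty c
    rcases List.mem_cons.1 (List.mem_of_getElem? hU) with rfl | hU
    · simp at hs
    obtain ⟨σ, hσ, rfl⟩ := List.mem_map.1 hU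
    obtain ⟨i, hi⟩ := List.mem_iff_getElem?.1 hσ
    exact ⟨.inl i, .inr P.2, σ, s, hi, hs, rfl⟩
  choose x e σ s hσ hs hc using hex
  -- The whole word plays the role of the part before an empty replaced part.
  refine ⟨outsideTwist x e (fun c => (σ c).endSign (e c) * y c) D.word.length 0, fun c => ?_⟩
  have := totalTwist_outsideTwist (L := []) (a := fun c => (σ c).endSign (e c) * y c) hσ hs hc c
  rw [List.append_nil, List.append_nil, ← mul_assoc, Slice.endSign_mul_self (hs c),
    one_mul] at this
  exact this

/-- One pair of twists with the right totals suffices, since other twists with congruent totals give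
equivalent colorings within each diagram. -/
theorem twistEquivalent_of_step {D D' : LinkDiagram k} (h : Step D D') :
    TwistEquivalent R D D' := by
  intro t t' htt
  obtain ⟨t₁, t₁', h₁, h₁', he⟩ := exists_twists_of_step (R := R) h
    fun c => totalTwist D.word c t + D.writhe c
  refine (chainEquiv_of_totalTwist D fun c => ?_).trans
    (he.trans (chainEquiv_of_totalTwist D' fun c => ?_))
  · rw [add_right_cancel (h₁ c)]
  · have := htt c
    rw [← h₁' c] at this
    push_cast at this
    exact add_right_cancel this

theorem AmbientIsotopic.twistEquivalent {D D' : LinkDiagram k} (h : AmbientIsotopic D D') :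
    TwistEquivalent R D D' := by
  induction h with
  | rel D D' h => exact twistEquivalent_of_step h
  | refl D =>
    intro t t' h
    refine chainEquiv_of_totalTwist D fun c => ?_
    have := h c
    push_cast at this
    exact add_right_cancel this
  | symm D D' _ ih => exact fun t t' h => (ih t' t fun c => (h c).symm).symm
  | trans D D' D'' _ _ ih ih' =>
    intro t t'' h
    -- The intermediate diagram may have any writhe, and a twist absorbs the difference. This is why
    -- the statement carried along the isotopy concerns all twists and not only untwisted colorings.
    obtain ⟨t', ht'⟩ := exists_totalTwist_eq D' fun c =>
      totalTwist D.word c t + D.writhe c - D'.writhe c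
    exact (ih t t' fun c => by rw [ht' c, sub_add_cancel]).trans
      (ih' t' t'' fun c => by rw [ht' c, sub_add_cancel, h c])

theorem AmbientIsotopic.chainEquiv {D D' : LinkDiagram k} (h : AmbientIsotopic D D')
    (hw : ∀ c, (D.writhe c : ZMod (rackRank R)) = D'.writhe c) :
    ChainEquiv (arcRules R D.word) (arcRules R D'.word) := by
  have := h.twistEquivalent (R := R) 0 0 fun c => by simpa using hw c
  have h0 : (0 : Twist).at = fun _ _ => 0 := rfl
  rwa [h0, twistRules_zero, twistRules_zero] at this

end StepInvariance

/-! ## Diagrams with prescribed writhes -/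

section Curls

variable {k : ℕ}

/-- The points of a curl inserted at level `m` of a diagram are connected to the level below it. -/
theorem eqvGen_kinkRight {pre post : List (Slice k)} {u v : List (Strand k)} {s : Strand k}
    {o : Bool} {w : List (Slice k)}
    (hw : w = pre ++ (kinkRight s o).map (Slice.whisker u v) ++ post) :
    (∀ j < u.length, Relation.EqvGen (Adjacent w) (pre.length, j) (pre.length + 1, j) ∧
      Relation.EqvGen (Adjacent w) (pre.length, j) (pre.length + 2, j) ∧
      Relation.EqvGen (Adjacent w) (pre.length, j) (pre.length + 3, j)) ∧
    (∀ j < v.length, Relation.EqvGen (Adjacent w) (pre.length, u.length + 1 + j)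
        (pre.length + 1, u.length + 3 + j) ∧
      Relation.EqvGen (Adjacent w) (pre.length, u.length + 1 + j)
        (pre.length + 2, u.length + 3 + j) ∧
      Relation.EqvGen (Adjacent w) (pre.length, u.length + 1 + j)
        (pre.length + 3, u.length + 1 + j)) ∧
    (∀ j < 3, Relation.EqvGen (Adjacent w) (pre.length, u.length)
        (pre.length + 1, u.length + j) ∧
      Relation.EqvGen (Adjacent w) (pre.length, u.length) (pre.length + 2, u.length + j)) ∧
    Relation.EqvGen (Adjacent w) (pre.length, u.length) (pre.length + 3, u.length) := by
  set m := pre.length with hm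
  set a := u.length with ha
  set K₀ : Slice k := ⟨u ++ [s], .cup s, [] ++ v⟩
  set K₁ : Slice k := ⟨u ++ [], .cross s s o, [s.rev] ++ v⟩
  set K₂ : Slice k := ⟨u ++ [s], .cap s, [] ++ v⟩
  have hw' : w = pre ++ ([K₀, K₁, K₂] ++ post) := by rw [hw, List.append_assoc]; rfl
  have h₀ : ∀ {p q}, K₀.Joins p q →
      Relation.EqvGen (Adjacent w) (slicePoint m p) (slicePoint m q) := fun {p q} h =>
    .rel _ _ ⟨m, K₀, p, q, by simp [hw', hm], h, rfl, rfl⟩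
  have h₁ : ∀ {p q}, K₁.Joins p q →
      Relation.EqvGen (Adjacent w) (slicePoint (m + 1) p) (slicePoint (m + 1) q) := fun {p q} h =>
    .rel _ _ ⟨m + 1, K₁, p, q, by simp [hw', hm], h, rfl, rfl⟩
  have h₂ : ∀ {p q}, K₂.Joins p q →
      Relation.EqvGen (Adjacent w) (slicePoint (m + 2) p) (slicePoint (m + 2) q) := fun {p q} h =>
    .rel _ _ ⟨m + 2, K₂, p, q, by simp [hw', hm], h, rfl, rfl⟩
  have l₀ : ∀ j < a + 1, Relation.EqvGen (Adjacent w) (m, j) (m + 1, j) := fun j hj =>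
    h₀ (Slice.Joins.left j (by simpa [K₀] using hj))
  have l₁ : ∀ j < a, Relation.EqvGen (Adjacent w) (m + 1, j) (m + 2, j) := fun j hj =>
    h₁ (Slice.Joins.left j (by simpa [K₁] using hj))
  have l₂ : ∀ j < a + 1, Relation.EqvGen (Adjacent w) (m + 2, j) (m + 3, j) := fun j hj =>
    h₂ (Slice.Joins.left j (by simpa [K₂] using hj))
  have r₀ : ∀ j < v.length, Relation.EqvGen (Adjacent w) (m, a + 1 + j) (m + 1, a + 3 + j) :=
    fun j hj => by
      have := h₀ (Slice.Joins.right j (by simpa [K₀] using hj))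
      simpa [slicePoint, K₀, Elem.bot, Elem.top, add_assoc] using this
  have r₁ : ∀ j < v.length + 1, Relation.EqvGen (Adjacent w) (m + 1, a + 2 + j) (m + 2, a + 2 + j) :=
    fun j hj => by
      have := h₁ (Slice.Joins.right j (by simpa [K₁] using hj))
      simpa [slicePoint, K₁, Elem.bot, Elem.top, add_assoc] using this
  have r₂ : ∀ j < v.length, Relation.EqvGen (Adjacent w) (m + 2, a + 3 + j) (m + 3, a + 1 + j) :=
    fun j hj => by
      have := h₂ (Slice.Joins.right j (by simpa [K₂] using hj))
      simpa [slicePoint, K₂, Elem.bot, Elem.top, add_assoc] using this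
  have e₀ : Relation.EqvGen (Adjacent w) (m + 1, a + 1) (m + 1, a + 2) := by
    have := h₀ (Slice.Joins.elem (Elem.Joins.cup s))
    simpa [slicePoint, K₀, add_assoc] using this
  have e₁ : Relation.EqvGen (Adjacent w) (m + 1, a) (m + 2, a + 1) := by
    have := h₁ (Slice.Joins.elem (Elem.Joins.cross_left s s o))
    simpa [slicePoint, K₁, add_assoc] using this
  have e₁' : Relation.EqvGen (Adjacent w) (m + 1, a + 1) (m + 2, a) := by
    have := h₁ (Slice.Joins.elem (Elem.Joins.cross_right s s o))
    simpa [slicePoint, K₁, add_assoc] using this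
  have e₂ : Relation.EqvGen (Adjacent w) (m + 2, a + 1) (m + 2, a + 2) := by
    have := h₂ (Slice.Joins.elem (Elem.Joins.cap s))
    simpa [slicePoint, K₂, add_assoc] using this
  -- The path follows the strand through the curl: up through the crossing, over the cap, down on
  -- the right, around the cup, and through the crossing again.
  have p₁ := l₀ a (by omega)
  have p₂ := p₁.trans _ _ _ e₁
  have p₃ := p₂.trans _ _ _ e₂
  have p₄ := p₃.trans _ _ _ ((r₁ 0 (by omega)).symm)
  have p₅ := p₄.trans _ _ _ e₀.symm
  have p₆ := p₅.trans _ _ _ e₁'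
  refine ⟨fun j hj => ?_, fun j hj => ?_, fun j hj => ?_, p₆.trans _ _ _ (l₂ a (by omega))⟩
  · have q₁ := l₀ j (by omega)
    have q₂ := q₁.trans _ _ _ (l₁ j hj)
    exact ⟨q₁, q₂, q₂.trans _ _ _ (l₂ j (by omega))⟩
  · have q₁ := r₀ j hj
    have q₂ := q₁.trans _ _ _ (by
      have := r₁ (1 + j) (by omega)
      rwa [← add_assoc] at this)
    exact ⟨q₁, q₂, q₂.trans _ _ _ (r₂ j hj)⟩
  · interval_cases j
    · exact ⟨p₁, p₆⟩
    · exact ⟨p₅, p₂⟩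
    · exact ⟨p₄, p₃⟩

theorem exists_split_of_hasStrand {w : List (Slice k)} (h : IsPath [] w []) {P : ℕ × ℕ}
    {s : Strand k} (hP : HasStrand w P s) : ∃ pre post u v, w = pre ++ post ∧
      IsPath [] pre (u ++ [s] ++ v) ∧ IsPath (u ++ [s] ++ v) post [] := by
  have hw : w = w.take P.1 ++ w.drop P.1 := (List.take_append_drop _ _).symm
  rw [hw, isPath_append_iff] at h
  obtain ⟨U, h₁, h₂⟩ := h
  have hU : botAt w P.1 = U := by
    rcases hd : w.drop P.1 with _ | ⟨σ, w'⟩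
    · rw [hd] at h₂
      have hl : w.length ≤ P.1 := List.drop_eq_nil_iff.1 hd
      simp [botAt, List.getElem?_eq_none hl, show U = [] from h₂]
    · rw [hd] at h₂
      have : w[P.1]? = some σ := by
        rw [← List.head?_drop, hd]; rfl
      simp [botAt, this, h₂.1]
  have hs := (hasStrand_iff (by rw [hw]; exact isPath_append_iff.2 ⟨U, h₁, h₂⟩)).1 hP
  rw [hU] at hs
  obtain ⟨u, v, rfl⟩ := List.append_of_mem (List.mem_of_getElem? hs)
  exact ⟨_, _, u, v, hw, by simpa using h₁, by simpa using h₂⟩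

/-- A diagram obtained by adding a curl. -/
theorem exists_curl (D : LinkDiagram k) (i : Fin k) (o : Bool) :
    ∃ D' : LinkDiagram k, AmbientIsotopic D D' ∧
      ∀ c, D'.writhe c = D.writhe c + if i = c then (if o then 1 else -1) else 0 := by
  obtain ⟨P, s, hP, rfl⟩ := D.comp_nonempty i
  obtain ⟨pre, post, u, v, hD, h₁, h₂⟩ := exists_split_of_hasStrand D.isPath hP
  set w := pre ++ (kinkRight s o).map (Slice.whisker u v) ++ post with hw
  have hk : IsPath [s] (kinkRight s o) [s] := by
    simp [kinkRight, IsPath, Slice.bot, Slice.top, Elem.bot, Elem.top]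
  have hpath : IsPath [] w [] :=
    isPath_append_iff.2 ⟨_, isPath_append_iff.2 ⟨_, h₁, hk.whisker u v⟩, h₂⟩
  obtain ⟨E₁, E₂, E₃, E₄⟩ := eqvGen_kinkRight hw
  set U := u ++ [s] ++ v with hU
  have hlen : ((kinkRight s o).map (Slice.whisker u v)).length = 3 := rfl
  have hpost : ∀ (i : ℕ), w[i + pre.length + 3]? = post[i]? := by
    intro i
    have hl : (pre ++ (kinkRight s o).map (Slice.whisker u v)).length = pre.length + 3 := by
      rw [List.length_append, hlen]
    rw [hw, List.getElem?_append_right (by omega)]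
    congr 1
    omega
  have hpost' : ∀ (i : ℕ), D.word[i + pre.length]? = post[i]? := by
    intro i
    rw [hD, List.getElem?_append_right (by omega)]
    congr 1
    omega
  have hpre : ∀ i < pre.length, w[i]? = D.word[i]? := by
    intro i hi
    rw [hw, hD, List.append_assoc, List.getElem?_append_left hi, List.getElem?_append_left hi]
  have hmid : botAt w pre.length = U ∧ botAt w (pre.length + 1) = u ++ [s, s, s.rev] ++ v ∧
      botAt w (pre.length + 2) = u ++ [s, s, s.rev] ++ v := by
    refine ⟨?_, ?_, ?_⟩ <;>
      simp [botAt, hw, kinkRight, Slice.whisker, Slice.bot, Elem.bot, U]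
  have hbotD : botAt D.word pre.length = U := by
    have := hpost' 0
    rw [Nat.zero_add] at this
    rw [botAt, this]
    rcases post with _ | ⟨σ, post⟩
    · exact (show U = [] from h₂).symm
    · exact h₂.1
  -- the old levels, and the curl below the level `m + 3`
  have hE : ∀ j < U.length, Relation.EqvGen (Adjacent w) (pre.length, j) (pre.length + 3, j) := by
    intro j hj
    simp only [U, List.length_append, List.length_singleton] at hj
    rcases lt_trichotomy j u.length with h | rfl | h
    · exact (E₁ j h).2.2
    · exact E₄
    · obtain ⟨j', rfl⟩ := Nat.exists_eq_add_of_lt h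
      have := (E₂ j' (by omega)).2.2
      rwa [show u.length + 1 + j' = u.length + j' + 1 by omega] at this
  -- Embeds the old points into the new diagram. The old level `pre.length` is sent to the top of
  -- the curl; `hE` connects it with the level below the curl.
  let ρ : ℕ × ℕ → ℕ × ℕ := fun P => if P.1 < pre.length then P else (P.1 + 3, P.2)
  have hbotρ : ∀ P, botAt w (ρ P).1 = botAt D.word P.1 ∧ (ρ P).2 = P.2 := by
    intro P
    by_cases hP : P.1 < pre.length
    · simp [ρ, hP, botAt, hpre]
    · obtain ⟨i, hi⟩ := Nat.exists_eq_add_of_le (not_lt.1 hP)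
      simp only [ρ, hP, if_false, botAt, and_true]
      rw [hi, add_comm pre.length, hpost, hpost']
  have hstr : ∀ P t, HasStrand D.word P t → HasStrand w (ρ P) t := by
    intro P t h
    rw [hasStrand_iff hpath, (hbotρ P).1, (hbotρ P).2]
    exact (hasStrand_iff D.isPath).1 h
  have hadj : ∀ P Q, Adjacent D.word P Q → Relation.EqvGen (Adjacent w) (ρ P) (ρ Q) := by
    rintro _ _ ⟨i, σ, p, q, hi, hpq, rfl, rfl⟩
    by_cases him : i < pre.length
    · have h' : Relation.EqvGen (Adjacent w) (slicePoint i p) (slicePoint i q) :=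
        .rel _ _ ⟨i, σ, p, q, by rw [hpre i him, hi], hpq, rfl, rfl⟩
      -- The top of the last slice of `pre` is moved above the curl by `ρ`, so the path has to go
      -- through the curl.
      have key : ∀ r : ℕ ⊕ ℕ, σ.strandAt r ≠ none →
          Relation.EqvGen (Adjacent w) (slicePoint i r) (ρ (slicePoint i r)) := by
        intro r hr
        rcases r with j | j
        · simp only [slicePoint, ρ, him, if_true]
          exact .refl _
        · by_cases him' : i + 1 < pre.length
          · simp only [slicePoint, ρ, him', if_true]
            exact .refl _
          · have him'' : i + 1 = pre.length := by omega
            simp only [slicePoint, ρ, him', if_false]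
            rw [him'']
            apply hE
            have := D.isPath.botAt_succ hi
            rw [him'', hbotD] at this
            rw [this]
            by_contra hj
            exact hr (List.getElem?_eq_none (by omega))
      have hne : ∀ {p q}, σ.Joins p q → σ.strandAt p ≠ none ∧ σ.strandAt q ≠ none := by
        intro p q h
        rcases h with ⟨j, hj⟩ | ⟨h⟩ | ⟨j, hj⟩
        · simp [Slice.strandAt, Slice.bot, Slice.top, Nat.lt_add_right _ hj]
        · obtain ⟨u, e, v⟩ := σ
          cases h <;> simp [Slice.strandAt, Slice.bot, Slice.top, Elem.bot, Elem.top]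
        · simp [Slice.strandAt, Slice.bot, Slice.top]
          omega
      exact (((key p (hne hpq).1).symm).trans _ _ _ h').trans _ _ _ (key q (hne hpq).2)
    · obtain ⟨i', rfl⟩ := Nat.exists_eq_add_of_le (not_lt.1 him)
      have h' : ∀ r : ℕ ⊕ ℕ, ρ (slicePoint (pre.length + i') r) =
          slicePoint (i' + pre.length + 3) r := by
        rintro (j | j)
        · simp only [ρ, slicePoint]
          rw [if_neg (by omega)]
          simp only [Prod.mk.injEq, and_true]
          omega
        · simp only [ρ, slicePoint]
          rw [if_neg (by omega)]
          simp only [Prod.mk.injEq, and_true]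
          omega
      rw [h', h']
      refine .rel _ _ ⟨_, σ, p, q, ?_, hpq, rfl, rfl⟩
      rw [hpost, ← hpost', add_comm, hi]
  have heqv : ∀ P Q, Relation.EqvGen (Adjacent D.word) P Q →
      Relation.EqvGen (Adjacent w) (ρ P) (ρ Q) := by
    intro P Q h
    induction h with
    | rel P Q h => exact hadj P Q h
    | refl P => exact .refl _
    | symm P Q _ ih => exact ih.symm
    | trans P Q T _ _ ih ih' => exact ih.trans _ _ _ ih'
  have hU' : ∀ j t, U[j]? = some t → HasStrand D.word (pre.length, j) t ∧
      Relation.EqvGen (Adjacent w) (pre.length, j) (ρ (pre.length, j)) := by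
    intro j t h
    refine ⟨(hasStrand_iff D.isPath).2 (by rw [hbotD]; exact h), ?_⟩
    simp only [ρ, lt_irrefl, if_false]
    exact hE j (List.getElem?_eq_some_iff.1 h).1
  -- Every new point is connected to an old one of the same component, so connectedness of the
  -- components is inherited from `D`.
  have hcover : ∀ P t, HasStrand w P t → ∃ Q t', HasStrand D.word Q t' ∧ t'.comp = t.comp ∧
      Relation.EqvGen (Adjacent w) P (ρ Q) := by
    rintro ⟨l, j⟩ t h
    have hb := (hasStrand_iff hpath).1 h
    have hin : ∀ l, (l = pre.length + 1 ∨ l = pre.length + 2) →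
        (u ++ [s, s, s.rev] ++ v)[j]? = some t → ∃ Q t', HasStrand D.word Q t' ∧
          t'.comp = t.comp ∧ Relation.EqvGen (Adjacent w) (l, j) (ρ Q) := by
      intro l hl ht
      rw [List.append_assoc] at ht
      rcases lt_or_ge j u.length with hj | hj
      · obtain ⟨a₁, a₂, -⟩ := E₁ j hj
        obtain ⟨b₁, b₂⟩ := hU' j t (by
          rw [List.getElem?_append_left hj] at ht
          rw [hU, List.append_assoc, List.getElem?_append_left hj, ht])
        refine ⟨_, t, b₁, rfl, ?_⟩
        rcases hl with rfl | rfl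
        · exact a₁.symm.trans _ _ _ b₂
        · exact a₂.symm.trans _ _ _ b₂
      obtain ⟨j, rfl⟩ := Nat.exists_eq_add_of_le hj
      rw [List.getElem?_append_right (by omega), Nat.add_sub_cancel_left] at ht
      rcases lt_or_ge j 3 with hj3 | hj3
      · obtain ⟨a₁, a₂⟩ := E₃ j hj3
        obtain ⟨b₁, b₂⟩ := hU' u.length s (by simp [hU])
        refine ⟨_, s, b₁, ?_, ?_⟩
        · have : t = s ∨ t = s.rev := by
            interval_cases j <;> simp at ht <;> simp [ht]
          rcases this with rfl | rfl <;> rfl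
        · rcases hl with rfl | rfl
          · exact a₁.symm.trans _ _ _ b₂
          · exact a₂.symm.trans _ _ _ b₂
      · obtain ⟨j, rfl⟩ := Nat.exists_eq_add_of_le hj3
        rw [List.getElem?_append_right (by simp), show 3 + j - [s, s, s.rev].length = j by
          simp] at ht
        obtain ⟨a₁, a₂, -⟩ := E₂ j (List.getElem?_eq_some_iff.1 ht).1
        obtain ⟨b₁, b₂⟩ := hU' (u.length + 1 + j) t (by
          rw [hU, List.getElem?_append_right (by simp), ← ht]
          simp)
        rw [← add_assoc]
        refine ⟨_, t, b₁, rfl, ?_⟩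
        rcases hl with rfl | rfl
        · exact a₁.symm.trans _ _ _ b₂
        · exact a₂.symm.trans _ _ _ b₂
    simp only at hb
    rcases lt_or_ge l pre.length with hl | hl
    · refine ⟨(l, j), t, (hasStrand_iff D.isPath).2 ?_, rfl, ?_⟩
      · simpa only [botAt, hpre l hl] using hb
      · simp only [ρ, hl, if_true]
        exact .refl _
    obtain ⟨l, rfl⟩ := Nat.exists_eq_add_of_le hl
    rcases lt_or_ge l 3 with hl3 | hl3
    · interval_cases l
      · rw [Nat.add_zero, hmid.1] at hb
        obtain ⟨b₁, b₂⟩ := hU' j t hb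
        exact ⟨_, t, b₁, rfl, b₂⟩
      · rw [hmid.2.1] at hb
        exact hin _ (Or.inl rfl) hb
      · rw [hmid.2.2] at hb
        exact hin _ (Or.inr rfl) hb
    · obtain ⟨l, rfl⟩ := Nat.exists_eq_add_of_le hl3
      have hρ : ρ (l + pre.length, j) = (pre.length + (3 + l), j) := by
        simp [ρ]; omega
      refine ⟨(l + pre.length, j), t, (hasStrand_iff D.isPath).2 ?_, rfl, ?_⟩
      · rw [← (hbotρ (l + pre.length, j)).1, hρ]
        exact hb
      · rw [hρ]
        exact .refl _
  let D' : LinkDiagram k :=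
    { word := w
      isPath := hpath
      comp_nonempty := fun c => by
        obtain ⟨P, t, h, hc⟩ := D.comp_nonempty c
        exact ⟨ρ P, t, hstr P t h, hc⟩
      comp_connected := fun P Q t t' hP hQ hc => by
        obtain ⟨P₀, t₀, hP₀, hc₀, e₀⟩ := hcover P t hP
        obtain ⟨Q₀, t₁, hQ₀, hc₁, e₁⟩ := hcover Q t' hQ
        have := heqv _ _ (D.comp_connected _ _ _ _ hP₀ hQ₀ (by rw [hc₀, hc₁, hc]))
        exact (e₀.trans _ _ _ this).trans _ _ _ e₁.symm }
  refine ⟨D', .symm _ _ (.rel _ _ ⟨pre, post, u, v, _, [], Move.R1_right s o, rfl, by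
    simpa using hD⟩), fun c => ?_⟩
  rw [D'.writhe_eq, D.writhe_eq, hD]
  simp only [D', hw, wordWrithe_append, wordWrithe_whisker, wordWrithe_kinkRight]
  ring

/-- The attainable changes of the writhe vector are closed under addition and contain the unit
vectors and their negatives, by curls of both signs. -/
theorem exists_diagram_writhe_add (n : Fin k → ℤ) : ∀ D : LinkDiagram k,
    ∃ D' : LinkDiagram k, AmbientIsotopic D D' ∧ ∀ c, D'.writhe c = D.writhe c + n c := by
  let C : (Fin k → ℤ) → Prop := fun n => ∀ D : LinkDiagram k,
    ∃ D' : LinkDiagram k, AmbientIsotopic D D' ∧ ∀ c, D'.writhe c = D.writhe c + n c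
  have h0 : C 0 := fun D => ⟨D, .refl _, by simp⟩
  have hadd : ∀ n n', C n → C n' → C (n + n') := by
    intro n n' h h' D
    obtain ⟨D₁, i₁, h₁⟩ := h D
    obtain ⟨D₂, i₂, h₂⟩ := h' D₁
    exact ⟨D₂, i₁.trans _ _ _ i₂, fun c => by rw [h₂, h₁, Pi.add_apply, add_assoc]⟩
  have hone : ∀ i (o : Bool), C (Pi.single i (if o then 1 else -1)) := by
    intro i o D
    obtain ⟨D', hi, h⟩ := exists_curl D i o
    refine ⟨D', hi, fun c => ?_⟩
    rw [h c, Pi.single_apply]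
    simp only [eq_comm]
  have hsingle : ∀ i z, C (Pi.single i z) := by
    intro i z
    induction z using Int.induction_on with
    | zero => simpa using h0
    | succ z ih => simpa [Pi.single_add] using hadd _ _ ih (hone i true)
    | pred z ih => simpa [sub_eq_add_neg, Pi.single_add] using hadd _ _ ih (hone i false)
  have : C (∑ i, Pi.single i (n i)) :=
    Finset.sum_induction _ C hadd h0 fun i _ => hsingle i (n i)
  rwa [Finset.univ_sum_single] at this

theorem exists_isFramingFamily (R : Type*) [Rack R] [Finite R] (D : LinkDiagram k) :
    ∃ E, IsFramingFamily R D E := by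
  choose E hE hw using fun w : Fin k → ZMod (rackRank R) =>
    exists_diagram_writhe_add (fun c => ((w c).val : ℤ) - D.writhe c) D
  refine ⟨E, fun w => ⟨hE w, fun c => ?_⟩⟩
  rw [hw w c, add_sub_cancel, Int.cast_natCast, ZMod.natCast_zmod_val]

end Curls

/-! ## The invariants -/

section Invariance

variable {R X : Type*} [Rack R] [RackShadow R X] {k : ℕ}

/-- For fixed `w` the chosen diagrams are isotopic through `D` and `D'` and have congruent writhe
vectors, so the summands for `w` can be compared one by one. -/
theorem IsFramingFamily.exists_equiv [Finite X] {D D' : LinkDiagram k} (h : AmbientIsotopic D D')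
    {E E' : (Fin k → ZMod (rackRank R)) → LinkDiagram k} (hE : IsFramingFamily R D E)
    (hE' : IsFramingFamily R D' E') (w : Fin k → ZMod (rackRank R)) :
    ∃ φ : ShadowColoring R X (E w) ≃ ShadowColoring R X (E' w),
      ∀ f, (φ f).shadowImage = f.shadowImage := by
  have hi : AmbientIsotopic (E w) (E' w) :=
    (((hE w).1.symm).trans _ _ _ h).trans _ _ _ (hE' w).1
  exact exists_equiv_of_chainEquiv X
    (hi.chainEquiv fun c => by rw [(hE w).2 c, (hE' w).2 c])

variable [Fintype R] [Fintype X]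

theorem IsFramingFamily.multisetInvariant_eq {D D' : LinkDiagram k} (h : AmbientIsotopic D D')
    {E E' : (Fin k → ZMod (rackRank R)) → LinkDiagram k} (hE : IsFramingFamily R D E)
    (hE' : IsFramingFamily R D' E') : multisetInvariant R X E = multisetInvariant R X E' := by
  refine Finset.sum_congr rfl fun w _ => ?_
  obtain ⟨φ, hφ⟩ := hE.exists_equiv (X := X) h hE' w
  rw [← Finset.map_univ_equiv φ, Finset.map_val, Multiset.map_map]
  simp [hφ]

theorem IsFramingFamily.shadowPolyInvariant_eq {D D' : LinkDiagram k} (h : AmbientIsotopic D D')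
    {E E' : (Fin k → ZMod (rackRank R)) → LinkDiagram k} (hE : IsFramingFamily R D E)
    (hE' : IsFramingFamily R D' E') : shadowPolyInvariant R X E = shadowPolyInvariant R X E' := by
  refine Finset.sum_congr rfl fun w _ => ?_
  obtain ⟨φ, hφ⟩ := hE.exists_equiv (X := X) h hE' w
  exact Fintype.sum_equiv φ _ _ fun f => by rw [hφ]

end Invariance

end ShadowLink

theorem mainTheorem1 {R X : Type*} [Rack R] [RackShadow R X] [Fintype R] [Fintype X] {k : ℕ} :
    -- a framed move gives a bijection of shadow colorings that preserves the shadow image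
    (∀ (D D' : LinkDiagram k) (pre post : List (Slice k)) (u v : List (Strand k))
        (L M : List (Slice k)), FramedMove L M → IsReplacement D D' pre post u v L M →
      ∃ φ : ShadowColoring R X D ≃ ShadowColoring R X D',
        (∀ f f', φ f = f' ↔ AgreeOutside pre.length L.length M.length f f') ∧
        (∀ f, (φ f).shadowImage = f.shadowImage ∧
          subshadowPoly R (φ f).shadowImage = subshadowPoly R f.shadowImage)) ∧
    -- every link has diagrams with all writhe vectors modulo the rack rank
    (∀ D : LinkDiagram k, ∃ E, IsFramingFamily R D E) ∧
    -- the invariants depend only on the ambient isotopy class of the oriented link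
    (∀ D D' : LinkDiagram k, AmbientIsotopic D D' →
      ∀ E E', IsFramingFamily R D E → IsFramingFamily R D' E' →
        multisetInvariant R X E = multisetInvariant R X E' ∧
        shadowPolyInvariant R X E = shadowPolyInvariant R X E') := by
  refine ⟨fun D D' pre post u v L M hm h => ?_, exists_isFramingFamily R, fun D D' h E E' hE hE' =>
    ⟨hE.multisetInvariant_eq h hE', hE.shadowPolyInvariant_eq h hE'⟩⟩
  obtain ⟨φ, hφ, himg⟩ := framedMove_bijection (R := R) (X := X) hm h
  exact ⟨φ, hφ, fun f => ⟨himg f, by rw [himg f]⟩⟩
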